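/- **Setting.** Let $\Lambda$ be a $k$-graph ($k\ge 0$): a nonempty countable small category with a functor $d:\Lambda\to\mathbb N^k$ such that every $\lambda$ with $d(\lambda)=m+n$ factors uniquely as $\lambda=\mu\nu$ with $d(\mu)=m$, $d(\nu)=n$. Assume that $\Lambda$ is row-finite without sources, i.e. $v\Lambda^n$ is finite and nonempty for every vertex $v$ and $n\in\mathbb N^k$. Let $\Lambda^\infty$ be the set of infinite paths (degree-preserving functors $x:\Omega_k\to\Lambda$, where $\Omega_k=\{(m,n)\in\mathbb N^k\times\mathbb N^k: m\le n\}$), with shifts $\sigma^p(x)(m,n)=x(m+p,n+p)$; write $x=\lambda z$ if $x(0,d(\lambda))=\lambda$ and $\sigma^{d(\lambda)}(x)=z$. The path groupoid $\mathcal G_\Lambda$ consists of the triples $(x,n,y)\in\Lambda^\infty\times\mathbb Z^k\times\Lambda^\infty$ with $\sigma^\ell(x)=\sigma^m(y)$ and $n=\ell-m$ for some $\ell,m\in\mathbb N^k$, with range $x$, source $y$, product $(x,n,y)(y,n',z)=(x,n+n',z)$, inverse $(y,-n,x)$, and the topology with basis the sets $Z(\lambda,\mu)=\{(\lambda z,d(\lambda)-d(\mu),\mu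 z)\}$, $s(\lambda)=s(\mu)$. Let $(A,X,\chi)$ be a $\Lambda$-system of $C^*$-correspondences: a $C^*$-algebra $A_v$ for each vertex $v$, an $A_{r(\lambda)}$–$A_{s(\lambda)}$ correspondence $X_\lambda$ for each $\lambda\in\Lambda$ (a right Hilbert $A_{s(\lambda)}$-module with a $*$-homomorphism $\phi_\lambda:A_{r(\lambda)}\to\mathcal L(X_\lambda)$), with $X_v=A_v$ for vertices $v$, and morphisms of correspondences $\chi_{\alpha,\beta}:X_\alpha\otimes_{A_{s(\alpha)}}X_\beta\to X_{\alpha\beta}$ for composable $\alpha,\beta$, which are isomorphisms if $\alpha$ is not a vertex, are associative, and satisfy $\chi_{r(\lambda),\lambda}(a\otimes x)=\phi_\lambda(a)x$ and $\chi_{\lambda,s(\lambda)}(x\otimes a)=x\cdot a$. Assume that the system is regular: each $X_\lambda$ is full and nondegenerate, and each $\phi_\lambda$ is injective with values in the compact operators $\mathcal K(X_\lambda)$. For $g=(x,n,y)\in\mathcal G_\Lambda$ let $D_g$ be the set of pairs $(\lambda,\mu)$ such that $x=\lambda z$, $y=\mu z$ for some $z$ and $d(\lambda)-d(\mu)=n$,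 directed by $(\lambda,\mu)\le(\lambda',\mu')\iff d(\lambda)\le d(\lambda')$. Let $$E_g=\varinjlim_{(\lambda,\mu)\in D_g}\mathcal K(X_\mu,X_\lambda)$$ be the Banach space inductive limit with respect to the connecting maps $\mathcal K(X_\mu,X_\lambda)\to\mathcal K(X_{\mu\nu},X_{\lambda\nu})$ that send $T$ to the operator $\chi_{\mu,\nu}(x\otimes y)\mapsto\chi_{\lambda,\nu}(Tx\otimes y)$, let $i^g_{\lambda,\mu}:\mathcal K(X_\mu,X_\lambda)\to E_g$ be the canonical maps, and let $E_X=\bigsqcup_{g\in\mathcal G_\Lambda}E_g$. **Theorem 4.3.1.** The canonical maps $i^g_{\lambda,\mu}$ are isometric. There are * unique bounded bilinear maps $E_g\times E_h\to E_{gh}$, for composable $g,h$, such that $i^{g}_{\lambda_1,\lambda_2}(T_1)\,i^{h}_{\lambda_2,\lambda_3}(T_2)=i^{gh}_{\lambda_1,\lambda_3}(T_1T_2)$ whenever $g\in Z(\lambda_1,\lambda_2)$, $h\in Z(\lambda_2,\lambda_3)$, $T_1\in\mathcal K(X_{\lambda_2},X_{\lambda_1})$, $T_2\in\mathcal K(X_{\lambda_3},X_{\lambda_2})$;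 * unique conjugate-linear isometries $e\mapsto e^*$, $E_g\to E_{g^{-1}}$, such that $i^g_{\lambda,\mu}(T)^*=i^{g^{-1}}_{\mu,\lambda}(T^*)$ whenever $g\in Z(\lambda,\mu)$ and $T\in\mathcal K(X_\mu,X_\lambda)$; * a unique topology on $E_X$ for which $E_X\to\mathcal G_\Lambda$ is a Banach bundle and all sections $f_T^{\lambda,\mu}$ ($s(\lambda)=s(\mu)$, $T\in\mathcal K(X_\mu,X_\lambda)$) and their linear combinations are continuous, where $f_T^{\lambda,\mu}(g)=i^g_{\lambda,\mu}(T)$ for $g\in Z(\lambda,\mu)$ and $f_T^{\lambda,\mu}(g)=0$ otherwise. With this multiplication, involution and topology, $E_X$ is a saturated Fell bundle over the locally compact Hausdorff groupoid $\mathcal G_\Lambda$. That is, $E_X$ is a Banach bundle; multiplication and involution are continuous; multiplication is bilinear on fibres, associative and submultiplicative in norm; the involution is conjugate-linear on fibres, $e^{**}=e$ and $(e_1e_2)^*=e_2^*e_1^*$; $\|e^*e\|=\|e\|^2$, and $e^*e$ is positive in the $C^*$-algebra $E_{s(g)}$ for $e\in E_g$; and $E_g\cdot E_h$ has dense linear span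 in $E_{gh}$ for all composable $g,h$. -/

import Mathlib

open CategoryTheory Filter Topology
open scoped ENNReal

universe u v w₁ w₂

noncomputable section

namespace GraphCorr

/-! ## Hilbert modules and correspondences

`CStarModule` in the library is left-handed (`⟪x, a • y⟫ = a * ⟪x, y⟫`); correspondences need
right Hilbert modules, which are therefore defined here. -/

/-- The structure of a right Hilbert `B`-module on a Banach space `X`, whose norm is the one given
by the `B`-valued inner product. (An element of a C*-algebra is positive if and only if it has the
form `b⋆ b`.) -/
class RightHilbertModule (B : Type*) (X : Type*) [NonUnitalCStarAlgebra B]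
    [NormedAddCommGroup X] [NormedSpace ℂ X] [CompleteSpace X] where
  /-- the right action `x · b` -/
  rmul : X → B → X
  /-- the inner product `⟨x, y⟩`, linear in the second variable -/
  hinner : X → X → B
  add_rmul : ∀ x y b, rmul (x + y) b = rmul x b + rmul y b
  rmul_add : ∀ x b c, rmul x (b + c) = rmul x b + rmul x c
  rmul_rmul : ∀ x b c, rmul (rmul x b) c = rmul x (b * c)
  smul_rmul : ∀ (t : ℂ) x b, rmul (t • x) b = t • rmul x b
  rmul_smul : ∀ (t : ℂ) x b, rmul x (t • b) = t • rmul x b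
  hinner_add : ∀ x y z, hinner x (y + z) = hinner x y + hinner x z
  hinner_smul : ∀ (t : ℂ) x y, hinner x (t • y) = t • hinner x y
  hinner_rmul : ∀ x y b, hinner x (rmul y b) = hinner x y * b
  star_hinner : ∀ x y, star (hinner x y) = hinner y x
  hinner_self_pos : ∀ x, ∃ b, hinner x x = star b * b
  norm_sq_eq : ∀ x, ‖x‖ ^ 2 = ‖hinner x x‖

open RightHilbertModule

/-- The structure of an `A`-`B` C*-correspondence on a right Hilbert `B`-module `X`: a
homomorphism `φ` from `A` to the bounded operators on `X` such that `φ (a⋆)` is an adjoint of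
`φ a`, that is, a `*`-homomorphism into the adjointable operators. -/
class Correspondence (A B : Type*) (X : Type*) [NonUnitalCStarAlgebra A]
    [NonUnitalCStarAlgebra B] [NormedAddCommGroup X] [NormedSpace ℂ X] [CompleteSpace X]
    [RightHilbertModule B X] where
  /-- the left action -/
  lact : A →ₙₐ[ℂ] (X →L[ℂ] X)
  lact_adjoint : ∀ (a : A) (x y : X),
    hinner (B := B) (lact a x) y = hinner (B := B) x (lact (star a) y)

section Modules

variable (B : Type*) [NonUnitalCStarAlgebra B]
  {X Y Z : Type*}
  [NormedAddCommGroup X] [NormedSpace ℂ X] [CompleteSpace X] [RightHilbertModule B X]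
  [NormedAddCommGroup Y] [NormedSpace ℂ Y] [CompleteSpace Y] [RightHilbertModule B Y]
  [NormedAddCommGroup Z] [NormedSpace ℂ Z] [CompleteSpace Z] [RightHilbertModule B Z]

/-- `S` is the adjoint of `T`. -/
def IsAdjointPair (T : X →L[ℂ] Y) (S : Y →L[ℂ] X) : Prop :=
  ∀ x y, hinner (B := B) (T x) y = hinner (B := B) x (S y)

/-- `T` is the rank-one operator `θ_{y, x} : z ↦ y · ⟨x, z⟩` for some `y` and `x`. -/
def IsRankOne (T : X →L[ℂ] Y) : Prop :=
  ∃ (y : Y) (x : X), ∀ z, T z = rmul y (hinner (B := B) x z)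

variable (X Y) in
/-- The compact operators `K(X, Y)`: the closed linear span of the rank-one operators. -/
def Compacts : Submodule ℂ (X →L[ℂ] Y) :=
  (Submodule.span ℂ {T : X →L[ℂ] Y | IsRankOne B T}).topologicalClosure

variable (X) in
/-- `X` is full: the inner products span a dense subspace of `B`. -/
def IsFull : Prop :=
  Dense (Submodule.span ℂ {b : B | ∃ x y : X, b = hinner x y} : Set B)

variable {B}

/-- Compact operators respect the right action. -/
lemma Compacts.map_rmul {T : X →L[ℂ] Y} (hT : T ∈ Compacts B X Y) (x : X) (b : B) :
    T (rmul x b) = rmul (T x) b := by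
  have hcont : Continuous fun y : Y => rmul y b := by
    have hb : ∀ y : Y, ‖rmul y b‖ ≤ ‖b‖ * ‖y‖ := by
      intro y
      have h1 : hinner (B := B) (rmul y b) (rmul y b) = star b * hinner (B := B) y y * b := by
        rw [hinner_rmul, ← star_hinner (B := B) y (rmul y b), hinner_rmul, star_mul, star_hinner]
      have h2 : ‖rmul y b‖ ^ 2 ≤ (‖b‖ * ‖y‖) ^ 2 := by
        rw [norm_sq_eq (B := B), h1, mul_pow, norm_sq_eq (B := B) y]
        calc ‖star b * hinner (B := B) y y * b‖ ≤ ‖star b‖ * ‖hinner (B := B) y y‖ * ‖b‖ :=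
              (norm_mul_le _ _).trans (mul_le_mul_of_nonneg_right (norm_mul_le _ _)
                (norm_nonneg _))
          _ = ‖b‖ ^ 2 * ‖hinner (B := B) y y‖ := by rw [norm_star]; ring
      exact (pow_le_pow_iff_left₀ (norm_nonneg _) (by positivity) two_ne_zero).1 h2
    let L : Y →ₗ[ℂ] Y :=
      { toFun := fun y => rmul y b
        map_add' := fun y z => add_rmul y z b
        map_smul' := fun t y => smul_rmul t y b }
    exact (L.mkContinuous ‖b‖ hb).continuous
  have hcl : IsClosed {S : X →L[ℂ] Y | S (rmul x b) = rmul (S x) b} :=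
    isClosed_eq (ContinuousLinearMap.apply ℂ Y (rmul x b)).continuous
      (hcont.comp (ContinuousLinearMap.apply ℂ Y x).continuous)
  refine closure_minimal ?_ hcl hT
  intro S hS
  induction hS using Submodule.span_induction with
  | mem S h =>
    obtain ⟨y, x', h⟩ := h
    simp only [Set.mem_ofPred_eq, h, hinner_rmul, rmul_rmul]
  | zero =>
    have : rmul (0 : Y) b = 0 := by simpa using smul_rmul (0 : ℂ) (0 : Y) b
    simp [this]
  | add S S' _ _ h h' =>
    simp only [Set.mem_ofPred_eq] at h h' ⊢
    simp [h, h', add_rmul]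
  | smul t S _ h =>
    simp only [Set.mem_ofPred_eq] at h ⊢
    simp [h, smul_rmul]

lemma Compacts.comp_mem {S : Y →L[ℂ] Z} {T : X →L[ℂ] Y} (hS : S ∈ Compacts B Y Z)
    (hT : T ∈ Compacts B X Y) : S.comp T ∈ Compacts B X Z := by
  let L : (X →L[ℂ] Y) →L[ℂ] (X →L[ℂ] Z) := ContinuousLinearMap.compL ℂ X Y Z S
  have hcl : IsClosed {R : X →L[ℂ] Y | L R ∈ Compacts B X Z} :=
    (Submodule.isClosed_topologicalClosure _).preimage L.continuous
  refine closure_minimal (s := (Submodule.span ℂ {R : X →L[ℂ] Y | IsRankOne B R} :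
    Set (X →L[ℂ] Y))) ?_ hcl hT
  have : Submodule.span ℂ {R : X →L[ℂ] Y | IsRankOne B R} ≤
      (Compacts B X Z).comap (L : (X →L[ℂ] Y) →ₗ[ℂ] (X →L[ℂ] Z)) := by
    refine Submodule.span_le.2 ?_
    rintro R ⟨y, x, h⟩
    refine Submodule.le_topologicalClosure _ (Submodule.subset_span ⟨S y, x, fun z => ?_⟩)
    change S (R z) = _
    rw [h, Compacts.map_rmul hS]
  exact this

/-- The composition `S T` of compact operators. -/
def Compacts.comp (S : Compacts B Y Z) (T : Compacts B X Y) : Compacts B X Z :=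
  ⟨(S : Y →L[ℂ] Z).comp (T : X →L[ℂ] Y), Compacts.comp_mem S.2 T.2⟩

variable (A : Type*) [NonUnitalCStarAlgebra A]

variable (B X) in
/-- `X` is nondegenerate: the elements `φ(a) x` span a dense subspace. -/
def IsNondegenerate [Correspondence A B X] : Prop :=
  Dense (Submodule.span ℂ {z : X | ∃ (a : A) (x : X), z = Correspondence.lact B a x} : Set X)

variable {A}

/-- Let `X` be an `A`-`B` correspondence, `Y` a `B`-`C` correspondence and `Z` an `A`-`C`
correspondence. A bilinear map `t : X × Y → Z` is a tensor map if it comes from a morphism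
`X ⊗_B Y → Z`, `x ⊗ y ↦ t x y`, of `A`-`C` correspondences: it is balanced over `B`, respects the
two actions, and carries the inner product `⟨x ⊗ y, x' ⊗ y'⟩ = ⟨y, ⟨x, x'⟩ · y'⟩` of the interior
tensor product to that of `Z`. Recall that `X ⊗_B Y` is the Hausdorff completion of the algebraic
tensor product for this inner product. -/
structure IsTensorMap (A B C : Type*) [NonUnitalCStarAlgebra A] [NonUnitalCStarAlgebra B]
    [NonUnitalCStarAlgebra C] {X Y Z : Type*}
    [NormedAddCommGroup X] [NormedSpace ℂ X] [CompleteSpace X] [RightHilbertModule B X]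
    [Correspondence A B X]
    [NormedAddCommGroup Y] [NormedSpace ℂ Y] [CompleteSpace Y] [RightHilbertModule C Y]
    [Correspondence B C Y]
    [NormedAddCommGroup Z] [NormedSpace ℂ Z] [CompleteSpace Z] [RightHilbertModule C Z]
    [Correspondence A C Z]
    (t : X →ₗ[ℂ] Y →ₗ[ℂ] Z) : Prop where
  balanced : ∀ (x : X) (b : B) (y : Y), t (rmul x b) y = t x (Correspondence.lact C b y)
  lact_apply : ∀ (a : A) (x : X) (y : Y),
    Correspondence.lact C a (t x y) = t (Correspondence.lact B a x) y
  rmul_apply : ∀ (x : X) (y : Y) (c : C), rmul (t x y) c = t x (rmul y c)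
  hinner_apply : ∀ (x x' : X) (y y' : Y), hinner (B := C) (t x y) (t x' y') =
    hinner (B := C) y (Correspondence.lact C (hinner (B := B) x x') y')

/-- The elements `t x y` span a dense subspace. A tensor map is an isometry of `X ⊗_B Y` into `Z`,
so this says that it is an isomorphism of `X ⊗_B Y` onto `Z`. -/
def HasDenseSpan {X Y Z : Type*} [AddCommGroup X] [Module ℂ X] [AddCommGroup Y] [Module ℂ Y]
    [NormedAddCommGroup Z] [NormedSpace ℂ Z] (t : X →ₗ[ℂ] Y →ₗ[ℂ] Z) : Prop :=
  Dense (Submodule.span ℂ {z : Z | ∃ x y, z = t x y} : Set Z)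

end Modules

/-! ## Higher-rank graphs and the path groupoid -/

/-- A `k`-graph: a nonempty countable small category with a degree functor to `ℕ^k` that has the
factorisation property. The objects are the vertices. A path `α` with range `r(α)` and source
`s(α)` is written as a morphism `r(α) ⟶ s(α)`, so that the product `αβ`, which is defined if
`s(α) = r(β)`, is `α ≫ β`. -/
class KGraph (k : ℕ) (V : Type u) [Category.{v} V] where
  nonempty : Nonempty V
  countable_obj : Countable V
  countable_hom : ∀ a b : V, Countable (a ⟶ b)
  /-- the degree of a path -/
  deg : ∀ {a b : V}, (a ⟶ b) → (Fin k → ℕ)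
  deg_id : ∀ a : V, deg (𝟙 a) = 0
  deg_comp : ∀ {a b c : V} (α : a ⟶ b) (β : b ⟶ c), deg (α ≫ β) = deg α + deg β
  factorisation : ∀ {a c : V} (γ : a ⟶ c) (m n : Fin k → ℕ), deg γ = m + n →
    ∃! p : Σ b : V, (a ⟶ b) × (b ⟶ c), deg p.2.1 = m ∧ deg p.2.2 = n ∧ p.2.1 ≫ p.2.2 = γ

section Paths

variable (k : ℕ) (V : Type u) [Category.{v} V] [KGraph k V]

/-- `Λ` is row-finite and has no sources: `vΛ^n` is finite and nonempty for all `v` and `n`. -/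
def RowFiniteNoSources : Prop :=
  ∀ (a : V) (n : Fin k → ℕ),
    {p : Σ b : V, a ⟶ b | KGraph.deg (k := k) p.2 = n}.Finite ∧
    {p : Σ b : V, a ⟶ b | KGraph.deg (k := k) p.2 = n}.Nonempty

/-- An infinite path `x`: a degree-preserving functor from `Ω_k` to the `k`-graph. Here `obj m` is
`x(m)`, and `map` gives `x(m, n)` for `m ≤ n`. -/
@[ext]
structure InfinitePath where
  obj : (Fin k → ℕ) → V
  map : ∀ {m n : Fin k → ℕ}, m ≤ n → (obj m ⟶ obj n)
  map_id : ∀ m : Fin k → ℕ, map (le_refl m) = 𝟙 (obj m)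
  map_comp : ∀ {m n p : Fin k → ℕ} (h : m ≤ n) (h' : n ≤ p),
    map (h.trans h') = map h ≫ map h'
  deg_map : ∀ {m n : Fin k → ℕ} (h : m ≤ n), KGraph.deg (k := k) (map h) = n - m

/-- A path together with its range and source. -/
@[ext]
structure Path (V : Type u) [Category.{v} V] where
  {rng src : V}
  hom : rng ⟶ src

variable {k V}

/-- The shift `σ^p(x)(m, n) = x(m + p, n + p)`. -/
def InfinitePath.shift (p : Fin k → ℕ) (x : InfinitePath k V) : InfinitePath k V where
  obj m := x.obj (m + p)
  map h := x.map (add_le_add_left h p)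
  map_id _ := x.map_id _
  map_comp _ _ := x.map_comp _ _
  deg_map {m n} h := by
    rw [x.deg_map]
    ext i
    exact Nat.add_sub_add_right (n i) (p i) (m i)

/-- `x = α z`: that is, `x(0, d(α)) = α` and `σ^{d(α)}(x) = z`. -/
def InfinitePath.IsConcat {a b : V} (α : a ⟶ b) (z x : InfinitePath k V) : Prop :=
  Path.mk (x.map (zero_le : 0 ≤ KGraph.deg (k := k) α)) = Path.mk α ∧
    x.shift (KGraph.deg (k := k) α) = z

lemma InfinitePath.shift_shift (p q : Fin k → ℕ) (x : InfinitePath k V) :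
    (x.shift p).shift q = x.shift (q + p) := by
  have key : ∀ {f g : (Fin k → ℕ) → (Fin k → ℕ)} (hfg : f = g)
      (hf : ∀ {m n}, m ≤ n → f m ≤ f n) (hg : ∀ {m n}, m ≤ n → g m ≤ g n),
      HEq (fun {m n : Fin k → ℕ} (h : m ≤ n) => x.map (hf h))
        (fun {m n : Fin k → ℕ} (h : m ≤ n) => x.map (hg h)) := by
    intro f g hfg hf hg
    subst hfg
    rfl
  have hfg : (fun m : Fin k → ℕ => m + q + p) = fun m => m + (q + p) := by
    funext m
    exact add_assoc m q p
  apply InfinitePath.ext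
  · funext m
    exact congrArg x.obj (add_assoc m q p)
  · exact key hfg (fun h => add_le_add_left (add_le_add_left h q) p)
      (fun h => add_le_add_left h (q + p))

/-- The integer vector `ℓ - m` for `ℓ, m ∈ ℕ^k`. -/
def degDiff (l m : Fin k → ℕ) : Fin k → ℤ := fun i => (l i : ℤ) - (m i : ℤ)

/-- The path groupoid of `Λ`: its unit space is the space of infinite paths, and the elements with
range `x` and source `y` are the triples `(x, n, y)` such that `σ^ℓ(x) = σ^m(y)` and `n = ℓ - m` for
some `ℓ` and `m`. The product of `g = (x, n, y)` and `h = (y, n', z)` is `g ≫ h = (x, n + n', z)`,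
and the inverse of `(x, n, y)` is `(y, -n, x)`. -/
instance pathGroupoid : Groupoid (InfinitePath k V) where
  Hom x y := {n : Fin k → ℤ // ∃ l m, x.shift l = y.shift m ∧ n = degDiff l m}
  id x := ⟨0, 0, 0, rfl, by funext i; simp [degDiff]⟩
  comp {x y z} g h := ⟨g.1 + h.1, by
    obtain ⟨n, l, m, e, rfl⟩ := g
    obtain ⟨n', l', m', e', rfl⟩ := h
    refine ⟨l' + l, m + m', ?_, ?_⟩
    · rw [← InfinitePath.shift_shift, e, InfinitePath.shift_shift, add_comm l' m,
        ← InfinitePath.shift_shift, e', InfinitePath.shift_shift]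
    · funext i
      simp only [degDiff, Pi.add_apply]
      push_cast
      ring⟩
  inv {x y} g := ⟨-g.1, by
    obtain ⟨n, l, m, e, rfl⟩ := g
    exact ⟨m, l, e.symm, by funext i; simp [degDiff]⟩⟩
  id_comp g := Subtype.ext (zero_add _)
  comp_id g := Subtype.ext (add_zero _)
  assoc f g h := Subtype.ext (add_assoc _ _ _)
  inv_comp g := Subtype.ext (neg_add_cancel _)
  comp_inv g := Subtype.ext (add_neg_cancel _)

end Paths

/-! ## Banach bundles and Fell bundles -/

/-- The elements of a groupoid, with range `rng` and source `src`. -/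
@[ext]
structure Elem (Γ : Type*) [Groupoid Γ] where
  {rng src : Γ}
  hom : rng ⟶ src

/-- The disjoint union of a family `E` of sets. -/
@[ext]
structure Total {G : Type*} (E : G → Type*) where
  base : G
  val : E base

/-- The total space `Total E` with the given topology is a Banach bundle over `G`. -/
structure IsBanachBundle {G : Type*} [TopologicalSpace G] (E : G → Type*)
    [∀ g, NormedAddCommGroup (E g)] [∀ g, NormedSpace ℂ (E g)] [∀ g, CompleteSpace (E g)]
    [TopologicalSpace (Total E)] : Prop where
  t2 : T2Space (Total E)
  continuous_base : Continuous (Total.base : Total E → G)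
  isOpenMap_base : IsOpenMap (Total.base : Total E → G)
  continuous_norm : Continuous fun e : Total E => ‖e.val‖
  /-- addition is continuous on `{(e, e') | π(e) = π(e')}`, as a subspace of the product -/
  continuous_add : Continuous[TopologicalSpace.induced
      (fun q : Total fun g => E g × E g =>
        ((⟨q.base, q.val.1⟩, ⟨q.base, q.val.2⟩) : Total E × Total E)) inferInstance,
      inferInstance] fun q : Total fun g => E g × E g => (⟨q.base, q.val.1 + q.val.2⟩ : Total E)
  continuous_smul : ∀ t : ℂ, Continuous fun e : Total E => (⟨e.base, t • e.val⟩ : Total E)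
  /-- if `‖e_i‖ → 0` and `π(e_i) → g` then `e_i → 0` in the fibre over `g` -/
  tendsto_zero : ∀ g : G, comap (fun e : Total E => ‖e.val‖) (𝓝 0) ⊓ comap Total.base (𝓝 g) ≤
    𝓝 (⟨g, 0⟩ : Total E)

section Fell

variable (Γ : Type*) [Groupoid Γ]

/-- Composable pairs of a groupoid. -/
structure ComposablePair where
  {x y z : Γ}
  fst : x ⟶ y
  snd : y ⟶ z

/-- The groupoid with the given topology on its elements is a locally compact Hausdorff
groupoid. -/
structure IsLocallyCompactHausdorffGroupoid [TopologicalSpace (Elem Γ)] : Prop where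
  t2 : T2Space (Elem Γ)
  locallyCompact : LocallyCompactSpace (Elem Γ)
  continuous_inv : Continuous fun g : Elem Γ => Elem.mk (Groupoid.inv g.hom)
  continuous_mul : Continuous[TopologicalSpace.induced
      (fun p : ComposablePair Γ => (Elem.mk p.fst, Elem.mk p.snd)) inferInstance, inferInstance]
    fun p : ComposablePair Γ => Elem.mk (p.fst ≫ p.snd)

variable {Γ}

/-- The set `E^(2)` of pairs of elements of `E` over composable pairs of the groupoid. -/
structure BundlePair (E : Elem Γ → Type*) where
  {x y z : Γ}
  fst : x ⟶ y
  snd : y ⟶ z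
  e₁ : E ⟨fst⟩
  e₂ : E ⟨snd⟩

/-- The Banach bundle `E` over the groupoid, with the given multiplication, involution and
topology, is a Fell bundle. That products of elements over `g` and `h` lie over `gh`, and adjoints
of elements over `g` over `g⁻¹`, is expressed by the types of `mul` and `adj`. -/
structure IsFellBundle [TopologicalSpace (Elem Γ)] (E : Elem Γ → Type*)
    [∀ g, NormedAddCommGroup (E g)] [∀ g, NormedSpace ℂ (E g)] [∀ g, CompleteSpace (E g)]
    [TopologicalSpace (Total E)]
    (mul : ∀ {x y z : Γ} (g : x ⟶ y) (h : y ⟶ z), E ⟨g⟩ → E ⟨h⟩ → E ⟨g ≫ h⟩)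
    (adj : ∀ {x y : Γ} (g : x ⟶ y), E ⟨g⟩ → E ⟨Groupoid.inv g⟩) : Prop where
  base_groupoid : IsLocallyCompactHausdorffGroupoid Γ
  banach_bundle : IsBanachBundle E
  continuous_mul : Continuous[TopologicalSpace.induced
      (fun p : BundlePair E => ((⟨_, p.e₁⟩, ⟨_, p.e₂⟩) : Total E × Total E)) inferInstance,
      inferInstance] fun p : BundlePair E => (⟨_, mul p.fst p.snd p.e₁ p.e₂⟩ : Total E)
  add_mul : ∀ {x y z : Γ} (g : x ⟶ y) (h : y ⟶ z) (a a' : E ⟨g⟩) (b : E ⟨h⟩),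
    mul g h (a + a') b = mul g h a b + mul g h a' b
  mul_add : ∀ {x y z : Γ} (g : x ⟶ y) (h : y ⟶ z) (a : E ⟨g⟩) (b b' : E ⟨h⟩),
    mul g h a (b + b') = mul g h a b + mul g h a b'
  smul_mul : ∀ {x y z : Γ} (g : x ⟶ y) (h : y ⟶ z) (t : ℂ) (a : E ⟨g⟩) (b : E ⟨h⟩),
    mul g h (t • a) b = t • mul g h a b
  mul_smul : ∀ {x y z : Γ} (g : x ⟶ y) (h : y ⟶ z) (t : ℂ) (a : E ⟨g⟩) (b : E ⟨h⟩),
    mul g h a (t • b) = t • mul g h a b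
  mul_assoc : ∀ {w x y z : Γ} (g : w ⟶ x) (h : x ⟶ y) (l : y ⟶ z)
    (a : E ⟨g⟩) (b : E ⟨h⟩) (c : E ⟨l⟩),
    (⟨_, mul (g ≫ h) l (mul g h a b) c⟩ : Total E) = ⟨_, mul g (h ≫ l) a (mul h l b c)⟩
  norm_mul_le : ∀ {x y z : Γ} (g : x ⟶ y) (h : y ⟶ z) (a : E ⟨g⟩) (b : E ⟨h⟩),
    ‖mul g h a b‖ ≤ ‖a‖ * ‖b‖
  continuous_adj : Continuous fun e : Total E => (⟨_, adj e.base.hom e.val⟩ : Total E)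
  adj_add : ∀ {x y : Γ} (g : x ⟶ y) (a b : E ⟨g⟩), adj g (a + b) = adj g a + adj g b
  adj_smul : ∀ {x y : Γ} (g : x ⟶ y) (t : ℂ) (a : E ⟨g⟩), adj g (t • a) = star t • adj g a
  adj_adj : ∀ {x y : Γ} (g : x ⟶ y) (a : E ⟨g⟩),
    (⟨_, adj _ (adj g a)⟩ : Total E) = ⟨_, a⟩
  adj_mul : ∀ {x y z : Γ} (g : x ⟶ y) (h : y ⟶ z) (a : E ⟨g⟩) (b : E ⟨h⟩),
    (⟨_, adj _ (mul g h a b)⟩ : Total E) = ⟨_, mul _ _ (adj h b) (adj g a)⟩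
  norm_adj_mul_self : ∀ {x y : Γ} (g : x ⟶ y) (a : E ⟨g⟩), ‖mul _ _ (adj g a) a‖ = ‖a‖ ^ 2
  /-- `a⋆ a` is positive in the C*-algebra `E_{s(g)}`, that is, of the form `b⋆ b` with `b` in
  the fibre over the unit `s(g)` -/
  adj_mul_self_pos : ∀ {x y : Γ} (g : x ⟶ y) (a : E ⟨g⟩), ∃ b : E ⟨𝟙 y⟩,
    (⟨_, mul _ _ (adj g a) a⟩ : Total E) = ⟨_, mul _ _ (adj (𝟙 y) b) b⟩

/-- Saturation: the products of elements over `g` and over `h` are total in the fibre over `gh`. -/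
def IsSaturated (E : Elem Γ → Type*)
    [∀ g, NormedAddCommGroup (E g)] [∀ g, NormedSpace ℂ (E g)]
    (mul : ∀ {x y z : Γ} (g : x ⟶ y) (h : y ⟶ z), E ⟨g⟩ → E ⟨h⟩ → E ⟨g ≫ h⟩) : Prop :=
  ∀ {x y z : Γ} (g : x ⟶ y) (h : y ⟶ z),
    Dense (Submodule.span ℂ {e : E ⟨g ≫ h⟩ | ∃ a b, e = mul g h a b} : Set (E ⟨g ≫ h⟩))

end Fell

/-! ## The topology of the path groupoid -/

section Cylinder

variable {k : ℕ} {V : Type u} [Category.{v} V] [KGraph k V]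

/-- The set `Z(α, β) = {(α z, d(α) - d(β), β z)}` for paths `α` and `β` with the same source. -/
def cylinder {a b c : V} (α : a ⟶ c) (β : b ⟶ c) : Set (Elem (InfinitePath k V)) :=
  {g | ∃ z : InfinitePath k V, InfinitePath.IsConcat α z g.rng ∧ InfinitePath.IsConcat β z g.src ∧
    g.hom.1 = degDiff (KGraph.deg (k := k) α) (KGraph.deg (k := k) β)}

/-- The topology of the path groupoid, with basis the sets `Z(α, β)`. -/
instance : TopologicalSpace (Elem (InfinitePath k V)) :=
  TopologicalSpace.generateFrom
    {U | ∃ (a b c : V) (α : a ⟶ c) (β : b ⟶ c), U = cylinder α β}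

end Cylinder

/-! ## Systems of correspondences -/

/-- A system `(A, X, χ)` of C*-correspondences over the `k`-graph `Λ`. The composite
`X_α × X_β → X_α ⊗ X_β → X_{αβ}` of `χ_{α, β}` with `(x, y) ↦ x ⊗ y` is `chi α β`. Elements of
fibres over equal paths are compared by `HEq`. -/
structure CorrSystem (k : ℕ) (V : Type u) [Category.{v} V] [KGraph k V] where
  /-- the C*-algebra of a vertex -/
  A : V → Type w₁
  [algA : ∀ a, NonUnitalCStarAlgebra (A a)]
  /-- the correspondence of a path -/
  X : ∀ {a b : V}, (a ⟶ b) → Type w₂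
  [groupX : ∀ {a b : V} (α : a ⟶ b), NormedAddCommGroup (X α)]
  [spaceX : ∀ {a b : V} (α : a ⟶ b), NormedSpace ℂ (X α)]
  [completeX : ∀ {a b : V} (α : a ⟶ b), CompleteSpace (X α)]
  [hilbertX : ∀ {a b : V} (α : a ⟶ b), RightHilbertModule (A b) (X α)]
  [corrX : ∀ {a b : V} (α : a ⟶ b), Correspondence (A a) (A b) (X α)]
  /-- the identification of `X_v` with the identity correspondence `A_v` -/
  vertexIso : ∀ a : V, X (𝟙 a) ≃ₗᵢ[ℂ] A a
  vertexIso_hinner : ∀ (a : V) (x y : X (𝟙 a)),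
    hinner (B := A a) x y = star (vertexIso a x) * vertexIso a y
  vertexIso_rmul : ∀ (a : V) (x : X (𝟙 a)) (c : A a),
    vertexIso a (rmul x c) = vertexIso a x * c
  vertexIso_lact : ∀ (a : V) (c : A a) (x : X (𝟙 a)),
    vertexIso a (Correspondence.lact (A a) c x) = c * vertexIso a x
  /-- `chi α β x y` is `χ_{α, β}(x ⊗ y)` -/
  chi : ∀ {a b c : V} (α : a ⟶ b) (β : b ⟶ c), X α →ₗ[ℂ] X β →ₗ[ℂ] X (α ≫ β)
  chi_tensor : ∀ {a b c : V} (α : a ⟶ b) (β : b ⟶ c),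
    IsTensorMap (A a) (A b) (A c) (chi α β)
  chi_iso : ∀ {a b c : V} (α : a ⟶ b) (β : b ⟶ c), KGraph.deg (k := k) α ≠ 0 →
    HasDenseSpan (chi α β)
  chi_vertex_left : ∀ {a b : V} (α : a ⟶ b) (c : A a) (x : X α),
    HEq (chi (𝟙 a) α ((vertexIso a).symm c) x) (Correspondence.lact (A b) c x)
  chi_vertex_right : ∀ {a b : V} (α : a ⟶ b) (x : X α) (c : A b),
    HEq (chi α (𝟙 b) x ((vertexIso b).symm c)) (rmul x c)
  chi_assoc : ∀ {a b c d : V} (α : a ⟶ b) (β : b ⟶ c) (γ : c ⟶ d) (x : X α) (y : X β) (z : X γ),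
    HEq (chi (α ≫ β) γ (chi α β x y) z) (chi α (β ≫ γ) x (chi β γ y z))

attribute [instance] CorrSystem.algA CorrSystem.groupX CorrSystem.spaceX CorrSystem.completeX
  CorrSystem.hilbertX CorrSystem.corrX

namespace CorrSystem

variable {k : ℕ} {V : Type u} [Category.{v} V] [KGraph k V] (S : CorrSystem.{u, v, w₁, w₂} k V)

/-- The space `K(X_β, X_α)` for paths `α` and `β` with the same source. -/
abbrev Kpt {a b c : V} (α : a ⟶ c) (β : b ⟶ c) : Submodule ℂ (S.X β →L[ℂ] S.X α) :=
  Compacts (S.A c) (S.X β) (S.X α)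

instance {a b c : V} (α : a ⟶ c) (β : b ⟶ c) : NormedAddCommGroup (S.Kpt α β) :=
  Submodule.normedAddCommGroup _

instance {a b c : V} (α : a ⟶ c) (β : b ⟶ c) : NormedSpace ℂ (S.Kpt α β) :=
  Submodule.normedSpace _

instance {a b c : V} (α : a ⟶ c) (β : b ⟶ c) : CompleteSpace (S.Kpt α β) :=
  (Submodule.isClosed_topologicalClosure _).completeSpace_coe

/-- A regular system. -/
structure IsRegular : Prop where
  rowFinite : RowFiniteNoSources k V
  nondegenerate : ∀ {a b : V} (α : a ⟶ b), IsNondegenerate (S.A b) (S.X α) (S.A a)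
  full : ∀ {a b : V} (α : a ⟶ b), IsFull (S.A b) (S.X α)
  injective : ∀ {a b : V} (α : a ⟶ b),
    Function.Injective fun c : S.A a => (Correspondence.lact (S.A b) c : S.X α →L[ℂ] S.X α)
  compact : ∀ {a b : V} (α : a ⟶ b) (c : S.A a), Correspondence.lact (S.A b) c ∈ S.Kpt α α

/-- `T'` is the image of `T` under the connecting map `K(X_β, X_α) → K(X_{βν}, X_{αν})`, that is,
the operator `T ⊗ 1` on `X_β ⊗ X_ν = X_{βν}`: it is characterised by
`T' (χ(x ⊗ y)) = χ(T x ⊗ y)`. -/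
def IsConnecting {a b c d : V} {α : a ⟶ c} {β : b ⟶ c} (ν : c ⟶ d)
    (T : S.Kpt α β) (T' : S.Kpt (α ≫ ν) (β ≫ ν)) : Prop :=
  ∀ (x : S.X β) (y : S.X ν),
    (T' : S.X (β ≫ ν) →L[ℂ] S.X (α ≫ ν)) (S.chi β ν x y) =
      S.chi α ν ((T : S.X β →L[ℂ] S.X α) x) y

end CorrSystem

/-- The set `D_g` of all pairs `(α, β)` such that `g = (α z, d(α) - d(β), β z)` for some `z`. -/
structure Decomp {k : ℕ} {V : Type u} [Category.{v} V] [KGraph k V]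
    (g : Elem (InfinitePath k V)) where
  {a b c : V}
  α : a ⟶ c
  β : b ⟶ c
  mem : g ∈ cylinder α β

section Fibre

variable {k : ℕ} {V : Type u} [Category.{v} V] [KGraph k V]

/-- The order of `D_g`: `(α, β) ≤ (α', β')` if and only if `d(α) ≤ d(α')`. -/
instance (g : Elem (InfinitePath k V)) : Preorder (Decomp g) :=
  Preorder.lift fun D => KGraph.deg (k := k) D.α

variable (S : CorrSystem.{u, v, w₁, w₂} k V) (g : Elem (InfinitePath k V))

namespace CorrSystem

/-- Bounded families in the product of the spaces `K(X_β, X_α)` over `(α, β) ∈ D_g`. -/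
abbrev BoundedFamily : Type _ := lp (fun D : Decomp g => S.Kpt D.α D.β) ∞

instance : CompleteSpace (S.BoundedFamily g) :=
  lp.completeSpace

/-- The bounded families that tend to zero in norm along the directed set `D_g`. -/
def nullFamilies : Submodule ℂ (S.BoundedFamily g) where
  carrier := {f | Tendsto (fun D => ‖f D‖) atTop (𝓝 0)}
  zero_mem' := by
    change Tendsto (fun D => ‖(0 : S.BoundedFamily g) D‖) atTop (𝓝 0)
    simpa using tendsto_const_nhds
  add_mem' {f f'} h h' := by
    refine squeeze_zero (fun D => norm_nonneg _) (fun D => ?_)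
      (by simpa using Tendsto.add h h')
    exact norm_add_le (f D) (f' D)
  smul_mem' t f h := by
    refine squeeze_zero (fun D => norm_nonneg _) (fun D => ?_)
      (by simpa using Tendsto.const_mul ‖t‖ h)
    exact (norm_smul t (show S.Kpt D.α D.β from f D)).le

instance : IsClosed (S.nullFamilies g : Set (S.BoundedFamily g)) := by
  refine isClosed_of_closure_subset fun f hf => ?_
  change Tendsto (fun D => ‖f D‖) atTop (𝓝 0)
  refine Metric.tendsto_nhds.2 fun ε hε => ?_
  obtain ⟨f', hf', hd⟩ := Metric.mem_closure_iff.1 hf (ε / 2) (by positivity)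
  have h' : Tendsto (fun D => ‖f' D‖) atTop (𝓝 0) := hf'
  filter_upwards [Metric.tendsto_nhds.1 h' (ε / 2) (by positivity)] with D hD
  have hD' : ‖f' D‖ < ε / 2 := by simpa using hD
  suffices h : ‖f D‖ < ε by simpa using h
  rw [dist_eq_norm] at hd
  have h1 : ‖(f - f') D‖ ≤ ‖f - f'‖ := lp.norm_apply_le_norm ENNReal.top_ne_zero (f - f') D
  have h2 : f D = (f - f') D + f' D := (sub_add_cancel (f D) (f' D)).symm
  calc ‖f D‖ ≤ ‖(f - f') D‖ + ‖f' D‖ := (congrArg norm h2).le.trans (norm_add_le _ _)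
    _ < ε := by linarith

/-- The Banach space of bounded families modulo null families. -/
abbrev FamilyQuotient : Type _ := S.BoundedFamily g ⧸ S.nullFamilies g

instance : NormedAddCommGroup (S.FamilyQuotient g) :=
  Submodule.Quotient.normedAddCommGroup _

instance : NormedSpace ℂ (S.FamilyQuotient g) :=
  Submodule.Quotient.normedSpace _ ℂ

instance : CompleteSpace (S.FamilyQuotient g) :=
  Submodule.Quotient.completeSpace _

variable {g} in
/-- `e` is the image of `T ∈ K(X_β, X_α)`, where `D = (α, β) ∈ D_g`, in the inductive limit: it is
the class of a bounded family whose entry at each `(αν, βν) ∈ D_g` is the image of `T` under the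
connecting map `K(X_β, X_α) → K(X_{βν}, X_{αν})`. (The pairs `(αν, βν) ∈ D_g` are the elements of
`D_g` above `(α, β)`.) -/
def IsLimitClass (D : Decomp g) (T : S.Kpt D.α D.β) (e : S.FamilyQuotient g) : Prop :=
  ∃ f : S.BoundedFamily g,
    (∀ {d : V} (ν : D.c ⟶ d) (h : g ∈ cylinder (D.α ≫ ν) (D.β ≫ ν)),
      S.IsConnecting ν T (f ⟨D.α ≫ ν, D.β ≫ ν, h⟩)) ∧
    (S.nullFamilies g).mkQ f = e

/-- The fibre `E_g`, the inductive limit of the Banach spaces `K(X_β, X_α)` over `(α, β) ∈ D_g`,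
in its usual realisation: the closed linear span, in the space of bounded families modulo null
families, of the images of all the spaces `K(X_β, X_α)`. -/
def fibreSubmodule : Submodule ℂ (S.FamilyQuotient g) :=
  (Submodule.span ℂ {e : S.FamilyQuotient g |
    ∃ (D : Decomp g) (T : S.Kpt D.α D.β), S.IsLimitClass D T e}).topologicalClosure

/-- The fibre `E_g` as a type. -/
def Fibre : Type _ := S.fibreSubmodule g

instance : NormedAddCommGroup (S.Fibre g) :=
  inferInstanceAs (NormedAddCommGroup (S.fibreSubmodule g))

instance : NormedSpace ℂ (S.Fibre g) :=
  inferInstanceAs (NormedSpace ℂ (S.fibreSubmodule g))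

instance : CompleteSpace (S.Fibre g) :=
  (Submodule.isClosed_topologicalClosure _).completeSpace_coe

variable {g} in
/-- The inclusion of `E_g` into the space of bounded families modulo null families. -/
def Fibre.toQuotient (e : S.Fibre g) : S.FamilyQuotient g :=
  (show S.fibreSubmodule g from e : S.FamilyQuotient g)

/-! ### The canonical maps, the multiplication, the involution and the topology -/

/-- The type of families of isometric linear maps `i^g_{α, β} : K(X_β, X_α) → E_g`. -/
abbrev EmbeddingFamily : Type _ :=
  ∀ (g : Elem (InfinitePath k V)) (D : Decomp g), S.Kpt D.α D.β →ₗᵢ[ℂ] S.Fibre g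

/-- The `i g D` are the canonical maps into the inductive limits. -/
def IsCanonicalEmbedding (i : S.EmbeddingFamily) : Prop :=
  ∀ (g : Elem (InfinitePath k V)) (D : Decomp g) (T : S.Kpt D.α D.β),
    S.IsLimitClass D T (Fibre.toQuotient S (i g D T))

/-- The type of families of bounded bilinear maps `E_g × E_h → E_{gh}`. -/
abbrev MulFamily : Type _ :=
  ∀ ⦃x y z : InfinitePath k V⦄ (g : x ⟶ y) (h : y ⟶ z),
    S.Fibre ⟨g⟩ →L[ℂ] S.Fibre ⟨h⟩ →L[ℂ] S.Fibre ⟨g ≫ h⟩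

/-- The type of families of conjugate-linear isometries `E_g → E_{g⁻¹}`. -/
abbrev AdjFamily : Type _ :=
  ∀ ⦃x y : InfinitePath k V⦄ (g : x ⟶ y), S.Fibre ⟨g⟩ →ₗᵢ⋆[ℂ] S.Fibre ⟨Groupoid.inv g⟩

end CorrSystem

end Fibre

section Operations

variable {k : ℕ} {V : Type u} [Category.{v} V] [KGraph k V]

lemma mem_cylinder_comp {x y z : InfinitePath k V} {g : x ⟶ y} {h : y ⟶ z} {a b c d : V}
    {α : a ⟶ d} {β : b ⟶ d} {γ : c ⟶ d}
    (hg : Elem.mk g ∈ cylinder α β) (hh : Elem.mk h ∈ cylinder β γ) :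
    Elem.mk (g ≫ h) ∈ cylinder α γ := by
  obtain ⟨p, h1, h2, h3⟩ := hg
  obtain ⟨q, h4, h5, h6⟩ := hh
  have hpq : p = q := h2.2.symm.trans h4.2
  subst hpq
  refine ⟨p, h1, h5, ?_⟩
  change g.1 + h.1 = _
  change g.1 = _ at h3
  change h.1 = _ at h6
  rw [h3, h6]
  funext i
  simp [degDiff]

lemma mem_cylinder_inv {x y : InfinitePath k V} {g : x ⟶ y} {a b d : V}
    {α : a ⟶ d} {β : b ⟶ d} (hg : Elem.mk g ∈ cylinder α β) :
    Elem.mk (Groupoid.inv g) ∈ cylinder β α := by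
  obtain ⟨p, h1, h2, h3⟩ := hg
  refine ⟨p, h2, h1, ?_⟩
  change -g.1 = _
  change g.1 = _ at h3
  rw [h3]
  funext i
  simp [degDiff]

variable (S : CorrSystem.{u, v, w₁, w₂} k V)

namespace CorrSystem

/-- The multiplication is determined by `i^g_{α, β}(T) i^h_{β, γ}(T') = i^{gh}_{α, γ}(T T')`
for `g = (α z, d(α) - d(β), β z)` and `h = (β z, d(β) - d(γ), γ z)`. -/
def IsMultiplication (i : S.EmbeddingFamily) (mul : S.MulFamily) : Prop :=
  ∀ {x y z : InfinitePath k V} (g : x ⟶ y) (h : y ⟶ z) {a b c d : V}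
    (α : a ⟶ d) (β : b ⟶ d) (γ : c ⟶ d)
    (hg : Elem.mk g ∈ cylinder α β) (hh : Elem.mk h ∈ cylinder β γ)
    (T : S.Kpt α β) (T' : S.Kpt β γ),
    mul g h (i ⟨g⟩ ⟨α, β, hg⟩ T) (i ⟨h⟩ ⟨β, γ, hh⟩ T') =
      i ⟨g ≫ h⟩ ⟨α, γ, mem_cylinder_comp hg hh⟩ (Compacts.comp T T')

/-- The involution is determined by `i^g_{α, β}(T)⋆ = i^{g⁻¹}_{β, α}(T⋆)`. -/
def IsInvolution (i : S.EmbeddingFamily) (adj : S.AdjFamily) : Prop :=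
  ∀ {x y : InfinitePath k V} (g : x ⟶ y) {a b d : V} (α : a ⟶ d) (β : b ⟶ d)
    (hg : Elem.mk g ∈ cylinder α β) (T : S.Kpt α β) (T' : S.Kpt β α),
    IsAdjointPair (S.A d) (T : S.X β →L[ℂ] S.X α) (T' : S.X α →L[ℂ] S.X β) →
    adj g (i ⟨g⟩ ⟨α, β, hg⟩ T) = i ⟨Groupoid.inv g⟩ ⟨β, α, mem_cylinder_inv hg⟩ T'

open Classical in
/-- The section `f_T^{α, β}`, with value `i^g_{α, β}(T)` at `g ∈ Z(α, β)` and `0` elsewhere. -/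
def basicSection (i : S.EmbeddingFamily) {a b d : V} (α : a ⟶ d) (β : b ⟶ d) (T : S.Kpt α β)
    (g : Elem (InfinitePath k V)) : S.Fibre g :=
  if hg : g ∈ cylinder α β then i g ⟨α, β, hg⟩ T else 0

/-- The linear span of the sections `f_T^{α, β}`. -/
def sections (i : S.EmbeddingFamily) : Submodule ℂ (∀ g, S.Fibre g) :=
  Submodule.span ℂ {f | ∃ (a b d : V) (α : a ⟶ d) (β : b ⟶ d) (T : S.Kpt α β),
    f = S.basicSection i α β T}

/-- The topology is determined by the requirements that the total space is a Banach bundle and that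
the members of `sections` are continuous. -/
def IsBundleTopology (i : S.EmbeddingFamily) (τ : TopologicalSpace (Total S.Fibre)) : Prop :=
  IsBanachBundle S.Fibre ∧
    ∀ f ∈ S.sections i, Continuous fun g => (⟨g, f g⟩ : Total S.Fibre)

end CorrSystem

end Operations

end GraphCorr

end

/-! The heart of the matter is the operator `T ⊗ 1` on `X_β ⊗ X_ν = X_{βν}` attached to a compact `T
: X_β → X_α`. It is contractive for every adjointable `T` (`PreservesHinner.norm_rTensor_le`). It is
compact because the left action on `X_ν` is by compact operators (`IsTensorOne.mem_compacts`). It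
does not decrease norms because that action, being injective, is isometric (`IsTensorOne.norm_ge`).
Hence the connecting maps are isometries, and they respect composition and adjoints.

A pair in `D_g` consists of initial segments of the range and the source of `g`. Unique
factorisation shows that everything above `(α, β)` has the form `(αν, βν)` with one `ν` for each
degree (`Decomp.exists_eq_extend`). So `D_g` is directed, the canonical maps are isometric
(`norm_mkQ_transitionFamily`), and `E_g` is the completion of a directed union of spaces of compact
operators (`IsCanonicalEmbedding.dense`).

Elements over composable `g` and `h` can be approximated by operators whose decompositions share the
middle path (`Decomp.exists_composable`). Composition and adjoint of operators therefore define the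
operations on dense subspaces, and bounded extension does the rest. Each algebraic axiom is a closed
condition that holds for compact operators. Positivity holds because `T⋆ T` is positive in the
compact operators and the positive cone of `E_{s(g)}` is closed. Saturation comes from fullness of
the middle correspondence (`Compacts.mem_of_forall_comp_mem`).

For the topology, `D_g` also indexes a neighbourhood base of `g`. Row-finiteness makes the cylinders
compact, hence closed as well as open, so near `g` each section is given by a single operator and
has locally constant norm. A space of sections with continuous norms and dense values carries
exactly one Banach bundle topology in which its members are continuous
(`IsGeneratingSections.isBanachBundle`, `IsGeneratingSections.eq_sectionTopology`). Multiplication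
and involution carry such sections to such sections on cylinders, which makes them continuous. -/

set_option linter.unusedSectionVars false

noncomputable section

namespace GraphCorr

open RightHilbertModule

/-! ## Hilbert modules -/

section HilbertModules

variable {B : Type*} [NonUnitalCStarAlgebra B]
  {X Y Z : Type*}
  [NormedAddCommGroup X] [NormedSpace ℂ X] [CompleteSpace X] [RightHilbertModule B X]
  [NormedAddCommGroup Y] [NormedSpace ℂ Y] [CompleteSpace Y] [RightHilbertModule B Y]
  [NormedAddCommGroup Z] [NormedSpace ℂ Z] [CompleteSpace Z] [RightHilbertModule B Z]

lemma hinner_add_left (x y z : X) :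
    hinner (B := B) (x + y) z = hinner (B := B) x z + hinner (B := B) y z := by
  rw [← star_hinner z (x + y), hinner_add, star_add, star_hinner, star_hinner]

lemma hinner_smul_left (t : ℂ) (x y : X) :
    hinner (B := B) (t • x) y = star t • hinner (B := B) x y := by
  rw [← star_hinner y (t • x), hinner_smul, star_smul, star_hinner]

lemma hinner_rmul_left (x y : X) (b : B) :
    hinner (B := B) (rmul x b) y = star b * hinner (B := B) x y := by
  rw [← star_hinner y (rmul x b), hinner_rmul, star_mul, star_hinner]

variable (B) in
/-- The inner product with a fixed first argument, as a linear map. -/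
def hinnerₗ (x : X) : X →ₗ[ℂ] B where
  toFun := hinner x
  map_add' := hinner_add x
  map_smul' t := hinner_smul t x

lemma hinner_sub_right (x y z : X) :
    hinner (B := B) x (y - z) = hinner (B := B) x y - hinner (B := B) x z :=
  map_sub (hinnerₗ B x) y z

lemma hinner_zero_right (x : X) : hinner (B := B) x 0 = 0 :=
  map_zero (hinnerₗ B x)

lemma hinner_sub_left (x y z : X) :
    hinner (B := B) (x - y) z = hinner (B := B) x z - hinner (B := B) y z := by
  rw [← star_hinner z (x - y), hinner_sub_right, star_sub, star_hinner, star_hinner]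

lemma hinner_zero_left (x : X) : hinner (B := B) 0 x = 0 := by
  rw [← star_hinner, hinner_zero_right, star_zero]

lemma hinner_self_eq_zero {x : X} : hinner (B := B) x x = 0 ↔ x = 0 := by
  refine ⟨fun h => ?_, fun h => by rw [h, hinner_zero_left]⟩
  have := norm_sq_eq (B := B) x
  rw [h, norm_zero] at this
  simpa using this

lemma hinner_self_nonneg [PartialOrder B] [StarOrderedRing B] (x : X) :
    0 ≤ hinner (B := B) x x := by
  obtain ⟨b, hb⟩ := hinner_self_pos (B := B) x
  rw [hb]
  exact star_mul_self_nonneg b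

/-- The Cauchy-Schwarz inequality. -/
lemma norm_hinner_le (x y : X) : ‖hinner (B := B) x y‖ ≤ ‖x‖ * ‖y‖ := by
  let _ := CStarAlgebra.spectralOrder B
  have := CStarAlgebra.spectralOrderedRing B
  rcases eq_or_ne x 0 with rfl | hx
  · simp [hinner_zero_left]
  set a := hinner (B := B) x y with ha
  have hsa : star a = hinner (B := B) y x := star_hinner x y
  set c : ℝ := ‖x‖ ^ 2 with hc
  have hc0 : 0 < c := by positivity
  have hx2 : ‖hinner (B := B) x x‖ = c := (norm_sq_eq x).symm
  -- This is the inner square of `x · a - c y`, with `a = ⟨x, y⟩` and `c = ‖x‖²`.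
  have key : 0 ≤ star a * hinner (B := B) x x * a - (c : ℂ) • (star a * a)
      - (c : ℂ) • (star a * a) + (c : ℂ) • (c : ℂ) • hinner (B := B) y y := by
    have : hinner (B := B) (rmul x a - (c : ℂ) • y) (rmul x a - (c : ℂ) • y) =
        star a * hinner (B := B) x x * a - (c : ℂ) • (star a * a)
      - (c : ℂ) • (star a * a) + (c : ℂ) • (c : ℂ) • hinner (B := B) y y := by
      simp only [hinner_sub_left, hinner_sub_right, hinner_smul, hinner_smul_left, hinner_rmul,
        hinner_rmul_left, ← ha, ← hsa, RCLike.star_def, Complex.conj_ofReal, smul_sub,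
        sub_mul, smul_mul_assoc]
      abel
    rw [← this]
    exact hinner_self_nonneg _
  -- Since `⟨x, x⟩` has norm `c`, the first term of `key` is absorbed by one of the two cross terms.
  have h1 : star a * hinner (B := B) x x * a ≤ (c : ℂ) • (star a * a) := by
    have := CStarAlgebra.star_left_conjugate_le_norm_smul (a := a)
      (b := hinner (B := B) x x) (star_hinner x x)
    rw [hx2] at this
    exact this
  have h2 : (c : ℂ) • (star a * a) ≤ (c : ℂ) • (c : ℂ) • hinner (B := B) y y := by
    rw [← sub_nonneg]
    refine key.trans ?_
    have : (c : ℂ) • (star a * a) - (c : ℂ) • (star a * a) - (c : ℂ) • (star a * a) +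
      (c : ℂ) • (c : ℂ) • hinner (B := B) y y =
      (c : ℂ) • (c : ℂ) • hinner (B := B) y y - (c : ℂ) • (star a * a) := by abel
    rw [← this]
    gcongr
  have h3 : 0 ≤ (c : ℂ) • (star a * a) := by
    change 0 ≤ c • (star a * a)
    exact smul_nonneg hc0.le (star_mul_self_nonneg a)
  have h4 := CStarAlgebra.norm_le_norm_of_nonneg_of_le h3 h2
  rw [norm_smul, norm_smul, norm_smul, CStarRing.norm_star_mul_self, ← norm_sq_eq (B := B) y,
    Complex.norm_real, Real.norm_of_nonneg hc0.le] at h4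
  have h5 : ‖a‖ * ‖a‖ ≤ c * ‖y‖ ^ 2 := le_of_mul_le_mul_left h4 hc0
  refine abs_le_of_sq_le_sq' ?_ (by positivity) |>.2
  rw [mul_pow, sq ‖a‖]
  exact h5

lemma hinner_ext {x y : X} (h : ∀ z, hinner (B := B) z x = hinner (B := B) z y) : x = y := by
  rw [← sub_eq_zero, ← hinner_self_eq_zero (B := B), hinner_sub_right, h, sub_self]

variable (B) in
lemma continuous_hinner_right (x : X) : Continuous fun y => hinner (B := B) x y :=
  ((hinnerₗ B x).mkContinuous ‖x‖ (norm_hinner_le x)).continuous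

variable (B) in
lemma continuous_hinner_left (y : X) : Continuous fun x => hinner (B := B) x y := by
  have : (fun x => hinner (B := B) x y) = fun x => star (hinner (B := B) y x) := by
    funext x
    rw [star_hinner]
  rw [this]
  exact continuous_star.comp (continuous_hinner_right B y)

lemma norm_rmul_le (x : X) (b : B) : ‖rmul x b‖ ≤ ‖x‖ * ‖b‖ := by
  have h2 : ‖rmul x b‖ ^ 2 ≤ (‖x‖ * ‖b‖) ^ 2 := by
    rw [norm_sq_eq (B := B), hinner_rmul, hinner_rmul_left, mul_pow, norm_sq_eq (B := B) x]
    calc ‖star b * hinner (B := B) x x * b‖ ≤ ‖star b‖ * ‖hinner (B := B) x x‖ * ‖b‖ :=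
          (norm_mul_le _ _).trans (mul_le_mul_of_nonneg_right (norm_mul_le _ _) (norm_nonneg _))
      _ = ‖hinner (B := B) x x‖ * ‖b‖ ^ 2 := by rw [norm_star]; ring
  exact (pow_le_pow_iff_left₀ (norm_nonneg _) (by positivity) two_ne_zero).1 h2

/-- The right action as a bounded bilinear map. -/
def rmulL (B X : Type*) [NonUnitalCStarAlgebra B] [NormedAddCommGroup X] [NormedSpace ℂ X]
    [CompleteSpace X] [RightHilbertModule B X] : X →L[ℂ] B →L[ℂ] X :=
  LinearMap.mkContinuous₂ (LinearMap.mk₂ ℂ rmul add_rmul (fun t x b => smul_rmul t x b)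
    rmul_add (fun t x b => rmul_smul t x b)) 1 fun x b => by
      simpa using norm_rmul_le x b

@[simp] lemma rmulL_apply (x : X) (b : B) : rmulL B X x b = rmul x b := rfl

lemma rmul_sub (x : X) (b c : B) : rmul x (b - c) = rmul x b - rmul x c := by
  simp [← rmulL_apply]

/-- The right action of an approximate unit. -/
lemma exists_norm_rmul_sub_lt (B : Type*) [NonUnitalCStarAlgebra B] [RightHilbertModule B X]
    (x : X) {ε : ℝ} (hε : 0 < ε) : ∃ b : B, ‖rmul x b - x‖ < ε := by
  let _ := CStarAlgebra.spectralOrder B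
  have := CStarAlgebra.spectralOrderedRing B
  set c := hinner (B := B) x x
  have hu := CStarAlgebra.increasingApproximateUnit B
  have h1 : Tendsto (fun b : B => (c * b - c)) (CStarAlgebra.approximateUnit B) (𝓝 0) := by
    have := (hu.tendsto_mul_left c).sub_const c
    rwa [sub_self] at this
  have h3 := h1.norm
  rw [norm_zero] at h3
  -- As `‖b‖ ≤ 1`, the inner square of `x b - x` has norm at most `2 ‖c b - c‖`; hence the tolerance
  -- `ε² / 2`.
  have h2 := (tendsto_order.1 h3).2 (ε ^ 2 / 2) (by positivity)
  obtain ⟨b, hb, hb1⟩ := (h2.and hu.eventually_norm).exists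
  refine ⟨b, ?_⟩
  have h4 : hinner (B := B) (rmul x b - x) (rmul x b - x) =
      star b * (c * b - c) - (c * b - c) := by
    simp only [hinner_sub_left, hinner_sub_right, hinner_rmul, hinner_rmul_left, mul_sub, sub_mul,
      mul_assoc, c]
    abel
  have h5 : ‖rmul x b - x‖ ^ 2 < ε ^ 2 := by
    rw [norm_sq_eq (B := B), h4]
    refine (norm_sub_le _ _).trans_lt ?_
    have : ‖star b * (c * b - c)‖ ≤ 1 * ‖c * b - c‖ := by
      refine (norm_mul_le _ _).trans ?_
      rw [norm_star]
      gcongr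
    linarith
  exact lt_of_pow_lt_pow_left₀ 2 hε.le h5

/-! ### Adjoints -/

namespace IsAdjointPair

variable {T T' : X →L[ℂ] Y} {S S' : Y →L[ℂ] X}

lemma symm (h : IsAdjointPair B T S) : IsAdjointPair B S T := fun y x => by
  rw [← star_hinner, ← h, star_hinner]

lemma unique (h : IsAdjointPair B T S) (h' : IsAdjointPair B T S') : S = S' := by
  ext y
  exact hinner_ext (B := B) fun z => by rw [← h, ← h']

lemma add (h : IsAdjointPair B T S) (h' : IsAdjointPair B T' S') :
    IsAdjointPair B (T + T') (S + S') := fun x y => by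
  simp [hinner_add_left, hinner_add, h x y, h' x y]

lemma sub (h : IsAdjointPair B T S) (h' : IsAdjointPair B T' S') :
    IsAdjointPair B (T - T') (S - S') := fun x y => by
  simp [hinner_sub_left, hinner_sub_right, h x y, h' x y]

lemma smul (t : ℂ) (h : IsAdjointPair B T S) : IsAdjointPair B (t • T) (star t • S) :=
  fun x y => by simp [hinner_smul_left, hinner_smul, h x y]

lemma comp {R : Y →L[ℂ] Z} {R' : Z →L[ℂ] Y} (hR : IsAdjointPair B R R')
    (h : IsAdjointPair B T S) : IsAdjointPair B (R.comp T) (S.comp R') := fun x z => by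
  simp [hR (T x) z, h x (R' z)]

lemma norm_apply_sq_le (h : IsAdjointPair B T S) (x : X) :
    ‖T x‖ ^ 2 ≤ ‖x‖ * ‖S (T x)‖ := by
  rw [norm_sq_eq (B := B), h]
  exact norm_hinner_le _ _

/-- The C*-inequality: `‖T x‖² = ‖⟨x, S T x⟩‖`, and Cauchy-Schwarz applies. -/
lemma norm_sq_le (h : IsAdjointPair B T S) : ‖T‖ ^ 2 ≤ ‖S.comp T‖ := by
  have : ‖T‖ ≤ √‖S.comp T‖ := by
    refine T.opNorm_le_bound (Real.sqrt_nonneg _) fun x => ?_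
    refine abs_le_of_sq_le_sq' ?_ (by positivity) |>.2
    rw [mul_pow, Real.sq_sqrt (norm_nonneg _)]
    calc ‖T x‖ ^ 2 ≤ ‖x‖ * ‖S.comp T x‖ := h.norm_apply_sq_le x
      _ ≤ ‖x‖ * (‖S.comp T‖ * ‖x‖) := by gcongr; exact (S.comp T).le_opNorm x
      _ = _ := by ring
  calc ‖T‖ ^ 2 ≤ √‖S.comp T‖ ^ 2 := by gcongr
    _ = _ := Real.sq_sqrt (norm_nonneg _)

/-- From `‖T‖² ≤ ‖S T‖ ≤ ‖S‖ ‖T‖`. If `‖S‖ < ‖T‖`, then `‖T‖` is positive and can be cancelled. -/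
lemma norm_le (h : IsAdjointPair B T S) : ‖T‖ ≤ ‖S‖ := by
  by_contra! hlt
  have h1 := h.norm_sq_le.trans (S.opNorm_comp_le T)
  nlinarith [norm_nonneg S]

lemma norm_eq (h : IsAdjointPair B T S) : ‖T‖ = ‖S‖ :=
  le_antisymm h.norm_le h.symm.norm_le

lemma norm_comp_self (h : IsAdjointPair B T S) : ‖S.comp T‖ = ‖T‖ ^ 2 := by
  refine le_antisymm ((S.opNorm_comp_le T).trans ?_) h.norm_sq_le
  rw [← h.norm_eq, sq]

end IsAdjointPair

/-- Rank-one operators. -/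
def rankOne (B : Type*) [NonUnitalCStarAlgebra B] [RightHilbertModule B X]
    [RightHilbertModule B Y] (y : Y) (x : X) : X →L[ℂ] Y :=
  (rmulL B Y y).comp ((hinnerₗ B x).mkContinuous ‖x‖ (norm_hinner_le x))

@[simp] lemma rankOne_apply (y : Y) (x z : X) :
    rankOne B y x z = rmul y (hinner (B := B) x z) := rfl

lemma isRankOne_rankOne (y : Y) (x : X) : IsRankOne B (rankOne B y x) := ⟨y, x, fun _ => rfl⟩

lemma IsRankOne.exists_eq {T : X →L[ℂ] Y} (h : IsRankOne B T) : ∃ y x, T = rankOne B y x := by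
  obtain ⟨y, x, h⟩ := h
  exact ⟨y, x, ContinuousLinearMap.ext h⟩

lemma isAdjointPair_rankOne (y : Y) (x : X) :
    IsAdjointPair B (rankOne B y x) (rankOne B x y) := fun z w => by
  simp [hinner_rmul_left, hinner_rmul, star_hinner]

lemma norm_rankOne_le (y : Y) (x : X) : ‖rankOne B y x‖ ≤ ‖y‖ * ‖x‖ :=
  ContinuousLinearMap.opNorm_le_bound _ (by positivity) fun z => by
    rw [rankOne_apply, mul_assoc]
    refine (norm_rmul_le _ _).trans ?_
    gcongr
    exact norm_hinner_le x z

lemma rankOne_mem_compacts (y : Y) (x : X) : rankOne B y x ∈ Compacts B X Y :=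
  Submodule.le_topologicalClosure _ (Submodule.subset_span (isRankOne_rankOne y x))

lemma rankOne_sub_right (y : Y) (x x' : X) :
    rankOne B y (x - x') = rankOne B y x - rankOne B y x' := by
  ext z
  simp [hinner_sub_left, rmul_sub]

/-- Pairing with an arbitrary `z` moves `T` to the other side, where the inner product is
`B`-linear. -/
lemma IsAdjointPair.map_rmul {T : X →L[ℂ] Y} {S : Y →L[ℂ] X} (h : IsAdjointPair B T S)
    (x : X) (b : B) : T (rmul x b) = rmul (T x) b :=
  hinner_ext (B := B) fun z => by rw [hinner_rmul, ← h.symm, ← h.symm, hinner_rmul]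

/-- Compositions of a compact operator with adjointable operators are compact. -/
lemma comp_comp_mem_compacts {W : Type*} [NormedAddCommGroup W] [NormedSpace ℂ W]
    [CompleteSpace W] [RightHilbertModule B W] {T : X →L[ℂ] Y} (hT : T ∈ Compacts B X Y)
    {L : Y →L[ℂ] Z} {L' : Z →L[ℂ] Y} (hL : IsAdjointPair B L L')
    {R : W →L[ℂ] X} {R' : X →L[ℂ] W} (hR : IsAdjointPair B R R') :
    L.comp (T.comp R) ∈ Compacts B W Z := by
  let Φ : (X →L[ℂ] Y) →L[ℂ] (W →L[ℂ] Z) :=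
    (ContinuousLinearMap.compL ℂ W Y Z L).comp ((ContinuousLinearMap.compL ℂ W X Y).flip R)
  have hcl : IsClosed {S : X →L[ℂ] Y | Φ S ∈ Compacts B W Z} :=
    (Submodule.isClosed_topologicalClosure _).preimage Φ.continuous
  refine closure_minimal (s := (Submodule.span ℂ {S : X →L[ℂ] Y | IsRankOne B S} :
    Set (X →L[ℂ] Y))) ?_ hcl hT
  have : Submodule.span ℂ {S : X →L[ℂ] Y | IsRankOne B S} ≤
      (Compacts B W Z).comap (Φ : (X →L[ℂ] Y) →ₗ[ℂ] (W →L[ℂ] Z)) := by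
    refine Submodule.span_le.2 ?_
    intro S hS
    obtain ⟨y, x, rfl⟩ := hS.exists_eq
    have : Φ (rankOne B y x) = rankOne B (L y) (R' x) := by
      ext w
      change L (rmul y (hinner (B := B) x (R w))) = rmul (L y) (hinner (B := B) (R' x) w)
      rw [hL.map_rmul, hR.symm]
    change Φ (rankOne B y x) ∈ Compacts B W Z
    rw [this]
    exact rankOne_mem_compacts _ _
  exact this

/-! ### The C*-algebra of compact operators. -/

namespace Compacts

/-- Operators of finite rank have explicit adjoints of finite rank. Passing to adjoints preserves
norms, so the adjoints of a convergent sequence form a Cauchy sequence, and its limit is the adjoint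
of the limit. -/
lemma exists_adjoint (T : Compacts B X Y) :
    ∃ S : Compacts B Y X, IsAdjointPair B (T : X →L[ℂ] Y) (S : Y →L[ℂ] X) := by
  obtain ⟨T, hT⟩ := T
  have hspan : ∀ R ∈ Submodule.span ℂ {R : X →L[ℂ] Y | IsRankOne B R},
      ∃ S ∈ Compacts B Y X, IsAdjointPair B R S := by
    intro R hR
    induction hR using Submodule.span_induction with
    | mem R h =>
      obtain ⟨y, x, rfl⟩ := h.exists_eq
      exact ⟨_, rankOne_mem_compacts x y, isAdjointPair_rankOne y x⟩
    | zero => exact ⟨0, zero_mem _, fun x y => by simp [hinner_zero_left, hinner_zero_right]⟩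
    | add R R' _ _ h h' =>
      obtain ⟨S, hS, h⟩ := h
      obtain ⟨S', hS', h'⟩ := h'
      exact ⟨S + S', add_mem hS hS', h.add h'⟩
    | smul t R _ h =>
      obtain ⟨S, hS, h⟩ := h
      exact ⟨star t • S, Submodule.smul_mem _ _ hS, h.smul t⟩
  obtain ⟨R, hR, hlim⟩ := mem_closure_iff_seq_limit.1 (show T ∈ closure _ from hT)
  choose S hS hadj using fun n => hspan (R n) (hR n)
  have hcauchy : CauchySeq S := by
    have h1 := hlim.cauchySeq
    rw [Metric.cauchySeq_iff] at h1 ⊢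
    intro ε hε
    obtain ⟨N, hN⟩ := h1 ε hε
    refine ⟨N, fun m hm n hn => ?_⟩
    have := hN m hm n hn
    rwa [dist_eq_norm, ((hadj m).sub (hadj n)).norm_eq, ← dist_eq_norm] at this
  obtain ⟨S', hS'⟩ := cauchySeq_tendsto_of_complete hcauchy
  refine ⟨⟨S', (Submodule.isClosed_topologicalClosure _).mem_of_tendsto hS'
    (Eventually.of_forall hS)⟩, fun x y => ?_⟩
  have e1 : Tendsto (fun n => hinner (B := B) (R n x) y) atTop (𝓝 (hinner (B := B) (T x) y)) :=
    ((continuous_hinner_left B y).comp (ContinuousLinearMap.apply ℂ Y x).continuous).tendsto T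
      |>.comp hlim
  have e2 : Tendsto (fun n => hinner (B := B) x (S n y)) atTop (𝓝 (hinner (B := B) x (S' y))) :=
    ((continuous_hinner_right B x).comp (ContinuousLinearMap.apply ℂ X y).continuous).tendsto S'
      |>.comp hS'
  refine tendsto_nhds_unique e1 (e2.congr fun n => ?_)
  rw [hadj n]

/-- The adjoint of a compact operator. -/
def adj (T : Compacts B X Y) : Compacts B Y X := (exists_adjoint T).choose

lemma isAdjointPair_adj (T : Compacts B X Y) :
    IsAdjointPair B (T : X →L[ℂ] Y) (adj T : Y →L[ℂ] X) := (exists_adjoint T).choose_spec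

/-- The algebraic rules for `adj` follow from this by exhibiting an adjoint pair. -/
lemma eq_adj {T : Compacts B X Y} {S : Compacts B Y X}
    (h : IsAdjointPair B (T : X →L[ℂ] Y) (S : Y →L[ℂ] X)) : S = adj T :=
  Subtype.ext (h.unique (isAdjointPair_adj T))

lemma adj_adj (T : Compacts B X Y) : adj (adj T) = T := (eq_adj (isAdjointPair_adj T).symm).symm

lemma adj_comp (S : Compacts B Y Z) (T : Compacts B X Y) :
    adj (comp S T) = comp (adj T) (adj S) :=
  (eq_adj (T := comp S T) (S := comp (adj T) (adj S))
    ((isAdjointPair_adj S).comp (isAdjointPair_adj T))).symm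

lemma adj_add (S T : Compacts B X Y) : adj (S + T) = adj S + adj T :=
  (eq_adj (T := S + T) (S := adj S + adj T) ((isAdjointPair_adj S).add (isAdjointPair_adj T))).symm

lemma adj_smul (t : ℂ) (T : Compacts B X Y) : adj (t • T) = star t • adj T :=
  (eq_adj (T := t • T) (S := star t • adj T) ((isAdjointPair_adj T).smul t)).symm

lemma norm_adj (T : Compacts B X Y) : ‖adj T‖ = ‖T‖ := (isAdjointPair_adj T).norm_eq.symm

lemma norm_adj_comp_self (T : Compacts B X Y) : ‖comp (adj T) T‖ = ‖T‖ ^ 2 :=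
  (isAdjointPair_adj T).norm_comp_self

lemma norm_comp_le (S : Compacts B Y Z) (T : Compacts B X Y) : ‖comp S T‖ ≤ ‖S‖ * ‖T‖ :=
  ContinuousLinearMap.opNorm_comp_le _ _

lemma comp_apply (S : Compacts B Y Z) (T : Compacts B X Y) (x : X) :
    (comp S T : X →L[ℂ] Z) x = (S : Y →L[ℂ] Z) ((T : X →L[ℂ] Y) x) := rfl

variable (B X) in
/-- The C*-algebra of compact operators on `X`. -/
@[reducible] def cstarAlgebra : NonUnitalCStarAlgebra (Compacts B X X) :=
  { (Submodule.normedAddCommGroup (Compacts B X X) : NormedAddCommGroup (Compacts B X X)),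
    (Submodule.normedSpace (Compacts B X X) : NormedSpace ℂ (Compacts B X X)) with
    mul := Compacts.comp
    left_distrib := fun R S T => Subtype.ext (ContinuousLinearMap.comp_add _ _ _)
    right_distrib := fun R S T => Subtype.ext (ContinuousLinearMap.add_comp _ _ _)
    zero_mul := fun T => Subtype.ext (ContinuousLinearMap.zero_comp _)
    mul_zero := fun T => Subtype.ext (ContinuousLinearMap.comp_zero _)
    mul_assoc := fun R S T => rfl
    norm_mul_le := norm_comp_le
    star := adj
    star_involutive := adj_adj
    star_mul := adj_comp
    star_add := adj_add
    complete := ((Submodule.isClosed_topologicalClosure _).completeSpace_coe :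
      CompleteSpace (Compacts B X X)).complete
    norm_mul_self_le := fun T => by
      rw [← sq]
      exact (norm_adj_comp_self T).ge
    smul_assoc := fun t S T => Subtype.ext (ContinuousLinearMap.smul_comp _ _ _)
    smul_comm := fun t S T => Subtype.ext (ContinuousLinearMap.comp_smul _ _ _).symm
    star_smul := adj_smul }

/-- The operator `T⋆ T` is positive in the C*-algebra of compact operators. -/
lemma exists_adj_comp_self_eq (T : Compacts B X Y) :
    ∃ R : Compacts B X X, comp (adj T) T = comp (adj R) R := by
  let _ := cstarAlgebra B X
  let _ := CStarAlgebra.spectralOrder (Compacts B X X)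
  have := CStarAlgebra.spectralOrderedRing (Compacts B X X)
  set S : Compacts B X X := comp (adj T) T with hS
  have hsa : IsSelfAdjoint S := by
    change adj S = S
    rw [hS, adj_comp, adj_adj]
  suffices h : 0 ≤ S by
    obtain ⟨R, hR⟩ := CStarAlgebra.nonneg_iff_eq_star_mul_self.1 h
    exact ⟨R, hR⟩
  -- `T` maps into a different module, so `T⋆ T` is not visibly a square in `K(X)`. Instead its
  -- negative part `n` is shown to vanish.
  have hneg := CFC.negPart_nonneg S
  rw [← CFC.negPart_eq_zero_iff S hsa]
  set n : Compacts B X X := S⁻ with hn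
  have hSn : S * n = -(n * n) := by
    conv_lhs => rw [← CFC.posPart_sub_negPart S hsa]
    rw [sub_mul, CFC.posPart_mul_negPart, zero_sub]
  obtain ⟨r, hr⟩ := CStarAlgebra.nonneg_iff_eq_star_mul_self.1 hneg
  have hnsa : star n = n := IsSelfAdjoint.of_nonneg hneg
  -- With `n = r⋆ r`, the element `n S n = -n³` is minus a square.
  have hnSn : n * (S * n) = -(star (r * n) * (r * n)) := by
    rw [hSn, star_mul, hnsa, mul_neg, mul_assoc, ← mul_assoc (star r), ← hr]
  -- `⟨x, n S n x⟩` equals both `⟨T n x, T n x⟩ ≥ 0` and `-⟨r n x, r n x⟩ ≤ 0`, so it is zero for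
  -- every `x`.
  have hTn : comp T n = 0 := by
    ext x
    let _ := CStarAlgebra.spectralOrder B
    have := CStarAlgebra.spectralOrderedRing B
    have e1 : ∀ R : Compacts B X X, ∀ W : Compacts B X X, W = star R * R →
        hinner (B := B) x ((W : X →L[ℂ] X) x) =
          hinner (B := B) ((R : X →L[ℂ] X) x) ((R : X →L[ℂ] X) x) := by
      rintro R W rfl
      exact (isAdjointPair_adj R _ _).symm
    have e2 : hinner (B := B) x (((n * (S * n) : Compacts B X X) : X →L[ℂ] X) x) =
        hinner (B := B) ((comp T n : X →L[ℂ] Y) x) ((comp T n : X →L[ℂ] Y) x) := by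
      have hn' : IsAdjointPair B (n : X →L[ℂ] X) (n : X →L[ℂ] X) := by
        have := isAdjointPair_adj n
        rwa [show adj n = n from hnsa] at this
      exact (hn' _ _).symm.trans (isAdjointPair_adj T _ _).symm
    have e3 : hinner (B := B) x (((-(star (r * n) * (r * n)) : Compacts B X X) : X →L[ℂ] X) x) =
        -hinner (B := B) (((r * n : Compacts B X X) : X →L[ℂ] X) x)
          (((r * n : Compacts B X X) : X →L[ℂ] X) x) := by
      rw [← e1 _ _ rfl]
      exact map_neg (hinnerₗ B x) _
    rw [hnSn, e3] at e2
    exact hinner_self_eq_zero.1 (le_antisymm (e2 ▸ neg_nonpos.2 (hinner_self_nonneg _))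
      (hinner_self_nonneg _))
  have hSn0 : S * n = 0 := by
    change comp (comp (adj T) T) n = 0
    have : comp (comp (adj T) T) n = comp (adj T) (comp T n) := rfl
    rw [this, hTn]
    exact Subtype.ext (ContinuousLinearMap.comp_zero _)
  have : star n * n = 0 := by rw [hnsa, ← neg_eq_zero, ← hSn, hSn0]
  exact (CStarRing.star_mul_self_eq_zero_iff n).1 this

end Compacts

end HilbertModules

/-! ## Operators on interior tensor products -/

/-- Repeated squaring gives `(a 1 / a 0) ^ 2 ^ n ≤ a (2 ^ n) / a 0 ≤ (K / a 0) r ^ 2 ^ n`, and the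
constant `K` disappears on taking `2 ^ n`-th roots. In the application `a m` is the norm of `(R ^ m
⊗ 1) ξ`, for which a crude bound with a constant depending on `ξ` is easy. -/
lemma le_mul_of_sq_le_mul_double {a : ℕ → ℝ} (ha : ∀ m, 0 ≤ a m)
    (hsq : ∀ m, a m ^ 2 ≤ a 0 * a (2 * m)) {K r : ℝ} (hr : 0 ≤ r)
    (hK : ∀ m, a m ≤ K * r ^ m) : a 1 ≤ r * a 0 := by
  rcases (ha 0).eq_or_lt with h0 | h0
  · have := hsq 1
    rw [← h0, zero_mul] at this
    have h1 : a 1 = 0 := by nlinarith [ha 1]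
    rw [h1, ← h0, mul_zero]
  have hpow : ∀ n : ℕ, (a 1 / a 0) ^ 2 ^ n ≤ a (2 ^ n) / a 0 := by
    intro n
    induction n with
    | zero => simp
    | succ n ih =>
      calc (a 1 / a 0) ^ 2 ^ (n + 1) = ((a 1 / a 0) ^ 2 ^ n) ^ 2 := by rw [← pow_mul, pow_succ]
        _ ≤ (a (2 ^ n) / a 0) ^ 2 := by
          have := ha 1
          gcongr
        _ = a (2 ^ n) ^ 2 / (a 0 * a 0) := by rw [div_pow, sq (a 0)]
        _ ≤ (a 0 * a (2 * 2 ^ n)) / (a 0 * a 0) := by gcongr; exact hsq _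
        _ = a (2 ^ (n + 1)) / a 0 := by
          rw [mul_div_mul_left _ _ h0.ne', pow_succ, mul_comm]
  rw [← div_le_iff₀ h0]
  by_contra! hlt
  have hb : ∀ n : ℕ, (a 1 / a 0) ^ 2 ^ n ≤ K / a 0 * r ^ 2 ^ n := fun n =>
    (hpow n).trans (by rw [div_mul_eq_mul_div]; gcongr; exact hK _)
  -- For `r = 0` division by `r` is unavailable, but the bound with exponent `2 ^ 0 = 1` already
  -- gives `a 1 / a 0 ≤ 0`.
  rcases hr.eq_or_lt with rfl | hr0
  · have := hb 0
    simp at this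
    linarith
  have h1 : 1 < a 1 / a 0 / r := by rwa [one_lt_div hr0]
  have hlim := (tendsto_pow_atTop_atTop_of_one_lt h1).comp
    (tendsto_pow_atTop_atTop_of_one_lt (one_lt_two (α := ℕ)))
  obtain ⟨n, hn⟩ := (hlim.eventually_gt_atTop (K / a 0)).exists
  have := hb n
  rw [Function.comp_apply, div_pow, lt_div_iff₀ (by positivity)] at hn
  linarith

section Tensor

variable {B C : Type*} [NonUnitalCStarAlgebra B] [NonUnitalCStarAlgebra C]
  {X X' Y Z Z' : Type*}
  [NormedAddCommGroup X] [NormedSpace ℂ X] [CompleteSpace X] [RightHilbertModule B X]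
  [NormedAddCommGroup X'] [NormedSpace ℂ X'] [CompleteSpace X'] [RightHilbertModule B X']
  [NormedAddCommGroup Y] [NormedSpace ℂ Y] [CompleteSpace Y] [RightHilbertModule C Y]
  [Correspondence B C Y]
  [NormedAddCommGroup Z] [NormedSpace ℂ Z] [CompleteSpace Z] [RightHilbertModule C Z]
  [NormedAddCommGroup Z'] [NormedSpace ℂ Z'] [CompleteSpace Z'] [RightHilbertModule C Z']

open Correspondence

/-- An injective left action by compact operators is isometric. -/
lemma norm_lact (hc : ∀ b : B, (lact C b : Y →L[ℂ] Y) ∈ Compacts C Y Y)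
    (hi : Function.Injective fun b : B => (lact C b : Y →L[ℂ] Y)) (b : B) :
    ‖(lact C b : Y →L[ℂ] Y)‖ = ‖b‖ := by
  -- Since the action takes values in the C*-algebra of compact operators, it is an injective
  -- `*`-homomorphism of C*-algebras, and such maps are isometric.
  let _ := Compacts.cstarAlgebra C Y
  let φ : B →⋆ₙₐ[ℂ] Compacts C Y Y :=
    { toFun := fun b => ⟨lact C b, hc b⟩
      map_smul' := fun t b => Subtype.ext (map_smul (lact C : B →ₙₐ[ℂ] (Y →L[ℂ] Y)) t b)
      map_zero' := Subtype.ext (map_zero (lact C : B →ₙₐ[ℂ] (Y →L[ℂ] Y)))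
      map_add' := fun b b' => Subtype.ext (map_add (lact C : B →ₙₐ[ℂ] (Y →L[ℂ] Y)) b b')
      map_mul' := fun b b' => Subtype.ext (map_mul (lact C : B →ₙₐ[ℂ] (Y →L[ℂ] Y)) b b')
      map_star' := fun b => Compacts.eq_adj (T := ⟨lact C b, hc b⟩) (S := ⟨lact C (star b), hc _⟩)
        (lact_adjoint b) }
  exact NonUnitalStarAlgHom.norm_map φ (fun b b' h => hi (congrArg Subtype.val h)) b

variable (B C) in
/-- `t` carries the inner product of the interior tensor product to that of `Z`. -/
def PreservesHinner (t : X →ₗ[ℂ] Y →ₗ[ℂ] Z) : Prop :=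
  ∀ (x x₁ : X) (y y₁ : Y), hinner (B := C) (t x y) (t x₁ y₁) =
    hinner (B := C) y (lact C (hinner (B := B) x x₁) y₁)

/-- `T'` is the operator `T ⊗ 1`. -/
def IsTensorOne (t : X →ₗ[ℂ] Y →ₗ[ℂ] Z) (t' : X' →ₗ[ℂ] Y →ₗ[ℂ] Z') (T : X →L[ℂ] X')
    (T' : Z →L[ℂ] Z') : Prop :=
  ∀ x y, T' (t x y) = t' (T x) y

variable {t : X →ₗ[ℂ] Y →ₗ[ℂ] Z} {t' : X' →ₗ[ℂ] Y →ₗ[ℂ] Z'}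

open TensorProduct

/-- Operators on `Z` can thus be defined on the algebraic tensor product and extended once a norm
estimate is known. -/
lemma HasDenseSpan.denseRange_lift (hd : HasDenseSpan t) : DenseRange (lift t) := by
  refine Dense.mono ?_ hd
  have : Submodule.span ℂ {z : Z | ∃ x y, z = t x y} ≤ LinearMap.range (lift t) := by
    refine Submodule.span_le.2 ?_
    rintro _ ⟨x, y, rfl⟩
    exact ⟨x ⊗ₜ y, lift.tmul x y⟩
  exact this

lemma HasDenseSpan.clm_ext {W : Type*} [NormedAddCommGroup W] [NormedSpace ℂ W]
    (hd : HasDenseSpan t) {S T : Z →L[ℂ] W} (h : ∀ x y, S (t x y) = T (t x y)) : S = T := by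
  refine ContinuousLinearMap.ext_on hd ?_
  rintro _ ⟨x, y, rfl⟩
  exact h x y

lemma HasDenseSpan.hinner_ext {z z' : Z} (hd : HasDenseSpan t)
    (h : ∀ x y, hinner (B := C) (t x y) z = hinner (B := C) (t x y) z') : z = z' := by
  refine GraphCorr.hinner_ext (B := C) fun w => ?_
  have hcl : IsClosed {w : Z | hinner (B := C) w z = hinner (B := C) w z'} :=
    isClosed_eq (continuous_hinner_left C z) (continuous_hinner_left C z')
  refine hcl.closure_subset_iff.2 ?_ (hd w)
  intro w hw
  induction hw using Submodule.span_induction with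
  | mem w hw =>
    obtain ⟨x, y, rfl⟩ := hw
    exact h x y
  | zero => simp [hinner_zero_left]
  | add w w' _ _ h h' =>
    simp only [Set.mem_ofPred_eq] at h h' ⊢
    simp [hinner_add_left, h, h']
  | smul c w _ h =>
    simp only [Set.mem_ofPred_eq] at h ⊢
    simp [hinner_smul_left, h]

lemma IsTensorOne.unique (hd : HasDenseSpan t) {T : X →L[ℂ] X'} {T₁ T₂ : Z →L[ℂ] Z'}
    (h₁ : IsTensorOne t t' T T₁) (h₂ : IsTensorOne t t' T T₂) : T₁ = T₂ :=
  hd.clm_ext fun x y => by rw [h₁, h₂]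

/-- `T ⊗ 1` and `S ⊗ 1` are formally adjoint already on the algebraic tensor products, before any
boundedness is known. By additivity it suffices to look at elementary tensors. -/
lemma PreservesHinner.hinner_rTensor (ht : PreservesHinner B C t) (ht' : PreservesHinner B C t')
    {T : X →L[ℂ] X'} {S : X' →L[ℂ] X} (h : IsAdjointPair B T S) (ξ : X ⊗[ℂ] Y) (η : X' ⊗[ℂ] Y) :
    hinner (B := C) (lift t' (LinearMap.rTensor Y (T : X →ₗ[ℂ] X') ξ)) (lift t' η) =
      hinner (B := C) (lift t ξ) (lift t (LinearMap.rTensor Y (S : X' →ₗ[ℂ] X) η)) := by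
  induction ξ using TensorProduct.induction_on with
  | zero => simp [hinner_zero_left]
  | add ξ ξ' hξ hξ' => simp only [map_add, hinner_add_left, hξ, hξ']
  | tmul x y =>
    induction η using TensorProduct.induction_on with
    | zero => simp [hinner_zero_right]
    | add η η' hη hη' => simp only [map_add, hinner_add, hη, hη']
    | tmul x' y' =>
      simp only [LinearMap.rTensor_tmul, lift.tmul, ContinuousLinearMap.coe_coe]
      rw [ht', ht, h]

lemma PreservesHinner.norm_le
    (hφ : ∀ b : B, ‖(lact C b : Y →L[ℂ] Y)‖ ≤ ‖b‖)
    (ht : PreservesHinner B C t) (x : X) (y : Y) :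
    ‖t x y‖ ≤ ‖x‖ * ‖y‖ := by
  refine abs_le_of_sq_le_sq' ?_ (by positivity) |>.2
  rw [norm_sq_eq (B := C), ht]
  calc _ ≤ ‖y‖ * ‖lact C (hinner (B := B) x x) y‖ := norm_hinner_le _ _
    _ ≤ ‖y‖ * (‖hinner (B := B) x x‖ * ‖y‖) := by
      gcongr
      exact (ContinuousLinearMap.le_opNorm _ _).trans (by gcongr; exact hφ _)
    _ = _ := by rw [← norm_sq_eq]; ring

/-- Put `R = S T`, which is its own adjoint. Cauchy-Schwarz applied to `⟨(R^m ⊗ 1) ξ, (R^m ⊗ 1) ξ⟩ =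
⟨ξ, (R^{2m} ⊗ 1) ξ⟩` is the hypothesis of `le_mul_of_sq_le_mul_double`, whence `‖(R ⊗ 1) ξ‖ ≤ ‖R‖
‖ξ‖`. Then `⟨(T ⊗ 1) ξ, (T ⊗ 1) ξ⟩ = ⟨ξ, (R ⊗ 1) ξ⟩` and `‖R‖ = ‖T‖²` give the claim. -/
lemma PreservesHinner.norm_rTensor_le
    (hφ : ∀ b : B, ‖(lact C b : Y →L[ℂ] Y)‖ ≤ ‖b‖)
    (ht : PreservesHinner B C t)
    (ht' : PreservesHinner B C t') {T : X →L[ℂ] X'} {S : X' →L[ℂ] X} (h : IsAdjointPair B T S)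
    (ξ : X ⊗[ℂ] Y) :
    ‖lift t' (LinearMap.rTensor Y (T : X →ₗ[ℂ] X') ξ)‖ ≤ ‖T‖ * ‖lift t ξ‖ := by
  set R : X →L[ℂ] X := S.comp T with hR
  have hRR : IsAdjointPair B R R := h.symm.comp h
  have hpow : ∀ m : ℕ, IsAdjointPair B (R ^ m) (R ^ m) := by
    intro m
    induction m with
    | zero => exact fun x y => rfl
    | succ m ih =>
      have := hRR.comp ih
      rwa [← ContinuousLinearMap.mul_def, ← ContinuousLinearMap.mul_def, ← pow_succ,
        ← pow_succ'] at this
  let a : ℕ → ℝ := fun m => ‖lift t (LinearMap.rTensor Y ((R ^ m : X →L[ℂ] X) : X →ₗ[ℂ] X) ξ)‖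
  have h0 : a 0 = ‖lift t ξ‖ := by
    have : LinearMap.rTensor Y (1 : X →ₗ[ℂ] X) = LinearMap.id := LinearMap.rTensor_id Y X
    simp [a, this]
  have hsq : ∀ m, a m ^ 2 ≤ a 0 * a (2 * m) := by
    intro m
    rw [h0]
    simp only [a]
    rw [norm_sq_eq (B := C), ht.hinner_rTensor ht (hpow m)]
    refine (norm_hinner_le _ _).trans_eq ?_
    rw [← LinearMap.comp_apply (LinearMap.rTensor Y _), ← LinearMap.rTensor_comp, two_mul, pow_add]
    rfl
  -- `K` is the sum of `‖x‖ ‖y‖` over the terms of one representation of `ξ`; it does not depend on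
  -- `m`.
  obtain ⟨K, hK⟩ : ∃ K, ∀ m, a m ≤ K * ‖R‖ ^ m := by
    simp only [a]
    clear hsq h0 a
    induction ξ using TensorProduct.induction_on with
    | zero => exact ⟨0, by simp⟩
    | add ξ ξ' hξ hξ' =>
      obtain ⟨K, hK⟩ := hξ
      obtain ⟨K', hK'⟩ := hξ'
      refine ⟨K + K', fun m => ?_⟩
      rw [map_add, map_add, add_mul]
      exact (norm_add_le _ _).trans (add_le_add (hK m) (hK' m))
    | tmul x y =>
      refine ⟨‖x‖ * ‖y‖, fun m => ?_⟩
      simp only [LinearMap.rTensor_tmul, lift.tmul, ContinuousLinearMap.coe_coe]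
      refine (ht.norm_le hφ _ _).trans ?_
      have hp : ∀ m : ℕ, ‖(R ^ m) x‖ ≤ ‖R‖ ^ m * ‖x‖ := by
        intro m
        induction m with
        | zero => simp
        | succ m ih =>
          rw [pow_succ', mul_apply_eq_comp, pow_succ', mul_assoc]
          exact (R.le_opNorm _).trans (by gcongr)
      calc _ ≤ (‖R‖ ^ m * ‖x‖) * ‖y‖ := by gcongr; exact hp m
        _ = _ := by ring
  have h1 := le_mul_of_sq_le_mul_double (fun m => norm_nonneg _) hsq (norm_nonneg R) hK
  have h2 : a 1 = ‖lift t (LinearMap.rTensor Y (S : X' →ₗ[ℂ] X)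
      (LinearMap.rTensor Y (T : X →ₗ[ℂ] X') ξ))‖ := by
    simp only [a]
    rw [← LinearMap.comp_apply (LinearMap.rTensor Y _), ← LinearMap.rTensor_comp, pow_one]
    rfl
  refine abs_le_of_sq_le_sq' ?_ (by positivity) |>.2
  rw [norm_sq_eq (B := C), ht.hinner_rTensor ht' h]
  calc _ ≤ ‖lift t ξ‖ * a 1 := by rw [h2]; exact norm_hinner_le _ _
    _ ≤ ‖lift t ξ‖ * (‖T‖ ^ 2 * ‖lift t ξ‖) := by
      rw [show ‖R‖ = ‖T‖ ^ 2 from h.norm_comp_self] at h1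
      change a 1 ≤ ‖T‖ ^ 2 * a 0 at h1
      rw [h0] at h1
      gcongr
    _ = _ := by ring

/-- The operator `T ⊗ 1` for adjointable `T`. -/
lemma exists_isTensorOne
    (hφ : ∀ b : B, ‖(lact C b : Y →L[ℂ] Y)‖ ≤ ‖b‖)
    (hd : HasDenseSpan t) (ht : PreservesHinner B C t)
    (ht' : PreservesHinner B C t') {T : X →L[ℂ] X'} {S : X' →L[ℂ] X} (h : IsAdjointPair B T S) :
    ∃ T' : Z →L[ℂ] Z', IsTensorOne t t' T T' ∧ ‖T'‖ ≤ ‖T‖ := by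
  have hb := ht.norm_rTensor_le hφ ht' h
  have hdr := hd.denseRange_lift
  refine ⟨(lift t' ∘ₗ LinearMap.rTensor Y (T : X →ₗ[ℂ] X')).extendOfNorm (lift t), fun x y => ?_,
    LinearMap.opNorm_extendOfNorm_le hdr (norm_nonneg _) hb⟩
  rw [← lift.tmul (f' := t), LinearMap.extendOfNorm_eq hdr ⟨_, hb⟩]
  simp

lemma IsTensorOne.norm_le
    (hφ : ∀ b : B, ‖(lact C b : Y →L[ℂ] Y)‖ ≤ ‖b‖)
    (hd : HasDenseSpan t) (ht : PreservesHinner B C t)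
    (ht' : PreservesHinner B C t') {T : X →L[ℂ] X'} {S : X' →L[ℂ] X} (h : IsAdjointPair B T S)
    {T' : Z →L[ℂ] Z'} (hT : IsTensorOne t t' T T') : ‖T'‖ ≤ ‖T‖ := by
  obtain ⟨T'', h1, h2⟩ := exists_isTensorOne hφ hd ht ht' h
  rwa [hT.unique hd h1]

/-- The adjoint of `T ⊗ 1` is `S ⊗ 1`; this makes the connecting maps compatible with adjoints. -/
lemma IsTensorOne.isAdjointPair (hd : HasDenseSpan t) (ht : PreservesHinner B C t)
    (ht' : PreservesHinner B C t') {T : X →L[ℂ] X'} {S : X' →L[ℂ] X} (h : IsAdjointPair B T S)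
    {T' : Z →L[ℂ] Z'} (hT : IsTensorOne t t' T T')
    {S' : Z' →L[ℂ] Z} (hS : IsAdjointPair C T' S') : IsTensorOne t' t S S' := fun x' y' => by
  refine hd.hinner_ext (C := C) fun x y => ?_
  rw [← hS, hT, ht', ht, h]

/-- The operator `T_x : y ↦ x ⊗ y` is adjointable. -/
lemma exists_creation
    (hφ : ∀ b : B, ‖(lact C b : Y →L[ℂ] Y)‖ ≤ ‖b‖)
    (hd : HasDenseSpan t) (ht : PreservesHinner B C t) (x : X) :
    ∃ (L : Y →L[ℂ] Z) (L' : Z →L[ℂ] Y), IsAdjointPair C L L' ∧ (∀ y, L y = t x y) ∧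
      ∀ x' y, L' (t x' y) = lact C (hinner (B := B) x x') y := by
  let L : Y →L[ℂ] Z := (t x).mkContinuous ‖x‖ (ht.norm_le hφ x)
  -- The adjoint must send `x' ⊗ y` to `⟨x, x'⟩ y`.
  let f : X →ₗ[ℂ] Y →ₗ[ℂ] Y :=
    LinearMap.mk₂ ℂ (fun x' y => lact C (hinner (B := B) x x') y)
      (fun x₁ x₂ y => by simp [hinner_add]) (fun c x₁ y => by simp [hinner_smul])
      (fun x₁ y₁ y₂ => by simp) (fun c x₁ y₁ => by simp)
  have hf : ∀ (y : Y) (ξ : X ⊗[ℂ] Y),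
      hinner (B := C) (L y) (lift t ξ) = hinner (B := C) y (lift f ξ) := by
    intro y ξ
    induction ξ using TensorProduct.induction_on with
    | zero => simp [hinner_zero_right]
    | add ξ ξ' hξ hξ' => simp only [map_add, hinner_add, hξ, hξ']
    | tmul x' y' => exact ht x x' y y'
  -- The norm of `⟨L (f ξ), ξ⟩` is `‖f ξ‖²`, so Cauchy-Schwarz bounds `‖f ξ‖²` by `‖x‖ ‖f ξ‖ ‖ξ‖`,
  -- and one factor cancels.
  have hb : ∀ ξ, ‖lift f ξ‖ ≤ ‖x‖ * ‖lift t ξ‖ := by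
    intro ξ
    rcases (norm_nonneg (lift f ξ)).eq_or_lt with h0 | h0
    · rw [← h0]
      positivity
    refine le_of_mul_le_mul_left ?_ h0
    rw [← sq, norm_sq_eq (B := C), ← hf]
    refine (norm_hinner_le _ _).trans ?_
    calc _ ≤ (‖x‖ * ‖lift f ξ‖) * ‖lift t ξ‖ := by gcongr; exact ht.norm_le hφ _ _
      _ = _ := by ring
  have hdr := hd.denseRange_lift
  have hL' := LinearMap.extendOfNorm_eq hdr ⟨_, hb⟩
  refine ⟨L, (lift f).extendOfNorm (lift t), fun y z => ?_, fun y => rfl, fun x' y => ?_⟩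
  · refine hdr.induction_on (p := fun z => hinner (B := C) (L y) z =
      hinner (B := C) y ((lift f).extendOfNorm (lift t) z)) z
      (isClosed_eq (continuous_hinner_right C _)
        ((continuous_hinner_right C y).comp (ContinuousLinearMap.continuous _))) fun ξ => ?_
    rw [hL', hf]
  · rw [← lift.tmul (f' := t), hL']
    rfl

/-- `T ↦ T ⊗ 1` is contractive and the compact operators are closed, so approximating `T` suffices.
This serves for rank-one operators and again for limits of finite-rank ones. -/
lemma mem_compacts_of_forall_norm_sub_lt
    (hφ : ∀ b : B, ‖(lact C b : Y →L[ℂ] Y)‖ ≤ ‖b‖)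
    (hd : HasDenseSpan t) (ht : PreservesHinner B C t)
    (ht' : PreservesHinner B C t') {T : X →L[ℂ] X'} {S : X' →L[ℂ] X} (h : IsAdjointPair B T S)
    {T' : Z →L[ℂ] Z'} (hT : IsTensorOne t t' T T')
    (H : ∀ ε > 0, ∃ (R : X →L[ℂ] X') (Q : X' →L[ℂ] X) (R' : Z →L[ℂ] Z'), IsAdjointPair B R Q ∧
      IsTensorOne t t' R R' ∧ R' ∈ Compacts C Z Z' ∧ ‖T - R‖ < ε) : T' ∈ Compacts C Z Z' := by
  have hcl : IsClosed (Compacts C Z Z' : Set (Z →L[ℂ] Z')) :=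
    Submodule.isClosed_topologicalClosure _
  rw [← SetLike.mem_coe, ← hcl.closure_eq, Metric.mem_closure_iff]
  intro ε hε
  obtain ⟨R, Q, R', hRQ, hR, hmem, hlt⟩ := H ε hε
  refine ⟨R', hmem, lt_of_le_of_lt ?_ hlt⟩
  rw [dist_eq_norm]
  refine IsTensorOne.norm_le hφ hd ht ht' (h.sub hRQ) fun x y => ?_
  simp [hT x y, hR x y]

/-- If the left action on `Y` is by compact operators, then `T ⊗ 1` is compact for compact `T`. -/
lemma IsTensorOne.mem_compacts
    (hφ : ∀ b : B, ‖(lact C b : Y →L[ℂ] Y)‖ ≤ ‖b‖)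
    (hc : ∀ b : B, (lact C b : Y →L[ℂ] Y) ∈ Compacts C Y Y)
    (hd : HasDenseSpan t) (hd' : HasDenseSpan t') (ht : PreservesHinner B C t)
    (ht' : PreservesHinner B C t')
    (hbal : ∀ (x : X') (b : B) (y : Y), t' (rmul x b) y = t' x (lact C b y))
    {T : X →L[ℂ] X'} (hmem : T ∈ Compacts B X X')
    {T' : Z →L[ℂ] Z'} (hT : IsTensorOne t t' T T') : T' ∈ Compacts C Z Z' := by
  have hone : ∀ (x' : X') (x : X) (R' : Z →L[ℂ] Z'), IsTensorOne t t' (rankOne B x' x) R' →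
      R' ∈ Compacts C Z Z' := by
    intro x' x R' hR'
    refine mem_compacts_of_forall_norm_sub_lt hφ hd ht ht' (isAdjointPair_rankOne x' x) hR'
      fun ε hε => ?_
    -- Writing `L_x` for `y ↦ x ⊗ y`, the operator `θ_{x', x b} ⊗ 1` factors as `L_{x'} φ(b⋆) L_x⋆`,
    -- with a compact operator in the middle. The error `θ_{x', x - x b}` has norm at most `‖x'‖ ‖x
    -- - x b‖`; adding `1` covers `x' = 0`.
    obtain ⟨b, hb⟩ := exists_norm_rmul_sub_lt B x (ε := ε / (‖x'‖ + 1)) (by positivity)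
    obtain ⟨L, L', hL, hL1, -⟩ := exists_creation hφ hd' ht' x'
    obtain ⟨Q, Q', hQ, -, hQ2⟩ := exists_creation hφ hd ht x
    refine ⟨rankOne B x' (rmul x b), _, L.comp ((lact C (star b)).comp Q'),
      isAdjointPair_rankOne _ _, fun u y => ?_, comp_comp_mem_compacts (hc _) hL hQ.symm, ?_⟩
    · simp only [ContinuousLinearMap.comp_apply, hQ2, hL1, rankOne_apply, hbal, hinner_rmul_left,
        map_mul]
      rfl
    · rw [← rankOne_sub_right]
      refine (norm_rankOne_le _ _).trans_lt ?_
      rw [norm_sub_rev, lt_div_iff₀ (by positivity)] at hb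
      nlinarith [norm_nonneg (x - rmul x b), norm_nonneg x']
  have hspan : ∀ R ∈ Submodule.span ℂ {R : X →L[ℂ] X' | IsRankOne B R},
      ∃ R', IsTensorOne t t' R R' ∧ R' ∈ Compacts C Z Z' := by
    intro R hR
    induction hR using Submodule.span_induction with
    | mem R h =>
      obtain ⟨y, x, rfl⟩ := h.exists_eq
      obtain ⟨R', h1, -⟩ := exists_isTensorOne hφ hd ht ht' (isAdjointPair_rankOne y x)
      exact ⟨R', h1, hone _ _ _ h1⟩
    | zero => exact ⟨0, fun x y => by simp, zero_mem _⟩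
    | add R₁ R₂ _ _ h h' =>
      obtain ⟨S₁, h₁, m₁⟩ := h
      obtain ⟨S₂, h₂, m₂⟩ := h'
      exact ⟨S₁ + S₂, fun x y => by simp [h₁ x y, h₂ x y], add_mem m₁ m₂⟩
    | smul c R _ h =>
      obtain ⟨S₁, h₁, m₁⟩ := h
      exact ⟨c • S₁, fun x y => by simp [h₁ x y], Submodule.smul_mem _ _ m₁⟩
  refine mem_compacts_of_forall_norm_sub_lt hφ hd ht ht'
    (Compacts.isAdjointPair_adj ⟨T, hmem⟩) hT fun ε hε => ?_
  obtain ⟨R, hR, hlt⟩ := Metric.mem_closure_iff.1 (show T ∈ closure _ from hmem) ε hε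
  obtain ⟨R', h1, h2⟩ := hspan R hR
  refine ⟨R, _, R', Compacts.isAdjointPair_adj ⟨R, Submodule.le_topologicalClosure _ hR⟩, h1, h2, ?_⟩
  rwa [← dist_eq_norm]

/-- If the left action on `Y` is isometric, then `T ↦ T ⊗ 1` does not decrease norms. -/
lemma IsTensorOne.norm_ge (hφ : ∀ b : B, ‖(lact C b : Y →L[ℂ] Y)‖ = ‖b‖)
    (ht : PreservesHinner B C t) (ht' : PreservesHinner B C t') {T : X →L[ℂ] X'}
    {T' : Z →L[ℂ] Z'} (hT : IsTensorOne t t' T T') : ‖T‖ ≤ ‖T'‖ := by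
  refine T.opNorm_le_bound (norm_nonneg _) fun x => ?_
  -- With `⟨T x, T x⟩ = b⋆ b`, the vectors `T x ⊗ y` and `φ(b) y` have the same norm. So `‖T x‖ =
  -- ‖b‖ = ‖φ(b)‖` can be read off from the action of `T ⊗ 1` on the vectors `x ⊗ y`.
  obtain ⟨b, hb⟩ := hinner_self_pos (B := B) (T x)
  have hnorm : ‖T x‖ = ‖b‖ := by
    refine (sq_eq_sq₀ (norm_nonneg _) (norm_nonneg _)).1 ?_
    rw [norm_sq_eq (B := B), hb, CStarRing.norm_star_mul_self, sq]
  rw [hnorm, ← hφ b]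
  refine ContinuousLinearMap.opNorm_le_bound _ (by positivity) fun y => ?_
  have h1 : ‖lact C b y‖ = ‖t' (T x) y‖ := by
    refine (sq_eq_sq₀ (norm_nonneg _) (norm_nonneg _)).1 ?_
    rw [norm_sq_eq (B := C), norm_sq_eq (B := C), ht', hb, lact_adjoint, map_mul]
    rfl
  rw [h1, ← hT, mul_assoc]
  exact (T'.le_opNorm _).trans (by gcongr; exact ht.norm_le (fun b => (hφ b).le) x y)

end Tensor

/-! ## Paths in higher-rank graphs -/

section PathLemmas

variable {k : ℕ} {V : Type u} [Category.{v} V] [KGraph k V]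

lemma Path.mk_injective {a b : V} {α β : a ⟶ b} (h : Path.mk α = Path.mk β) : α = β := by
  injection h

lemma Path.mk_comp_congr {a b c a' b' c' : V} {α : a ⟶ b} {β : b ⟶ c} {α' : a' ⟶ b'}
    {β' : b' ⟶ c'} (h : Path.mk α = Path.mk α') (h' : Path.mk β = Path.mk β') :
    Path.mk (α ≫ β) = Path.mk (α' ≫ β') := by
  injection h with h₁ h₂ h₃
  subst h₁ h₂ h₃
  injection h' with h₁ h₂ h₃
  subst h₂ h₃
  rfl

lemma Path.exists_eq_mk_of_rng_eq {c : V} (P : Path V) (h : P.rng = c) :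
    ∃ (d : V) (ν : c ⟶ d), Path.mk ν = P := by
  subst h
  exact ⟨_, P.hom, rfl⟩

lemma Path.exists_eq_mk_of_src_eq {c : V} (P : Path V) (h : P.src = c) :
    ∃ (a : V) (ν : a ⟶ c), Path.mk ν = P := by
  subst h
  exact ⟨_, P.hom, rfl⟩

lemma deg_congr {a b a' b' : V} {α : a ⟶ b} {α' : a' ⟶ b'} (h : Path.mk α = Path.mk α') :
    KGraph.deg (k := k) α = KGraph.deg (k := k) α' :=
  congrArg (fun P : Path V => KGraph.deg (k := k) P.hom) h

variable (k) in
-- Unique factorisation in a form that tolerates endpoints that are only propositionally equal. The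
-- degrees of the second factors agree automatically, by cancellation in `ℕ^k`.
lemma Path.factor_unique {a b c a' b' c' : V} {α : a ⟶ b} {β : b ⟶ c} {α' : a' ⟶ b'}
    {β' : b' ⟶ c'} (h : Path.mk (α ≫ β) = Path.mk (α' ≫ β'))
    (hd : KGraph.deg (k := k) α = KGraph.deg (k := k) α') :
    Path.mk α = Path.mk α' ∧ Path.mk β = Path.mk β' := by
  have hdeg := deg_congr (k := k) h
  rw [KGraph.deg_comp, KGraph.deg_comp, hd, add_right_inj] at hdeg
  injection h with h₁ h₂ h₃
  subst h₁ h₂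
  have h₃ := eq_of_heq h₃
  have := (KGraph.factorisation (k := k) (α ≫ β) _ _ (KGraph.deg_comp α β)).unique
    (y₁ := ⟨b, α, β⟩) (y₂ := ⟨b', α', β'⟩) ⟨rfl, rfl, rfl⟩ ⟨hd.symm, hdeg.symm, h₃.symm⟩
  cases this
  exact ⟨rfl, rfl⟩

variable (k) in
/-- Paths of degree `0` are vertices. -/
lemma Path.mk_eq_mk_id {a b : V} {α : a ⟶ b} (h : KGraph.deg (k := k) α = 0) :
    Path.mk α = Path.mk (𝟙 a) :=
  -- Compare the factorisations `α · 1 = 1 · α`, whose first factors both have degree `0`.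
  (Path.factor_unique k (α := α) (β := 𝟙 b) (α' := 𝟙 a) (β' := α) (by simp)
    (by rw [h, KGraph.deg_id])).1

namespace InfinitePath

/-- The segment `x(m, n)` together with its endpoints. -/
def seg (x : InfinitePath k V) {m n : Fin k → ℕ} (h : m ≤ n) : Path V := Path.mk (x.map h)

lemma seg_congr (x : InfinitePath k V) {m n m' n' : Fin k → ℕ} (h : m ≤ n) (h' : m' ≤ n')
    (hm : m = m') (hn : n = n') : x.seg h = x.seg h' := by
  subst hm hn
  rfl

lemma seg_trans (x : InfinitePath k V) {m n p : Fin k → ℕ} (h : m ≤ n) (h' : n ≤ p) :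
    x.seg (h.trans h') = Path.mk (x.map h ≫ x.map h') := by
  rw [seg, x.map_comp]

lemma seg_shift (x : InfinitePath k V) (p : Fin k → ℕ) {m n : Fin k → ℕ} (h : m ≤ n) :
    (x.shift p).seg h = x.seg (add_le_add_left h p) := rfl

lemma ext_seg {x y : InfinitePath k V}
    (H : ∀ {m n : Fin k → ℕ} (h : m ≤ n), x.seg h = y.seg h) : x = y := by
  have hobj : x.obj = y.obj := by
    funext n
    exact congrArg Path.rng (H (le_refl n))
  obtain ⟨o, f, h1, h2, h3⟩ := x
  obtain ⟨o', f', h1', h2', h3'⟩ := y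
  change o = o' at hobj
  subst hobj
  congr 1
  funext m n h
  exact Path.mk_injective (H h)

/-- `x(0, n) = x(0, m) x(m, n)`, and the degree `m` of the first factor determines both factors. -/
lemma seg_eq_of_seg_zero_eq {x y : InfinitePath k V} {m n : Fin k → ℕ} (h : m ≤ n)
    (H : x.seg (zero_le : 0 ≤ n) = y.seg (zero_le : 0 ≤ n)) : x.seg h = y.seg h := by
  have h1 := x.seg_trans (zero_le : 0 ≤ m) h
  have h2 := y.seg_trans (zero_le : 0 ≤ m) h
  exact (Path.factor_unique k (h1.symm.trans (H.trans h2))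
    (by rw [x.deg_map, y.deg_map])).2

lemma seg_zero_eq_of_le {x y : InfinitePath k V} {m n : Fin k → ℕ} (h : m ≤ n)
    (H : x.seg (zero_le : 0 ≤ n) = y.seg (zero_le : 0 ≤ n)) :
    x.seg (zero_le : 0 ≤ m) = y.seg (zero_le : 0 ≤ m) := by
  have h1 := x.seg_trans (zero_le : 0 ≤ m) h
  have h2 := y.seg_trans (zero_le : 0 ≤ m) h
  exact (Path.factor_unique k (h1.symm.trans (H.trans h2))
    (by rw [x.deg_map, y.deg_map])).1

lemma ext_seg_zero {x y : InfinitePath k V}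
    (H : ∀ n : Fin k → ℕ, x.seg (zero_le : 0 ≤ n) = y.seg (zero_le : 0 ≤ n)) : x = y :=
  ext_seg fun h => seg_eq_of_seg_zero_eq h (H _)

lemma seg_eq_seg_of_shift_eq {x y : InfinitePath k V} {p q : Fin k → ℕ}
    (h : x.shift p = y.shift q) (n : Fin k → ℕ) :
    x.seg (le_add_of_nonneg_right zero_le : p ≤ p + n) =
      y.seg (le_add_of_nonneg_right zero_le : q ≤ q + n) := by
  have h1 : (x.shift p).seg (zero_le : 0 ≤ n) = (y.shift q).seg (zero_le : 0 ≤ n) := by rw [h]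
  rw [seg_shift, seg_shift] at h1
  rw [x.seg_congr _ (add_le_add_left (zero_le : 0 ≤ n) p) (zero_add _).symm (add_comm _ _), h1]
  exact y.seg_congr _ _ (zero_add _) (add_comm _ _)

/-- `x(0, p + n) = x(0, p) x(p, p + n)`, where the second factor is an initial segment of the shift.
-/
lemma ext_of_shift_eq {x y : InfinitePath k V} {p : Fin k → ℕ}
    (h : x.seg (zero_le : 0 ≤ p) = y.seg (zero_le : 0 ≤ p)) (h' : x.shift p = y.shift p) :
    x = y := by
  refine ext_seg_zero fun n => seg_zero_eq_of_le (le_add_of_nonneg_left zero_le : n ≤ p + n) ?_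
  have e : (0 : Fin k → ℕ) ≤ p := zero_le
  have e' : p ≤ p + n := le_add_of_nonneg_right zero_le
  exact (x.seg_trans e e').trans ((Path.mk_comp_congr h (seg_eq_seg_of_shift_eq h' n)).trans
    (y.seg_trans e e').symm)

end InfinitePath

open InfinitePath

/-- The tail `z` is forced to be the common shift, so it can be eliminated. -/
lemma mem_cylinder_iff {a b c : V} {α : a ⟶ c} {β : b ⟶ c} {g : Elem (InfinitePath k V)} :
    g ∈ cylinder α β ↔
      g.rng.seg (zero_le : 0 ≤ KGraph.deg (k := k) α) = Path.mk α ∧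
      g.src.seg (zero_le : 0 ≤ KGraph.deg (k := k) β) = Path.mk β ∧
      g.rng.shift (KGraph.deg (k := k) α) = g.src.shift (KGraph.deg (k := k) β) ∧
      g.hom.1 = degDiff (KGraph.deg (k := k) α) (KGraph.deg (k := k) β) := by
  constructor
  · rintro ⟨z, ⟨h1, h2⟩, ⟨h3, h4⟩, h5⟩
    exact ⟨h1, h3, h2.trans h4.symm, h5⟩
  · rintro ⟨h1, h2, h3, h4⟩
    exact ⟨_, ⟨h1, rfl⟩, ⟨h2, h3.symm⟩, h4⟩

lemma degDiff_add (l m p : Fin k → ℕ) : degDiff (l + p) (m + p) = degDiff l m := by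
  funext i
  simp [degDiff]

/-- Membership in `Z(αν, βν)`. -/
lemma mem_cylinder_comp_iff {a b c d : V} {α : a ⟶ c} {β : b ⟶ c} {ν : c ⟶ d}
    {g : Elem (InfinitePath k V)} :
    g ∈ cylinder (α ≫ ν) (β ≫ ν) ↔ g ∈ cylinder α β ∧
      g.rng.seg (le_add_of_nonneg_right zero_le : KGraph.deg (k := k) α ≤
        KGraph.deg (k := k) α + KGraph.deg (k := k) ν) = Path.mk ν := by
  rw [mem_cylinder_iff, mem_cylinder_iff]
  -- Starting with `γν` means starting with `γ` and continuing with `ν`; this is needed for the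
  -- range and for the source. Once the tails coincide, it is enough to ask for `ν` on the range
  -- side.
  have e1 : ∀ {e : V} (γ : e ⟶ c) (x : InfinitePath k V),
      x.seg (zero_le : 0 ≤ KGraph.deg (k := k) (γ ≫ ν)) = Path.mk (γ ≫ ν) ↔
      x.seg (zero_le : 0 ≤ KGraph.deg (k := k) γ) = Path.mk γ ∧
      x.seg (le_add_of_nonneg_right zero_le : KGraph.deg (k := k) γ ≤
        KGraph.deg (k := k) γ + KGraph.deg (k := k) ν) = Path.mk ν := by
    intro e γ x
    rw [x.seg_congr _ (zero_le.trans (le_add_of_nonneg_right zero_le : KGraph.deg (k := k) γ ≤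
        KGraph.deg (k := k) γ + KGraph.deg (k := k) ν)) rfl (KGraph.deg_comp γ ν),
      x.seg_trans zero_le (le_add_of_nonneg_right zero_le)]
    constructor
    · intro h
      exact Path.factor_unique k h (by rw [x.deg_map, tsub_zero])
    · rintro ⟨h1, h2⟩
      exact Path.mk_comp_congr h1 h2
  rw [e1, e1]
  constructor
  · rintro ⟨⟨h1, h2⟩, ⟨h3, h4⟩, h5, h6⟩
    refine ⟨⟨h1, h3, ?_, ?_⟩, h2⟩
    · rw [KGraph.deg_comp, KGraph.deg_comp, add_comm, ← shift_shift, add_comm (KGraph.deg β),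
        ← shift_shift] at h5
      -- Both tails begin with `ν` and agree after it.
      refine ext_of_shift_eq ?_ h5
      exact (g.rng.seg_congr _ _ (zero_add _) (add_comm _ _)).trans
        (h2.trans (h4.symm.trans (g.src.seg_congr _ _ (zero_add _).symm (add_comm _ _))))
    · rw [h6, KGraph.deg_comp, KGraph.deg_comp, degDiff_add]
  · rintro ⟨⟨h1, h2, h3, h4⟩, h5⟩
    refine ⟨⟨h1, h5⟩, ⟨h2, ?_⟩, ?_, ?_⟩
    · rw [← seg_eq_seg_of_shift_eq h3, h5]
    · rw [KGraph.deg_comp, KGraph.deg_comp, add_comm, ← shift_shift, add_comm (KGraph.deg β),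
        ← shift_shift, h3]
    · rw [h4, KGraph.deg_comp, KGraph.deg_comp, degDiff_add]

/-! ### The directed set of decompositions -/

lemma cylinder_comp_subset {a b c d : V} (α : a ⟶ c) (β : b ⟶ c) (ν : c ⟶ d) :
    (cylinder (α ≫ ν) (β ≫ ν) : Set (Elem (InfinitePath k V))) ⊆ cylinder α β :=
  fun _ h => (mem_cylinder_comp_iff.1 h).1

/-- The extension `(αν, βν)` of the decomposition `(α, β)`. -/
@[reducible] def Decomp.extend {g : Elem (InfinitePath k V)} (D : Decomp g) {d : V}
    (ν : D.c ⟶ d) (h : g ∈ cylinder (D.α ≫ ν) (D.β ≫ ν)) : Decomp g :=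
  ⟨D.α ≫ ν, D.β ≫ ν, h⟩

/-- `ν` is the segment of degree `p` that follows `α` in the range of `g`. -/
lemma Decomp.exists_extend {g : Elem (InfinitePath k V)} (D : Decomp g) (p : Fin k → ℕ) :
    ∃ (d : V) (ν : D.c ⟶ d), KGraph.deg (k := k) ν = p ∧
      g ∈ cylinder (D.α ≫ ν) (D.β ≫ ν) := by
  have hm := mem_cylinder_iff.1 D.mem
  obtain ⟨d, ν, hν⟩ := Path.exists_eq_mk_of_rng_eq
    (g.rng.seg (le_add_of_nonneg_right zero_le : KGraph.deg (k := k) D.α ≤ _ + p))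
    (congrArg Path.src hm.1)
  have hdeg : KGraph.deg (k := k) ν = p := by
    rw [deg_congr (k := k) hν, g.rng.deg_map, add_tsub_cancel_left]
  refine ⟨d, ν, hdeg, mem_cylinder_comp_iff.2 ⟨D.mem, ?_⟩⟩
  rw [hν]
  exact g.rng.seg_congr _ _ rfl (by rw [hdeg])

lemma degDiff_eq_iff {l m l' m' : Fin k → ℕ} : degDiff l m = degDiff l' m' ↔ l + m' = l' + m := by
  simp only [funext_iff, degDiff, Pi.add_apply]
  refine forall_congr' fun i => ?_
  omega

/-- A decomposition is determined by the degree of its first path: the integer vector of `g` gives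
the other degree, and the two paths are initial segments of the range and the source. So the
extension of `D` by a segment of the missing degree must be `D'`. This is why an order by degrees
alone indexes the connecting maps. -/
lemma Decomp.exists_eq_extend {g : Elem (InfinitePath k V)} {D D' : Decomp g} (hle : D ≤ D') :
    ∃ (d : V) (ν : D.c ⟶ d) (h : g ∈ cylinder (D.α ≫ ν) (D.β ≫ ν)), D' = D.extend ν h := by
  have hle' : KGraph.deg (k := k) D.α ≤ KGraph.deg (k := k) D'.α := hle
  obtain ⟨d, ν, hν, hmem⟩ := D.exists_extend (KGraph.deg (k := k) D'.α - KGraph.deg (k := k) D.α)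
  refine ⟨d, ν, hmem, ?_⟩
  have h1 := mem_cylinder_iff.1 hmem
  have h2 := mem_cylinder_iff.1 D'.mem
  have hα : KGraph.deg (k := k) (D.α ≫ ν) = KGraph.deg (k := k) D'.α := by
    rw [KGraph.deg_comp, hν, add_tsub_cancel_of_le hle']
  have hβ : KGraph.deg (k := k) (D.β ≫ ν) = KGraph.deg (k := k) D'.β := by
    have := h1.2.2.2.symm.trans h2.2.2.2
    rw [degDiff_eq_iff, hα, add_right_inj] at this
    exact this.symm
  have eα : Path.mk (D.α ≫ ν) = Path.mk D'.α := by
    rw [← h1.1, ← h2.1]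
    exact g.rng.seg_congr _ _ rfl hα
  have eβ : Path.mk (D.β ≫ ν) = Path.mk D'.β := by
    rw [← h1.2.1, ← h2.2.1]
    exact g.src.seg_congr _ _ rfl hβ
  obtain ⟨α', β', h'⟩ := D'
  injection eα with e1 e2 e3
  subst e1 e2
  have e3 := eq_of_heq e3
  subst e3
  injection eβ with e1 e2 e3
  subst e1
  have e3 := eq_of_heq e3
  subst e3
  rfl

lemma Decomp.extend_injective {g : Elem (InfinitePath k V)} {D : Decomp g} {d d' : V}
    {ν : D.c ⟶ d} {ν' : D.c ⟶ d'} {h : g ∈ cylinder (D.α ≫ ν) (D.β ≫ ν)}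
    {h' : g ∈ cylinder (D.α ≫ ν') (D.β ≫ ν')} (e : D.extend ν h = D.extend ν' h') :
    Path.mk ν = Path.mk ν' := by
  have e1 : Path.mk (D.α ≫ ν) = Path.mk (D.α ≫ ν') :=
    congrArg (fun D : Decomp g => Path.mk D.α) e
  exact (Path.factor_unique k e1 rfl).2

lemma Decomp.le_extend {g : Elem (InfinitePath k V)} (D : Decomp g) {d : V}
    (ν : D.c ⟶ d) (h : g ∈ cylinder (D.α ≫ ν) (D.β ≫ ν)) : D ≤ D.extend ν h := by
  change KGraph.deg (k := k) D.α ≤ KGraph.deg (k := k) (D.α ≫ ν)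
  rw [KGraph.deg_comp]
  exact le_add_of_nonneg_right zero_le

/-- If `σ^l(x) = σ^m(y)`, then `x(0, l)` and `y(0, m)` have the same source; the second path is
transported along this equality of vertices. -/
instance (g : Elem (InfinitePath k V)) : Nonempty (Decomp g) := by
  obtain @⟨x, y, ⟨n, l, m, hs, hn⟩⟩ := g
  have hobj : y.obj m = x.obj l := by
    have : (x.shift l).obj 0 = (y.shift m).obj 0 := by rw [hs]
    change x.obj (0 + l) = y.obj (0 + m) at this
    rw [zero_add, zero_add] at this
    exact this.symm
  obtain ⟨b, β, hβ⟩ := Path.exists_eq_mk_of_src_eq (y.seg (zero_le : 0 ≤ m)) hobj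
  have hα' : KGraph.deg (k := k) (x.map (zero_le : 0 ≤ l)) = l := by rw [x.deg_map, tsub_zero]
  have hβ' : KGraph.deg (k := k) β = m := by
    rw [deg_congr (k := k) hβ, y.deg_map, tsub_zero]
  refine ⟨⟨x.map (zero_le : 0 ≤ l), β, mem_cylinder_iff.2 ⟨?_, ?_, ?_, ?_⟩⟩⟩
  · exact x.seg_congr _ _ rfl hα'
  · rw [hβ]
    exact y.seg_congr _ _ rfl hβ'
  · change x.shift _ = y.shift _
    rw [hα', hβ', hs]
  · rw [hα', hβ']
    exact hn

lemma Decomp.exists_ge {g : Elem (InfinitePath k V)} (D : Decomp g) (n : Fin k → ℕ) :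
    ∃ D', D ≤ D' ∧ n ≤ KGraph.deg (k := k) D'.α := by
  obtain ⟨d, ν, hν, h⟩ := D.exists_extend n
  refine ⟨D.extend ν h, D.le_extend ν h, ?_⟩
  change n ≤ KGraph.deg (k := k) (D.α ≫ ν)
  rw [KGraph.deg_comp, hν]
  exact le_add_of_nonneg_left zero_le

instance (g : Elem (InfinitePath k V)) : IsDirectedOrder (Decomp g) :=
  ⟨fun D D' => by
    obtain ⟨D'', h1, h2⟩ := D.exists_ge (KGraph.deg (k := k) D'.α)
    exact ⟨D'', h1, h2⟩⟩

lemma Decomp.cylinder_subset {g : Elem (InfinitePath k V)} {D D' : Decomp g} (h : D ≤ D') :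
    (cylinder D'.α D'.β : Set (Elem (InfinitePath k V))) ⊆ cylinder D.α D.β := by
  obtain ⟨d, ν, hν, rfl⟩ := Decomp.exists_eq_extend h
  exact cylinder_comp_subset _ _ _

lemma Decomp.exists_composable_of_mk_eq {x y z : InfinitePath k V} {g : x ⟶ y} {h : y ⟶ z}
    {a b c b' d d' : V} {α : a ⟶ d} {β : b ⟶ d} {β' : b' ⟶ d'} {γ : c ⟶ d'}
    (hg : Elem.mk g ∈ cylinder α β) (hh : Elem.mk h ∈ cylinder β' γ)
    (hβ : Path.mk β = Path.mk β') :
    ∃ (a b c d : V) (α' : a ⟶ d) (β'' : b ⟶ d) (γ' : c ⟶ d) (hg' : Elem.mk g ∈ cylinder α' β'')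
      (hh' : Elem.mk h ∈ cylinder β'' γ'),
      (⟨α, β, hg⟩ : Decomp (Elem.mk g)) ≤ ⟨α', β'', hg'⟩ ∧
        (⟨β', γ, hh⟩ : Decomp (Elem.mk h)) ≤ ⟨β'', γ', hh'⟩ := by
  injection hβ with e1 e2 e3
  subst e1 e2
  have e3 := eq_of_heq e3
  subst e3
  exact ⟨_, _, _, _, α, β, γ, hg, hh, le_rfl, le_rfl⟩

/-- Decompositions of `g` and of `h` have extensions `(α, β)` and `(β, γ)`. -/
lemma Decomp.exists_composable {x y z : InfinitePath k V} {g : x ⟶ y} {h : y ⟶ z}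
    (D : Decomp (Elem.mk g)) (D' : Decomp (Elem.mk h)) :
    ∃ (a b c d : V) (α : a ⟶ d) (β : b ⟶ d) (γ : c ⟶ d) (hg : Elem.mk g ∈ cylinder α β)
      (hh : Elem.mk h ∈ cylinder β γ), D ≤ ⟨α, β, hg⟩ ∧ D' ≤ ⟨β, γ, hh⟩ := by
  -- Both middle paths are prolonged to the join of their degrees; being initial segments of the
  -- same `y`, they then coincide.
  obtain ⟨e, ν, hν, hD⟩ := D.exists_extend
    (KGraph.deg (k := k) D.β ⊔ KGraph.deg (k := k) D'.α - KGraph.deg (k := k) D.β)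
  obtain ⟨e', ν', hν', hD'⟩ := D'.exists_extend
    (KGraph.deg (k := k) D.β ⊔ KGraph.deg (k := k) D'.α - KGraph.deg (k := k) D'.α)
  have h1 := mem_cylinder_iff.1 hD
  have h2 := mem_cylinder_iff.1 hD'
  have hle := D.le_extend ν hD
  have hle' := D'.le_extend ν' hD'
  have hβ : Path.mk (D.β ≫ ν) = Path.mk (D'.α ≫ ν') := by
    rw [← h1.2.1, ← h2.1]
    refine y.seg_congr _ _ rfl ?_
    rw [KGraph.deg_comp, KGraph.deg_comp, hν, hν', add_tsub_cancel_of_le le_sup_left,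
      add_tsub_cancel_of_le le_sup_right]
  obtain ⟨a, b, c, d, α, β, γ, hg, hh, h3, h4⟩ := exists_composable_of_mk_eq hD hD' hβ
  exact ⟨a, b, c, d, α, β, γ, hg, hh, hle.trans h3, hle'.trans h4⟩

/-! ### The topology of the path groupoid -/

lemma isOpen_cylinder {a b c : V} (α : a ⟶ c) (β : b ⟶ c) :
    IsOpen (cylinder α β : Set (Elem (InfinitePath k V))) :=
  TopologicalSpace.isOpen_generateFrom_of_mem ⟨a, b, c, α, β, rfl⟩

/-- Two cylinders containing an element contain a common smaller one through it, by directedness of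
its decompositions. So one directed set governs both the limit defining the fibre over `g` and the
neighbourhoods of `g`. -/
lemma hasBasis_nhds_cylinder (g : Elem (InfinitePath k V)) :
    (𝓝 g).HasBasis (fun _ : Decomp g => True) fun D => cylinder D.α D.β := by
  have hbasis : TopologicalSpace.IsTopologicalBasis
      {U : Set (Elem (InfinitePath k V)) | ∃ (a b c : V) (α : a ⟶ c) (β : b ⟶ c),
        U = cylinder α β} := by
    refine ⟨?_, ?_, rfl⟩
    · rintro _ ⟨a, b, c, α, β, rfl⟩ _ ⟨a', b', c', α', β', rfl⟩ h ⟨h1, h2⟩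
      obtain ⟨D, hD1, hD2⟩ := exists_ge_ge (⟨α, β, h1⟩ : Decomp h) ⟨α', β', h2⟩
      exact ⟨_, ⟨_, _, _, D.α, D.β, rfl⟩, D.mem, Set.subset_inter (Decomp.cylinder_subset hD1)
        (Decomp.cylinder_subset hD2)⟩
    · refine Set.eq_univ_of_forall fun h => ?_
      obtain ⟨D⟩ : Nonempty (Decomp h) := inferInstance
      exact ⟨_, ⟨_, _, _, D.α, D.β, rfl⟩, D.mem⟩
  refine hbasis.nhds_hasBasis.to_hasBasis ?_ ?_
  · rintro _ ⟨⟨a, b, c, α, β, rfl⟩, h⟩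
    exact ⟨⟨α, β, h⟩, trivial, subset_rfl⟩
  · rintro D -
    exact ⟨_, ⟨⟨_, _, _, D.α, D.β, rfl⟩, D.mem⟩, subset_rfl⟩

lemma cylinder_mem_nhds {a b c : V} {α : a ⟶ c} {β : b ⟶ c} {g : Elem (InfinitePath k V)}
    (h : g ∈ cylinder α β) : cylinder α β ∈ 𝓝 g :=
  (isOpen_cylinder α β).mem_nhds h

lemma Elem.ext_of_hom_val {g h : Elem (InfinitePath k V)} (h1 : g.rng = h.rng)
    (h2 : g.src = h.src) (h3 : g.hom.1 = h.hom.1) : g = h := by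
  obtain @⟨x, y, n⟩ := g
  obtain @⟨x', y', n'⟩ := h
  change x = x' at h1
  change y = y' at h2
  subst h1 h2
  exact congrArg Elem.mk (Subtype.ext h3)

lemma seg_eq_of_mem_cylinder {a b c : V} {α : a ⟶ c} {β : b ⟶ c}
    {g h : Elem (InfinitePath k V)} (hg : g ∈ cylinder α β) (hh : h ∈ cylinder α β) :
    g.rng.seg (zero_le : 0 ≤ KGraph.deg (k := k) α) =
      h.rng.seg (zero_le : 0 ≤ KGraph.deg (k := k) α) ∧
    g.src.seg (zero_le : 0 ≤ KGraph.deg (k := k) β) =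
      h.src.seg (zero_le : 0 ≤ KGraph.deg (k := k) β) :=
  ⟨(mem_cylinder_iff.1 hg).1.trans (mem_cylinder_iff.1 hh).1.symm,
    (mem_cylinder_iff.1 hg).2.1.trans (mem_cylinder_iff.1 hh).2.1.symm⟩

lemma Decomp.exists_deg_ge {g : Elem (InfinitePath k V)} (n : Fin k → ℕ) :
    ∃ D : Decomp g, n ≤ KGraph.deg (k := k) D.α ∧ n ≤ KGraph.deg (k := k) D.β := by
  obtain ⟨D⟩ : Nonempty (Decomp g) := inferInstance
  obtain ⟨d, ν, hν, h⟩ := D.exists_extend n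
  refine ⟨D.extend ν h, ?_, ?_⟩
  · change n ≤ KGraph.deg (k := k) (D.α ≫ ν)
    rw [KGraph.deg_comp, hν]
    exact le_add_of_nonneg_left zero_le
  · change n ≤ KGraph.deg (k := k) (D.β ≫ ν)
    rw [KGraph.deg_comp, hν]
    exact le_add_of_nonneg_left zero_le

lemma eventually_seg_rng_eq (g : Elem (InfinitePath k V)) (n : Fin k → ℕ) :
    ∀ᶠ h in 𝓝 g, h.rng.seg (zero_le : 0 ≤ n) = g.rng.seg (zero_le : 0 ≤ n) := by
  obtain ⟨D, h1, -⟩ := Decomp.exists_deg_ge (g := g) n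
  filter_upwards [cylinder_mem_nhds D.mem] with h hh
  exact seg_zero_eq_of_le h1 (seg_eq_of_mem_cylinder hh D.mem).1

lemma eventually_seg_src_eq (g : Elem (InfinitePath k V)) (n : Fin k → ℕ) :
    ∀ᶠ h in 𝓝 g, h.src.seg (zero_le : 0 ≤ n) = g.src.seg (zero_le : 0 ≤ n) := by
  obtain ⟨D, -, h1⟩ := Decomp.exists_deg_ge (g := g) n
  filter_upwards [cylinder_mem_nhds D.mem] with h hh
  exact seg_zero_eq_of_le h1 (seg_eq_of_mem_cylinder hh D.mem).2

lemma eventually_hom_val_eq (g : Elem (InfinitePath k V)) : ∀ᶠ h in 𝓝 g, h.hom.1 = g.hom.1 := by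
  obtain ⟨D⟩ : Nonempty (Decomp g) := inferInstance
  filter_upwards [cylinder_mem_nhds D.mem] with h hh
  rw [(mem_cylinder_iff.1 hh).2.2.2, (mem_cylinder_iff.1 D.mem).2.2.2]

/-- Every initial segment and the integer vector are locally constant, and together they determine
the element. -/
instance : T2Space (Elem (InfinitePath k V)) := by
  refine t2_iff_nhds.2 fun {g h} hne => ?_
  refine Elem.ext_of_hom_val (ext_seg_zero fun n => ?_) (ext_seg_zero fun n => ?_) ?_
  · obtain ⟨e, h1, h2⟩ := (((eventually_seg_rng_eq g n).filter_mono inf_le_left).and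
      ((eventually_seg_rng_eq h n).filter_mono inf_le_right)).exists
    exact h1.symm.trans h2
  · obtain ⟨e, h1, h2⟩ := (((eventually_seg_src_eq g n).filter_mono inf_le_left).and
      ((eventually_seg_src_eq h n).filter_mono inf_le_right)).exists
    exact h1.symm.trans h2
  · obtain ⟨e, h1, h2⟩ := (((eventually_hom_val_eq g).filter_mono inf_le_left).and
      ((eventually_hom_val_eq h).filter_mono inf_le_right)).exists
    exact h1.symm.trans h2

/-- Limits of ultrafilters of infinite paths with fixed range. -/
lemma exists_limit_path (hrf : RowFiniteNoSources k V) {ι : Type*} (U : Ultrafilter ι)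
    (f : ι → InfinitePath k V) (a : V) (ha : ∀ᶠ i in U, (f i).obj 0 = a) :
    ∃ x : InfinitePath k V, ∀ {m n : Fin k → ℕ} (h : m ≤ n), ∀ᶠ i in U, (f i).seg h = x.seg h := by
  -- There are finitely many paths of degree `n` with range `a`, so the ultrafilter selects one of
  -- them.
  have h0 : ∀ n : Fin k → ℕ, ∃ P : Path V, ∀ᶠ i in U, (f i).seg (zero_le : 0 ≤ n) = P := by
    intro n
    have hfin := (hrf a n).1
    have : ∀ᶠ i in U, ∃ p ∈ {p : Σ b : V, a ⟶ b | KGraph.deg (k := k) p.2 = n},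
        (f i).seg (zero_le : 0 ≤ n) = Path.mk p.2 := by
      filter_upwards [ha] with i hi
      obtain ⟨d, ν, hν⟩ := Path.exists_eq_mk_of_rng_eq ((f i).seg (zero_le : 0 ≤ n)) hi
      refine ⟨⟨d, ν⟩, ?_, hν.symm⟩
      change KGraph.deg ν = n
      rw [deg_congr (k := k) hν, (f i).deg_map, tsub_zero]
    obtain ⟨p, -, hp⟩ := (Ultrafilter.eventually_exists_mem_iff hfin).1 this
    exact ⟨_, hp⟩
  have h1 : ∀ (m n : Fin k → ℕ) (h : m ≤ n), ∃ P : Path V, ∀ᶠ i in U, (f i).seg h = P := by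
    intro m n h
    obtain ⟨P, hP⟩ := h0 n
    obtain ⟨j, hj⟩ := hP.exists
    refine ⟨(f j).seg h, ?_⟩
    filter_upwards [hP] with i hi
    exact seg_eq_of_seg_zero_eq h (hi.trans hj.symm)
  choose P hP using h1
  have hrng : ∀ m n h, (P m m le_rfl).rng = (P m n h).rng := by
    intro m n h
    obtain ⟨i, h1, h2⟩ := ((hP m m le_rfl).and (hP m n h)).exists
    rw [← h1, ← h2]
    rfl
  have hsrc : ∀ m n h, (P m n h).src = (P n n le_rfl).rng := by
    intro m n h
    obtain ⟨i, h1, h2⟩ := ((hP n n le_rfl).and (hP m n h)).exists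
    rw [← h1, ← h2]
    rfl
  -- The selected segments fit together only up to propositional equality of vertices. Correcting
  -- them by `eqToHom` does not change the underlying `Path`. The functor laws are then read off at
  -- one index where finitely many selected segments are attained.
  have hmk : ∀ (Q : Path V) (a b : V) (h1 : a = Q.rng) (h2 : Q.src = b),
      Path.mk (eqToHom h1 ≫ Q.hom ≫ eqToHom h2) = Q := by
    rintro Q a b rfl rfl
    simp
  let F : ∀ {m n : Fin k → ℕ} (_ : m ≤ n), (P m m le_rfl).rng ⟶ (P n n le_rfl).rng :=
    fun {m n} h => eqToHom (hrng m n h) ≫ (P m n h).hom ≫ eqToHom (hsrc m n h)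
  have hF : ∀ {m n : Fin k → ℕ} (h : m ≤ n), Path.mk (F h) = P m n h := fun h => hmk _ _ _ _ _
  let x : InfinitePath k V :=
    { obj := fun n => (P n n le_rfl).rng
      map := F
      map_id := by
        intro m
        obtain ⟨i, hi⟩ := (hP m m le_rfl).exists
        refine Path.mk_injective ?_
        rw [hF, ← hi, seg, (f i).map_id]
      map_comp := by
        intro m n p h h'
        obtain ⟨i, h1, h2, h3⟩ := ((hP m n h).and ((hP n p h').and (hP m p (h.trans h')))).exists
        refine Path.mk_injective ?_
        rw [hF, ← h3, seg_trans _ h h']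
        exact Path.mk_comp_congr (h1.trans (hF h).symm) (h2.trans (hF h').symm)
      deg_map := by
        intro m n h
        obtain ⟨i, h1⟩ := (hP m n h).exists
        rw [deg_congr (k := k) ((hF h).trans h1.symm), (f i).deg_map] }
  refine ⟨x, fun {m n} h => ?_⟩
  filter_upwards [hP m n h] with i hi
  exact hi.trans (hF h).symm

/-- For an ultrafilter on the cylinder, the ranges and the sources converge segment by segment.
Equality of the tails involves one pair of segments at a time, so it passes to the limit, and the
limit paths define an element of the cylinder. -/
lemma isCompact_cylinder (hrf : RowFiniteNoSources k V) {a b c : V} (α : a ⟶ c) (β : b ⟶ c) :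
    IsCompact (cylinder α β : Set (Elem (InfinitePath k V))) := by
  refine isCompact_iff_ultrafilter_le_nhds.2 fun U hU => ?_
  have hmem : ∀ᶠ g : Elem (InfinitePath k V) in (U : Filter _), g ∈ cylinder α β :=
    hU (mem_principal_self _)
  obtain ⟨x, hx⟩ := exists_limit_path hrf U (fun g => g.rng) a (by
    filter_upwards [hmem] with g hg
    exact congrArg Path.rng (mem_cylinder_iff.1 hg).1)
  obtain ⟨y, hy⟩ := exists_limit_path hrf U (fun g => g.src) b (by
    filter_upwards [hmem] with g hg
    exact congrArg Path.rng (mem_cylinder_iff.1 hg).2.1)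
  have hshift : x.shift (KGraph.deg (k := k) α) = y.shift (KGraph.deg (k := k) β) := by
    refine ext_seg fun {m n} h => ?_
    obtain ⟨g, h1, h2, h3⟩ := (hmem.and ((hx (add_le_add_left h _)).and
      (hy (add_le_add_left h _)))).exists
    rw [seg_shift, seg_shift, ← h2, ← h3, ← seg_shift _ _ h, ← seg_shift _ _ h,
      (mem_cylinder_iff.1 h1).2.2.1]
  let g : Elem (InfinitePath k V) := ⟨(⟨degDiff (KGraph.deg (k := k) α) (KGraph.deg (k := k) β),
    _, _, hshift, rfl⟩ : x ⟶ y)⟩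
  have hg : g ∈ cylinder α β := by
    refine mem_cylinder_iff.2 ⟨?_, ?_, hshift, rfl⟩
    · obtain ⟨g', h1, h2⟩ := (hmem.and (hx zero_le)).exists
      exact h2.symm.trans (mem_cylinder_iff.1 h1).1
    · obtain ⟨g', h1, h2⟩ := (hmem.and (hy zero_le)).exists
      exact h2.symm.trans (mem_cylinder_iff.1 h1).2.1
  -- It suffices to treat neighbourhoods `Z(αν, βν)`. Inside `Z(α, β)` these impose a condition only
  -- on one segment of the range.
  refine ⟨g, hg, ((hasBasis_nhds_cylinder g).ge_iff).2 fun D _ => ?_⟩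
  obtain ⟨D', hD1, hD2⟩ := exists_ge_ge D (⟨α, β, hg⟩ : Decomp g)
  refine mem_of_superset ?_ (Decomp.cylinder_subset hD1)
  obtain ⟨d, ν, hν, rfl⟩ := Decomp.exists_eq_extend hD2
  filter_upwards [hmem, hx (le_add_of_nonneg_right zero_le : KGraph.deg (k := k) α ≤
        KGraph.deg (k := k) α + KGraph.deg (k := k) ν)] with g' h1 h2
  exact mem_cylinder_comp_iff.2 ⟨h1, h2.trans (mem_cylinder_comp_iff.1 hν).2⟩

lemma isClosed_cylinder (hrf : RowFiniteNoSources k V) {a b c : V} (α : a ⟶ c) (β : b ⟶ c) :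
    IsClosed (cylinder α β : Set (Elem (InfinitePath k V))) :=
  (isCompact_cylinder hrf α β).isClosed

lemma continuous_inv_pathGroupoid :
    Continuous fun g : Elem (InfinitePath k V) => Elem.mk (Groupoid.inv g.hom) := by
  refine continuous_generateFrom_iff.2 ?_
  rintro _ ⟨a, b, c, α, β, rfl⟩
  convert isOpen_cylinder (k := k) β α using 1
  ext g
  refine ⟨fun h => ?_, fun h => mem_cylinder_inv h⟩
  have := mem_cylinder_inv (g := Groupoid.inv g.hom) h
  have e : Groupoid.inv (Groupoid.inv g.hom) = g.hom := Subtype.ext (neg_neg _)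
  rwa [e] at this

/-- A cylinder around `gh` contains a product `Z(α, β) Z(β, γ)` of cylinders around `g` and `h`. The
filter form also serves for the base points in the proof that multiplication of the bundle is
continuous. -/
lemma tendsto_mul_pathGroupoid {ι : Type*} {l : Filter ι} (f : ι → ComposablePair (InfinitePath k V))
    {x y z : InfinitePath k V} (g : x ⟶ y) (h : y ⟶ z)
    (h1 : Tendsto (fun i => Elem.mk (f i).fst) l (𝓝 (Elem.mk g)))
    (h2 : Tendsto (fun i => Elem.mk (f i).snd) l (𝓝 (Elem.mk h))) :
    Tendsto (fun i => Elem.mk ((f i).fst ≫ (f i).snd)) l (𝓝 (Elem.mk (g ≫ h))) := by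
  refine (hasBasis_nhds_cylinder _).tendsto_right_iff.2 fun D _ => ?_
  obtain ⟨D₁⟩ : Nonempty (Decomp (Elem.mk g)) := inferInstance
  obtain ⟨D₂⟩ : Nonempty (Decomp (Elem.mk h)) := inferInstance
  obtain ⟨D₁', hD₁, hle₁⟩ := D₁.exists_ge (KGraph.deg (k := k) D.α)
  obtain ⟨a, b, c, d, α, β, γ, hg, hh, e1, e2⟩ := D₁'.exists_composable D₂
  have hle : D ≤ ⟨α, γ, mem_cylinder_comp hg hh⟩ := hle₁.trans e1
  filter_upwards [h1 (cylinder_mem_nhds hg), h2 (cylinder_mem_nhds hh)] with i hi1 hi2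
  exact Decomp.cylinder_subset hle (mem_cylinder_comp hi1 hi2)

/-- The path groupoid of a row-finite graph is a locally compact Hausdorff groupoid. -/
lemma isLocallyCompactHausdorffGroupoid (hrf : RowFiniteNoSources k V) :
    IsLocallyCompactHausdorffGroupoid (InfinitePath k V) where
  t2 := inferInstance
  locallyCompact := by
    have : WeaklyLocallyCompactSpace (Elem (InfinitePath k V)) := ⟨fun g => by
      obtain ⟨D⟩ : Nonempty (Decomp g) := inferInstance
      exact ⟨_, isCompact_cylinder hrf D.α D.β, cylinder_mem_nhds D.mem⟩⟩
    infer_instance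
  continuous_inv := continuous_inv_pathGroupoid
  continuous_mul := by
    let _ : TopologicalSpace (ComposablePair (InfinitePath k V)) := TopologicalSpace.induced
      (fun p => (Elem.mk p.fst, Elem.mk p.snd)) inferInstance
    have hc : Continuous fun p : ComposablePair (InfinitePath k V) =>
      (Elem.mk p.fst, Elem.mk p.snd) := continuous_induced_dom
    exact continuous_iff_continuousAt.2 fun p => tendsto_mul_pathGroupoid (fun p => p) p.fst p.snd
      hc.fst.continuousAt hc.snd.continuousAt

end PathLemmas

/-! ## Banach bundles from spaces of sections -/

section BanachBundles

variable {G : Type*} [TopologicalSpace G] {E : G → Type*}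
  [∀ g, NormedAddCommGroup (E g)] [∀ g, NormedSpace ℂ (E g)] [∀ g, CompleteSpace (E g)]

/-- The topology on the total space for which the base point and the distances to the sections in
`Γ` are continuous. -/
@[reducible] def sectionTopology (Γ : Submodule ℂ (∀ g, E g)) : TopologicalSpace (Total E) :=
  TopologicalSpace.induced
    (fun e => ((e.base, fun f : Γ => ‖e.val - f.1 e.base‖) : G × (Γ → ℝ))) inferInstance

/-- `Γ` is a space of sections with continuous norm functions that is dense in every fibre. -/
structure IsGeneratingSections (Γ : Submodule ℂ (∀ g, E g)) : Prop where
  continuous_norm : ∀ f ∈ Γ, Continuous fun g => ‖f g‖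
  dense : ∀ g, Dense {e : E g | ∃ f ∈ Γ, f g = e}

lemma IsGeneratingSections.exists_norm_sub_lt {Γ : Submodule ℂ (∀ g, E g)}
    (hΓ : IsGeneratingSections Γ) {g : G} (e : E g) {ε : ℝ} (hε : 0 < ε) :
    ∃ f ∈ Γ, ‖e - f g‖ < ε := by
  obtain ⟨_, ⟨f, hf, rfl⟩, h⟩ := Metric.mem_closure_iff.1 (hΓ.dense g e) ε hε
  exact ⟨f, hf, by rwa [← dist_eq_norm]⟩

lemma tendsto_sectionTopology_iff {Γ : Submodule ℂ (∀ g, E g)} {ι : Type*} {l : Filter ι}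
    {u : ι → Total E} {e : Total E} :
    Tendsto u l (@nhds _ (sectionTopology Γ) e) ↔
      Tendsto (fun i => (u i).base) l (𝓝 e.base) ∧
      ∀ f ∈ Γ, Tendsto (fun i => ‖(u i).val - f (u i).base‖) l (𝓝 ‖e.val - f e.base‖) := by
  rw [sectionTopology, nhds_induced, tendsto_comap_iff, nhds_prod_eq, tendsto_prod_iff',
    tendsto_pi_nhds]
  exact and_congr Iff.rfl ⟨fun h f hf => h ⟨f, hf⟩, fun h f => h f.1 f.2⟩

/-- To converge to `e`, it suffices to converge in the base and to be close to a section that is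
close to `e`. -/
lemma IsGeneratingSections.tendsto_of_forall_lt {Γ : Submodule ℂ (∀ g, E g)}
    (hΓ : IsGeneratingSections Γ) {ι : Type*} {l : Filter ι} {u : ι → Total E} {e : Total E}
    (hb : Tendsto (fun i => (u i).base) l (𝓝 e.base))
    (H : ∀ ε > 0, ∃ f ∈ Γ, ‖e.val - f e.base‖ < ε ∧ ∀ᶠ i in l, ‖(u i).val - f (u i).base‖ < ε) :
    Tendsto u l (@nhds _ (sectionTopology Γ) e) := by
  refine tendsto_sectionTopology_iff.2 ⟨hb, fun f' hf' => Metric.tendsto_nhds.2 fun ε hε => ?_⟩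
  obtain ⟨f, hf, h1, h2⟩ := H (ε / 3) (by positivity)
  -- The distances of `u i` and of `e` to `f'` differ by less than `ε / 3` from the norms of `f -
  -- f'` at their base points. As `f - f' ∈ Γ`, these norms vary continuously.
  have h3 := ((hΓ.continuous_norm _ (Γ.sub_mem hf hf')).tendsto e.base).comp hb
  filter_upwards [h2, Metric.tendsto_nhds.1 h3 (ε / 3) (by positivity)] with i hi1 hi2
  simp only [Function.comp_apply, Pi.sub_apply, Real.dist_eq] at hi2 ⊢
  have k1 : |‖(u i).val - f' (u i).base‖ - ‖f (u i).base - f' (u i).base‖| ≤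
      ‖(u i).val - f (u i).base‖ := by
    refine (abs_norm_sub_norm_le _ _).trans_eq ?_
    congr 1
    abel
  have k2 : |‖e.val - f' e.base‖ - ‖f e.base - f' e.base‖| ≤ ‖e.val - f e.base‖ := by
    refine (abs_norm_sub_norm_le _ _).trans_eq ?_
    congr 1
    abel
  rw [abs_lt] at hi2 ⊢
  rw [abs_le] at k1 k2
  constructor <;> linarith [k1.1, k1.2, k2.1, k2.2, hi2.1, hi2.2]

lemma eventually_norm_sub_lt_of_tendsto {Γ : Submodule ℂ (∀ g, E g)} {ι : Type*} {l : Filter ι}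
    {u : ι → Total E} {e : Total E} (h : Tendsto u l (@nhds _ (sectionTopology Γ) e))
    {f : ∀ g, E g} (hf : f ∈ Γ) {ε : ℝ} (hlt : ‖e.val - f e.base‖ < ε) :
    ∀ᶠ i in l, ‖(u i).val - f (u i).base‖ < ε :=
  (tendsto_order.1 ((tendsto_sectionTopology_iff.1 h).2 f hf)).2 _ hlt

/-- Sections in `Γ` are continuous. -/
lemma IsGeneratingSections.tendsto_section {Γ : Submodule ℂ (∀ g, E g)}
    (hΓ : IsGeneratingSections Γ) {f : ∀ g, E g} (hf : f ∈ Γ) (g : G) :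
    Tendsto (fun g => (⟨g, f g⟩ : Total E)) (𝓝 g) (@nhds _ (sectionTopology Γ) ⟨g, f g⟩) :=
  hΓ.tendsto_of_forall_lt tendsto_id fun ε hε => ⟨f, hf, by simpa using hε, by simpa using hε⟩

/-- Values of sections are only dense in a fibre, so there may be no section in `Γ` through `e`.
Instead `e` is a limit of `f'(g)`, letting `g` tend to the base point for fixed `f'` and then
`f'(π(e))` to `e`; such iterated limits are described by `Filter.curry`. A single good `f'` proves
openness. -/
lemma IsGeneratingSections.isOpenMap_base {Γ : Submodule ℂ (∀ g, E g)}
    (hΓ : IsGeneratingSections Γ) :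
    @IsOpenMap _ _ (sectionTopology Γ) _ (Total.base : Total E → G) := by
  let _ := sectionTopology Γ
  refine isOpenMap_iff_nhds_le.2 fun e N hN => ?_
  have hne : (comap (fun f : Γ => f.1 e.base) (𝓝 e.val)).NeBot := by
    refine comap_neBot_iff.2 fun s hs => ?_
    obtain ⟨_, h, f, hf, rfl⟩ := mem_closure_iff_nhds.1 (hΓ.dense e.base e.val) s hs
    exact ⟨⟨f, hf⟩, h⟩
  have htend : Tendsto (fun p : Γ × G => (⟨p.2, p.1.1 p.2⟩ : Total E))
      ((comap (fun f : Γ => f.1 e.base) (𝓝 e.val)).curry (𝓝 e.base)) (𝓝 e) := by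
    refine hΓ.tendsto_of_forall_lt ?_ fun ε hε => ?_
    · exact tendsto_snd.mono_left curry_le_prod
    · obtain ⟨f, hf, hlt⟩ := hΓ.exists_norm_sub_lt e.val (half_pos hε)
      refine ⟨f, hf, by linarith, eventually_curry_iff.2 ?_⟩
      have : ∀ᶠ f' : Γ in comap (fun f : Γ => f.1 e.base) (𝓝 e.val),
          ‖e.val - f'.1 e.base‖ < ε / 2 := by
        have h1 : Tendsto (fun f : Γ => f.1 e.base) (comap (fun f : Γ => f.1 e.base) (𝓝 e.val))
          (𝓝 e.val) := tendsto_comap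
        have h2 := (tendsto_const_nhds (x := e.val)).sub h1
        rw [sub_self] at h2
        have h3 := h2.norm
        rw [norm_zero] at h3
        exact (tendsto_order.1 h3).2 _ (half_pos hε)
      filter_upwards [this] with f' hf'
      have hlt' : ‖(f'.1 - f) e.base‖ < ε := by
        calc ‖(f'.1 - f) e.base‖ = ‖(e.val - f e.base) - (e.val - f'.1 e.base)‖ := by
              rw [Pi.sub_apply]; congr 1; abel
          _ ≤ _ := norm_sub_le _ _
          _ < ε := by linarith
      exact (tendsto_order.1
        ((hΓ.continuous_norm _ (Γ.sub_mem f'.2 hf)).tendsto e.base)).2 _ hlt'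
  have hev : ∀ᶠ p in (comap (fun f : Γ => f.1 e.base) (𝓝 e.val)).curry (𝓝 e.base), p.2 ∈ N :=
    htend hN
  exact (eventually_curry_iff.1 hev).exists.choose_spec

/-- The bundle topology given by a generating space of sections. -/
lemma IsGeneratingSections.isBanachBundle [T2Space G] {Γ : Submodule ℂ (∀ g, E g)}
    (hΓ : IsGeneratingSections Γ) : @IsBanachBundle G _ E _ _ _ (sectionTopology Γ) := by
  let _ := sectionTopology Γ
  have hbase : Continuous (Total.base : Total E → G) :=
    continuous_iff_continuousAt.2 fun e => (tendsto_sectionTopology_iff.1 tendsto_id).1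
  have hdist : ∀ f ∈ Γ, Continuous fun e : Total E => ‖e.val - f e.base‖ := fun f hf =>
    continuous_iff_continuousAt.2 fun e => (tendsto_sectionTopology_iff.1 tendsto_id).2 f hf
  refine
    { t2 := ?_
      continuous_base := hbase
      isOpenMap_base := hΓ.isOpenMap_base
      continuous_norm := by simpa using hdist 0 Γ.zero_mem
      continuous_add := ?_
      continuous_smul := ?_
      tendsto_zero := ?_ }
  · refine T2Space.of_injective_continuous
      (f := fun e : Total E => ((e.base, fun f : Γ => ‖e.val - f.1 e.base‖) : G × (Γ → ℝ)))
      ?_ continuous_induced_dom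
    rintro ⟨g, a⟩ ⟨h, b⟩ hab
    injection hab with h1 h2
    change g = h at h1
    subst h1
    congr 1
    -- Points of a fibre with the same distances to all sections coincide: a section close to `a` is
    -- equally close to `b`.
    refine eq_of_forall_dist_le fun ε hε => ?_
    obtain ⟨f, hf, hlt⟩ := hΓ.exists_norm_sub_lt a (half_pos hε)
    have h3 : ‖a - f g‖ = ‖b - f g‖ := congrFun h2 ⟨f, hf⟩
    rw [dist_eq_norm]
    calc ‖a - b‖ = ‖(a - f g) - (b - f g)‖ := by congr 1; abel
      _ ≤ _ := norm_sub_le _ _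
      _ ≤ ε := by linarith
  · let _ : TopologicalSpace (Total fun g => E g × E g) := TopologicalSpace.induced
      (fun q : Total fun g => E g × E g =>
        ((⟨q.base, q.val.1⟩, ⟨q.base, q.val.2⟩) : Total E × Total E)) inferInstance
    have hc : Continuous fun q : Total fun g => E g × E g =>
      ((⟨q.base, q.val.1⟩, ⟨q.base, q.val.2⟩) : Total E × Total E) := continuous_induced_dom
    refine continuous_iff_continuousAt.2 fun q => ?_
    have h1 := hc.fst.continuousAt (x := q)
    have h2 := hc.snd.continuousAt (x := q)
    refine hΓ.tendsto_of_forall_lt (tendsto_sectionTopology_iff.1 h1).1 fun ε hε => ?_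
    obtain ⟨f, hf, hlt⟩ := hΓ.exists_norm_sub_lt q.val.1 (half_pos hε)
    obtain ⟨f', hf', hlt'⟩ := hΓ.exists_norm_sub_lt q.val.2 (half_pos hε)
    have key : ∀ (g : G) (a b : E g), ‖a - f g‖ < ε / 2 → ‖b - f' g‖ < ε / 2 →
        ‖(a + b) - (f + f') g‖ < ε := by
      intro g a b ha hb
      calc ‖(a + b) - (f + f') g‖ = ‖(a - f g) + (b - f' g)‖ := by
            rw [Pi.add_apply]; congr 1; abel
        _ ≤ _ := norm_add_le _ _
        _ < ε := by linarith
    refine ⟨f + f', Γ.add_mem hf hf', key _ _ _ hlt hlt', ?_⟩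
    filter_upwards [eventually_norm_sub_lt_of_tendsto h1 hf hlt,
      eventually_norm_sub_lt_of_tendsto h2 hf' hlt'] with q' hq hq'
    exact key _ _ _ hq hq'
  · intro t
    refine continuous_iff_continuousAt.2 fun e => ?_
    refine hΓ.tendsto_of_forall_lt hbase.continuousAt fun ε hε => ?_
    -- Adding `1` keeps the denominator positive for `t = 0`.
    obtain ⟨f, hf, hlt⟩ := hΓ.exists_norm_sub_lt e.val (ε := ε / (‖t‖ + 1)) (by positivity)
    have key : ∀ (g : G) (a : E g), ‖a - f g‖ < ε / (‖t‖ + 1) → ‖t • a - (t • f) g‖ < ε := by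
      intro g a ha
      rw [Pi.smul_apply, ← smul_sub, norm_smul]
      rw [lt_div_iff₀ (by positivity)] at ha
      nlinarith [norm_nonneg (a - f g)]
    refine ⟨t • f, Γ.smul_mem t hf, key _ _ hlt, ?_⟩
    filter_upwards [eventually_norm_sub_lt_of_tendsto tendsto_id hf hlt] with e' he'
    exact key _ _ he'
  · intro g
    refine hΓ.tendsto_of_forall_lt (u := id) (tendsto_comap.mono_left inf_le_right)
      fun ε hε => ⟨0, Γ.zero_mem, by simpa using hε, ?_⟩
    have : Tendsto (fun e : Total E => ‖e.val‖) (comap (fun e : Total E => ‖e.val‖) (𝓝 0) ⊓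
      comap Total.base (𝓝 g)) (𝓝 0) := tendsto_comap.mono_left inf_le_left
    simpa using (tendsto_order.1 this).2 ε hε

/-! ### Uniqueness of the bundle topology. -/

lemma IsBanachBundle.tendsto_add [TopologicalSpace (Total E)] (hE : IsBanachBundle E)
    {ι : Type*} {l : Filter ι} {r : ι → Total fun g => E g × E g} {g : G} {a b : E g}
    (h1 : Tendsto (fun i => (⟨(r i).base, (r i).val.1⟩ : Total E)) l (𝓝 ⟨g, a⟩))
    (h2 : Tendsto (fun i => (⟨(r i).base, (r i).val.2⟩ : Total E)) l (𝓝 ⟨g, b⟩)) :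
    Tendsto (fun i => (⟨(r i).base, (r i).val.1 + (r i).val.2⟩ : Total E)) l (𝓝 ⟨g, a + b⟩) := by
  let _ : TopologicalSpace (Total fun g => E g × E g) := TopologicalSpace.induced
    (fun q : Total fun g => E g × E g =>
      ((⟨q.base, q.val.1⟩, ⟨q.base, q.val.2⟩) : Total E × Total E)) inferInstance
  refine (hE.continuous_add.tendsto (⟨g, (a, b)⟩ : Total fun g => E g × E g)).comp ?_
  rw [nhds_induced, tendsto_comap_iff]
  exact h1.prodMk_nhds h2

/-- A bundle topology for which the sections in `Γ` are continuous is unique. -/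
lemma IsGeneratingSections.eq_sectionTopology {Γ : Submodule ℂ (∀ g, E g)}
    (hΓ : IsGeneratingSections Γ) (τ : TopologicalSpace (Total E)) (hE : IsBanachBundle E)
    (hc : ∀ f ∈ Γ, Continuous fun g => (⟨g, f g⟩ : Total E)) : τ = sectionTopology Γ := by
  -- In any such topology `e - f(π(e))` is the sum of `e` and a continuous section, so its norm is
  -- continuous. Hence `τ` is finer than `sectionTopology Γ`.
  have hdist : ∀ f ∈ Γ, Continuous fun e : Total E => ‖e.val - f e.base‖ := by
    intro f hf
    refine continuous_iff_continuousAt.2 fun e => ?_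
    have h1 : Tendsto (fun e : Total E => (⟨e.base, (-f) e.base⟩ : Total E)) (𝓝 e)
        (𝓝 ⟨e.base, (-f) e.base⟩) :=
      ((hc (-f) (Γ.neg_mem hf)).comp hE.continuous_base).continuousAt
    have h2 := hE.tendsto_add (r := fun e : Total E => ⟨e.base, (e.val, (-f) e.base)⟩)
      (a := e.val) (l := 𝓝 e) tendsto_id h1
    have h3 := (hE.continuous_norm.tendsto _).comp h2
    simpa [ContinuousAt, Function.comp_def, ← sub_eq_add_neg] using h3
  refine le_antisymm ?_ ?_
  · refine continuous_iff_le_induced.1 ?_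
    exact hE.continuous_base.prodMk (continuous_pi fun f => hdist f.1 f.2)
  · refine le_of_nhds_le_nhds fun e => ?_
    -- For the converse, points `e'` tending to `e` in `sectionTopology Γ` are compared with points
    -- `b` of the same fibres that tend to `e` in `τ`. The filter `H` collects these pairs `(b,
    -- e')`. Since `‖e' - b‖ → 0`, the axiom `tendsto_zero` gives `e' - b → 0` in `τ`, and `e' = b +
    -- (e' - b)`.
    set F := @nhds _ (sectionTopology Γ) e with hF
    have hFid : Tendsto id F (@nhds _ (sectionTopology Γ) e) := tendsto_id
    let p₁ : (Total fun g => E g × E g) → Total E := fun q => ⟨q.base, q.val.1⟩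
    let p₂ : (Total fun g => E g × E g) → Total E := fun q => ⟨q.base, q.val.2⟩
    set H := comap p₁ (𝓝 e) ⊓ comap p₂ F with hH
    have hp₁ : Tendsto p₁ H (𝓝 e) := tendsto_comap.mono_left inf_le_left
    have hp₂ : Tendsto p₂ H F := tendsto_comap.mono_left inf_le_right
    -- Openness of the base map provides partners `b` for all `e'` near `e`, so nothing of `F` is
    -- lost.
    have hle : F ≤ map p₂ H := by
      intro s hs
      obtain ⟨s₁, ⟨N, hN, hN'⟩, s₂, ⟨W, hW, hW'⟩, hsub⟩ := mem_inf_iff_superset.1 (mem_map.1 hs)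
      have hb : ∀ᶠ e' in F, e'.base ∈ Total.base '' N :=
        (tendsto_sectionTopology_iff.1 hFid).1 (hE.isOpenMap_base.image_mem_nhds hN)
      filter_upwards [hb, hW] with e' he' heW
      obtain ⟨⟨g, b⟩, hbN, hbase⟩ := he'
      obtain ⟨g', a⟩ := e'
      change g = g' at hbase
      subst hbase
      exact hsub (a := ⟨g, (b, a)⟩) ⟨hN' hbN, hW' heW⟩
    -- Both members of a pair are eventually close to a section that is close to `e`.
    have hnorm : Tendsto (fun q => ‖(p₂ q).val - (p₁ q).val‖) H (𝓝 0) := by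
      refine Metric.tendsto_nhds.2 fun ε hε => ?_
      obtain ⟨f, hf, hlt⟩ := hΓ.exists_norm_sub_lt e.val (half_pos hε)
      have h1 := (tendsto_order.1 (((hdist f hf).tendsto e).comp hp₁)).2 _ hlt
      have h2 := eventually_norm_sub_lt_of_tendsto hp₂ hf hlt
      filter_upwards [h1, h2] with q hq1 hq2
      simp only [Function.comp_apply] at hq1
      rw [Real.dist_eq, sub_zero, abs_norm]
      change ‖q.val.1 - f q.base‖ < ε / 2 at hq1
      change ‖q.val.2 - f q.base‖ < ε / 2 at hq2
      change ‖q.val.2 - q.val.1‖ < ε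
      calc ‖q.val.2 - q.val.1‖ = ‖(q.val.2 - f q.base) - (q.val.1 - f q.base)‖ := by
            congr 1; abel
        _ ≤ _ := norm_sub_le _ _
        _ < ε := by linarith
    have hzero : Tendsto (fun q : Total fun g => E g × E g =>
        (⟨q.base, q.val.2 - q.val.1⟩ : Total E)) H (𝓝 ⟨e.base, 0⟩) := by
      refine Tendsto.mono_right ?_ (hE.tendsto_zero e.base)
      refine tendsto_inf.2 ⟨tendsto_comap_iff.2 hnorm, tendsto_comap_iff.2 ?_⟩
      have hb : Tendsto (fun q => (p₁ q).base) H (𝓝 e.base) :=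
        (hE.continuous_base.tendsto e).comp hp₁
      exact hb
    have hsum := hE.tendsto_add (r := fun q : Total fun g => E g × E g =>
      ⟨q.base, (q.val.1, q.val.2 - q.val.1)⟩) (a := e.val) hp₁ hzero
    simp only [add_sub_cancel, add_zero] at hsum
    exact hle.trans hsum

end BanachBundles

namespace CorrSystem

variable {k : ℕ} {V : Type u} [Category.{v} V] [KGraph k V] {S : CorrSystem.{u, v, w₁, w₂} k V}

/-! ## Connecting maps -/

lemma preservesHinner_chi {a b c : V} (α : a ⟶ b) (β : b ⟶ c) :
    PreservesHinner (S.A b) (S.A c) (S.chi α β) := (S.chi_tensor α β).hinner_apply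

/-- The path `1 ≫ α` is replaced by a variable `γ` with `γ = α`, so that the heterogeneous equality
becomes an equality. The claim is then nondegeneracy. -/
lemma hasDenseSpan_of_heq_lact (hS : S.IsRegular) {a b : V} {α γ : a ⟶ b} (h : γ = α)
    (t : S.X (𝟙 a) →ₗ[ℂ] S.X α →ₗ[ℂ] S.X γ)
    (ht : ∀ (c : S.A a) (x : S.X α),
      HEq (t ((S.vertexIso a).symm c) x) (Correspondence.lact (S.A b) c x)) : HasDenseSpan t := by
  subst h
  refine Dense.mono ?_ (hS.nondegenerate γ)
  refine Submodule.span_mono ?_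
  rintro _ ⟨c, x, rfl⟩
  exact ⟨_, x, (eq_of_heq (ht c x)).symm⟩

/-- In a regular system, all the maps `χ` are isomorphisms. -/
lemma IsRegular.hasDenseSpan_chi (hS : S.IsRegular) {a b c : V} (α : a ⟶ b) (β : b ⟶ c) :
    HasDenseSpan (S.chi α β) := by
  -- `chi_iso` excludes vertices. A path of degree `0` is an identity, where nondegeneracy takes
  -- over.
  by_cases h : KGraph.deg (k := k) α = 0
  · have h' := Path.mk_eq_mk_id k h
    injection h' with h1 h2 h3
    subst h2
    have h3 := eq_of_heq h3
    subst h3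
    exact hasDenseSpan_of_heq_lact hS (Category.id_comp β) _ (S.chi_vertex_left β)
  · exact S.chi_iso α β h

lemma IsRegular.norm_lact_eq (hS : S.IsRegular) {a b : V} (α : a ⟶ b) (c : S.A a) :
    ‖(Correspondence.lact (S.A b) c : S.X α →L[ℂ] S.X α)‖ = ‖c‖ :=
  norm_lact (hS.compact α) (hS.injective α) c

lemma IsConnecting.unique (hS : S.IsRegular) {a b c d : V} {α : a ⟶ c} {β : b ⟶ c} {ν : c ⟶ d}
    {T : S.Kpt α β} {T₁ T₂ : S.Kpt (α ≫ ν) (β ≫ ν)} (h₁ : S.IsConnecting ν T T₁)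
    (h₂ : S.IsConnecting ν T T₂) : T₁ = T₂ :=
  Subtype.ext (IsTensorOne.unique (hS.hasDenseSpan_chi β ν) h₁ h₂)

/-- Contractivity holds for every adjointable operator; the reverse inequality uses that the left
action on `X_ν` is isometric. -/
lemma IsConnecting.norm_eq (hS : S.IsRegular) {a b c d : V} {α : a ⟶ c} {β : b ⟶ c} {ν : c ⟶ d}
    {T : S.Kpt α β} {T' : S.Kpt (α ≫ ν) (β ≫ ν)} (h : S.IsConnecting ν T T') : ‖T'‖ = ‖T‖ :=
  le_antisymm
    (IsTensorOne.norm_le (fun c => (hS.norm_lact_eq ν c).le) (hS.hasDenseSpan_chi β ν)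
      (preservesHinner_chi β ν) (preservesHinner_chi α ν) (Compacts.isAdjointPair_adj T) h)
    (IsTensorOne.norm_ge (hS.norm_lact_eq ν) (preservesHinner_chi β ν) (preservesHinner_chi α ν) h)

lemma IsConnecting.comp {a b c d e : V} {α : a ⟶ d} {β : b ⟶ d} {γ : c ⟶ d} {ν : d ⟶ e}
    {T : S.Kpt α β} {R : S.Kpt β γ} {T' : S.Kpt (α ≫ ν) (β ≫ ν)} {R' : S.Kpt (β ≫ ν) (γ ≫ ν)}
    (hT : S.IsConnecting ν T T') (hR : S.IsConnecting ν R R') :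
    S.IsConnecting ν (Compacts.comp T R) (Compacts.comp T' R') := fun x y => by
  rw [Compacts.comp_apply, Compacts.comp_apply, hR, hT]

lemma IsConnecting.adj (hS : S.IsRegular) {a b c d : V} {α : a ⟶ c} {β : b ⟶ c} {ν : c ⟶ d}
    {T : S.Kpt α β} {T' : S.Kpt (α ≫ ν) (β ≫ ν)} (h : S.IsConnecting ν T T') :
    S.IsConnecting ν (Compacts.adj T) (Compacts.adj T') :=
  IsTensorOne.isAdjointPair (hS.hasDenseSpan_chi β ν) (preservesHinner_chi β ν)
    (preservesHinner_chi α ν) (Compacts.isAdjointPair_adj T) h (Compacts.isAdjointPair_adj T')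

/-- Existence of `T ⊗ 1` as a bounded operator needs only an adjoint of `T`. Its compactness depends
on the compact left action on `X_ν`. -/
lemma exists_isConnecting (hS : S.IsRegular) {a b c d : V} {α : a ⟶ c} {β : b ⟶ c} (ν : c ⟶ d)
    (T : S.Kpt α β) : ∃ T' : S.Kpt (α ≫ ν) (β ≫ ν), S.IsConnecting ν T T' := by
  have hφ := fun c => (hS.norm_lact_eq ν c).le
  have hd := hS.hasDenseSpan_chi β ν
  obtain ⟨T', hT', -⟩ := exists_isTensorOne hφ hd
    (preservesHinner_chi β ν) (preservesHinner_chi α ν) (Compacts.isAdjointPair_adj T)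
  exact ⟨⟨T', hT'.mem_compacts hφ (hS.compact ν) hd (hS.hasDenseSpan_chi α ν)
    (preservesHinner_chi β ν) (preservesHinner_chi α ν) (S.chi_tensor α ν).balanced T.2⟩, hT'⟩

variable (S) in
lemma exists_connectingMap (hS : S.IsRegular) {a b c d : V} (α : a ⟶ c) (β : b ⟶ c) (ν : c ⟶ d) :
    ∃ L : S.Kpt α β →ₗᵢ[ℂ] S.Kpt (α ≫ ν) (β ≫ ν), ∀ T, S.IsConnecting ν T (L T) := by
  choose F hF using fun T => exists_isConnecting hS ν (α := α) (β := β) T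
  let L : S.Kpt α β →ₗ[ℂ] S.Kpt (α ≫ ν) (β ≫ ν) :=
    { toFun := F
      map_add' := fun T R => (hF (T + R)).unique hS fun x y => by
        have h1 := hF T x y
        have h2 := hF R x y
        simp only [Submodule.coe_add, add_apply, h1, h2, map_add,
          LinearMap.add_apply]
      map_smul' := fun t T => (hF (t • T)).unique hS fun x y => by
        have h1 := hF T x y
        simp only [Submodule.coe_smul, smul_apply, h1, map_smul,
          LinearMap.smul_apply, RingHom.id_apply] }
  exact ⟨⟨L, fun T => (hF T).norm_eq hS⟩, hF⟩

lemma heq_apply {a b c a' b' c' : V} {α : a ⟶ c} {β : b ⟶ c} {α' : a' ⟶ c'} {β' : b' ⟶ c'}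
    (hα : Path.mk α = Path.mk α') (hβ : Path.mk β = Path.mk β') {T : S.Kpt α β} {T' : S.Kpt α' β'}
    (hT : HEq T T') {x : S.X β} {x' : S.X β'} (hx : HEq x x') :
    HEq ((T : S.X β →L[ℂ] S.X α) x) ((T' : S.X β' →L[ℂ] S.X α') x') := by
  injection hα with h1 h2 h3
  subst h1 h2 h3
  injection hβ with h1 h2 h3
  subst h1 h3
  cases hT
  cases hx
  rfl

/-- Transitivity of the connecting maps. -/
lemma IsConnecting.of_comp (hS : S.IsRegular) {a b c d e : V} {α : a ⟶ c} {β : b ⟶ c} {ν : c ⟶ d}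
    {ν' : d ⟶ e} {T : S.Kpt α β} {T' : S.Kpt (α ≫ ν) (β ≫ ν)} (h : S.IsConnecting ν T T')
    {T₂ : S.Kpt (α ≫ ν ≫ ν') (β ≫ ν ≫ ν')} (h₂ : S.IsConnecting (ν ≫ ν') T T₂)
    {T₁ : S.Kpt ((α ≫ ν) ≫ ν') ((β ≫ ν) ≫ ν')} (h₁ : HEq T₁ T₂) : S.IsConnecting ν' T' T₁ := by
  intro x y
  have hφ := fun c => (hS.norm_lact_eq ν' c).le
  -- For fixed `y` both sides are continuous in `x`, so `x` may be taken of the form `χ(p ⊗ q)`.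
  have hcont : ∀ {f : V} (γ : f ⟶ d), ∃ L : S.X γ →L[ℂ] S.X (γ ≫ ν'),
      ∀ x, L x = S.chi γ ν' x y := fun γ =>
    ⟨((S.chi γ ν').flip y).mkContinuous ‖y‖ fun x => by
      rw [mul_comm]
      exact (preservesHinner_chi γ ν').norm_le hφ x y, fun x => rfl⟩
  obtain ⟨L, hL⟩ := hcont (α ≫ ν)
  obtain ⟨L', hL'⟩ := hcont (β ≫ ν)
  have key : (T₁ : S.X ((β ≫ ν) ≫ ν') →L[ℂ] S.X ((α ≫ ν) ≫ ν')).comp L' =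
      L.comp (T' : S.X (β ≫ ν) →L[ℂ] S.X (α ≫ ν)) := by
    refine (hS.hasDenseSpan_chi β ν).clm_ext fun p q => ?_
    rw [ContinuousLinearMap.comp_apply, ContinuousLinearMap.comp_apply, hL', hL, h]
    -- Associativity turns `(p ⊗ q) ⊗ y` into `p ⊗ (q ⊗ y)`, where `T₂` acts on `p` alone by `T`.
    have e1 := heq_apply (congrArg Path.mk (Category.assoc α ν ν'))
      (congrArg Path.mk (Category.assoc β ν ν')) h₁ (S.chi_assoc β ν ν' p q y)
    rw [h₂] at e1
    exact eq_of_heq (e1.trans (S.chi_assoc α ν ν' _ q y).symm)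
  have := congrArg (fun R => R x) key
  simpa [hL, hL'] using this

/-! ## The canonical maps into the inductive limit -/

variable (S) in
-- `D'` need not be syntactically an extension of `D`, so the map is specified through every
-- presentation of `D'` as an extension. By cancellation of paths all of these involve the same `ν`.
lemma exists_transitionMap (hS : S.IsRegular) {g : Elem (InfinitePath k V)} {D D' : Decomp g}
    (hle : D ≤ D') : ∃ L : S.Kpt D.α D.β →ₗᵢ[ℂ] S.Kpt D'.α D'.β,
      ∀ {d : V} (ν : D.c ⟶ d) (h : g ∈ cylinder (D.α ≫ ν) (D.β ≫ ν)) (T : S.Kpt D.α D.β)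
        (T' : S.Kpt (D.α ≫ ν) (D.β ≫ ν)), D' = D.extend ν h → HEq (L T) T' →
        S.IsConnecting ν T T' := by
  obtain ⟨d, ν, h, rfl⟩ := Decomp.exists_eq_extend hle
  obtain ⟨L, hL⟩ := S.exists_connectingMap hS D.α D.β ν
  refine ⟨L, fun {d'} ν' h' T T' e hT => ?_⟩
  have e' := Decomp.extend_injective e
  injection e' with _ h2 h3
  subst h2
  have h3 := eq_of_heq h3
  subst h3
  cases hT
  exact hL T

/-- Above `D` the entries of two representing families are both `T ⊗ 1`; their difference vanishes
eventually, hence is null. -/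
lemma IsLimitClass.unique (hS : S.IsRegular) {g : Elem (InfinitePath k V)} {D : Decomp g}
    {T : S.Kpt D.α D.β} {e e' : S.FamilyQuotient g} (h : S.IsLimitClass D T e)
    (h' : S.IsLimitClass D T e') : e = e' := by
  obtain ⟨f, hf, rfl⟩ := h
  obtain ⟨f', hf', rfl⟩ := h'
  rw [← sub_eq_zero, ← map_sub, Submodule.mkQ_apply, Submodule.Quotient.mk_eq_zero]
  change Tendsto (fun D => ‖(f - f') D‖) atTop (𝓝 0)
  refine tendsto_const_nhds.congr' ?_
  filter_upwards [eventually_ge_atTop D] with D' hD'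
  obtain ⟨d, ν, hν, rfl⟩ := Decomp.exists_eq_extend hD'
  have := (hf ν hν).unique hS (hf' ν hν)
  have e1 : (f - f') (D.extend ν hν) = f (D.extend ν hν) - f' (D.extend ν hν) := rfl
  rw [e1, this, sub_self, norm_zero]

open Classical in
/-- The family of images of `T ∈ K(X_β, X_α)` under the transition maps, extended by zero. -/
def transitionFamily (hS : S.IsRegular) {g : Elem (InfinitePath k V)} (D : Decomp g)
    (T : S.Kpt D.α D.β) (D' : Decomp g) : S.Kpt D'.α D'.β :=
  if h : D ≤ D' then (S.exists_transitionMap hS h).choose T else 0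

lemma norm_transitionFamily_le (hS : S.IsRegular) {g : Elem (InfinitePath k V)} (D : Decomp g)
    (T : S.Kpt D.α D.β) (D' : Decomp g) : ‖transitionFamily hS D T D'‖ ≤ ‖T‖ := by
  unfold transitionFamily
  split_ifs with h
  · exact ((S.exists_transitionMap hS h).choose.norm_map T).le
  · simp

lemma norm_transitionFamily (hS : S.IsRegular) {g : Elem (InfinitePath k V)} {D D' : Decomp g}
    (h : D ≤ D') (T : S.Kpt D.α D.β) : ‖transitionFamily hS D T D'‖ = ‖T‖ := by
  rw [transitionFamily, dif_pos h]
  exact (S.exists_transitionMap hS h).choose.norm_map T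

lemma isConnecting_transitionFamily (hS : S.IsRegular) {g : Elem (InfinitePath k V)}
    (D : Decomp g) (T : S.Kpt D.α D.β) {d : V} (ν : D.c ⟶ d)
    (h : g ∈ cylinder (D.α ≫ ν) (D.β ≫ ν)) :
    S.IsConnecting ν T (transitionFamily hS D T (D.extend ν h)) := by
  refine (S.exists_transitionMap hS (D.le_extend ν h)).choose_spec ν h T _ rfl ?_
  rw [transitionFamily, dif_pos (D.le_extend ν h)]

/-- `transitionFamily` as a linear map to the bounded families. -/
def transitionFamilyₗ (hS : S.IsRegular) {g : Elem (InfinitePath k V)} (D : Decomp g) :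
    S.Kpt D.α D.β →ₗ[ℂ] S.BoundedFamily g where
  toFun T := ⟨transitionFamily hS D T, memℓp_infty ⟨‖T‖, by
    rintro _ ⟨D', rfl⟩
    exact norm_transitionFamily_le hS D T D'⟩⟩
  map_add' T R := by
    ext1
    funext D'
    change transitionFamily hS D (T + R) D' = transitionFamily hS D T D' + transitionFamily hS D R D'
    unfold transitionFamily
    split_ifs
    · exact map_add _ T R
    · simp
  map_smul' t T := by
    ext1
    funext D'
    change transitionFamily hS D (t • T) D' = t • transitionFamily hS D T D'
    unfold transitionFamily
    split_ifs
    · exact map_smul _ t T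
    · simp

/-- Above `D` the family has constant norm `‖T‖`, so adding a null family cannot bring the supremum
norm below `‖T‖`. -/
lemma norm_mkQ_transitionFamily (hS : S.IsRegular) {g : Elem (InfinitePath k V)} (D : Decomp g)
    (T : S.Kpt D.α D.β) : ‖(S.nullFamilies g).mkQ (transitionFamilyₗ hS D T)‖ = ‖T‖ := by
  refine le_antisymm ?_ ?_
  · refine (Submodule.Quotient.norm_mk_le _ _).trans ?_
    exact lp.norm_le_of_forall_le (norm_nonneg T) (norm_transitionFamily_le hS D T)
  · refine le_of_forall_pos_le_add fun ε hε => ?_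
    obtain ⟨m, hm, hlt⟩ := Submodule.Quotient.norm_mk_lt
      ((S.nullFamilies g).mkQ (transitionFamilyₗ hS D T)) (half_pos hε)
    have hnull : m - transitionFamilyₗ hS D T ∈ S.nullFamilies g :=
      (Submodule.Quotient.eq _).1 hm
    have hlim : Tendsto (fun D' => ‖(m - transitionFamilyₗ hS D T) D'‖) atTop (𝓝 0) := hnull
    obtain ⟨D', h1, h2⟩ := (((tendsto_order.1 hlim).2 _ (half_pos hε)).and
      (eventually_ge_atTop D)).exists
    have h3 : transitionFamily hS D T D' = m D' - (m - transitionFamilyₗ hS D T) D' :=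
      (sub_sub_cancel (m D') (transitionFamily hS D T D')).symm
    have h4 : ‖m D'‖ ≤ ‖m‖ := lp.norm_apply_le_norm ENNReal.top_ne_zero m D'
    rw [← norm_transitionFamily hS h2 T, h3]
    refine (norm_sub_le _ _).trans ?_
    linarith

variable (S) in
/-- The canonical maps of a regular system. -/
def canonicalMap (hS : S.IsRegular) : S.EmbeddingFamily := fun g D =>
  { toFun := fun T => (⟨(S.nullFamilies g).mkQ (transitionFamilyₗ hS D T),
      Submodule.le_topologicalClosure _ (Submodule.subset_span ⟨D, T, transitionFamilyₗ hS D T,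
        fun ν h => isConnecting_transitionFamily hS D T ν h, rfl⟩)⟩ : S.fibreSubmodule g)
    map_add' := fun T R => Subtype.ext (by simp only [map_add]; rfl)
    map_smul' := fun t T => Subtype.ext (by simp only [map_smul]; rfl)
    norm_map' := norm_mkQ_transitionFamily hS D }

lemma isCanonicalEmbedding_canonicalMap (hS : S.IsRegular) :
    S.IsCanonicalEmbedding (S.canonicalMap hS) := fun _ D T =>
  ⟨transitionFamilyₗ hS D T, fun ν h => isConnecting_transitionFamily hS D T ν h, rfl⟩

lemma Fibre.toQuotient_injective {g : Elem (InfinitePath k V)} :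
    Function.Injective (Fibre.toQuotient S (g := g)) := Subtype.val_injective

lemma existsUnique_isCanonicalEmbedding (hS : S.IsRegular) :
    ∃! i : S.EmbeddingFamily, S.IsCanonicalEmbedding i := by
  refine ⟨S.canonicalMap hS, isCanonicalEmbedding_canonicalMap hS, fun i hi => ?_⟩
  funext g D
  ext T : 1
  exact Fibre.toQuotient_injective
    ((hi g D T).unique hS (isCanonicalEmbedding_canonicalMap hS g D T))

section Canonical

variable {i : S.EmbeddingFamily}

/-- Compatibility of the canonical maps with the connecting maps. -/
lemma IsCanonicalEmbedding.extend (hS : S.IsRegular) (hi : S.IsCanonicalEmbedding i)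
    {g : Elem (InfinitePath k V)} (D : Decomp g) {d : V} {ν : D.c ⟶ d}
    (h : g ∈ cylinder (D.α ≫ ν) (D.β ≫ ν)) {T : S.Kpt D.α D.β}
    {T' : S.Kpt (D.α ≫ ν) (D.β ≫ ν)} (hT : S.IsConnecting ν T T') :
    i g (D.extend ν h) T' = i g D T := by
  -- One family represents both classes: by transitivity its entries above the extension are also
  -- the images of `T'`.
  obtain ⟨f, hf, he⟩ := hi g D T
  refine Fibre.toQuotient_injective ((hi g (D.extend ν h) T').unique hS
    ⟨f, fun {d'} ν' h' => ?_, he⟩)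
  have h'' : g ∈ cylinder (D.α ≫ ν ≫ ν') (D.β ≫ ν ≫ ν') := by
    rw [← Category.assoc, ← Category.assoc]
    exact h'
  refine hT.of_comp hS (hf (ν ≫ ν') h'') ?_
  have : (⟨(D.α ≫ ν) ≫ ν', (D.β ≫ ν) ≫ ν', h'⟩ : Decomp g) = D.extend (ν ≫ ν') h'' := by
    unfold Decomp.extend
    congr 1 <;> exact Category.assoc _ _ _
  change HEq (f ⟨(D.α ≫ ν) ≫ ν', (D.β ≫ ν) ≫ ν', h'⟩) (f (D.extend (ν ≫ ν') h''))
  rw [this]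

lemma IsCanonicalEmbedding.exists_eq_of_le (hS : S.IsRegular) (hi : S.IsCanonicalEmbedding i)
    {g : Elem (InfinitePath k V)} {D D' : Decomp g} (h : D ≤ D') (T : S.Kpt D.α D.β) :
    ∃ T' : S.Kpt D'.α D'.β, i g D' T' = i g D T := by
  obtain ⟨d, ν, hν, rfl⟩ := Decomp.exists_eq_extend h
  obtain ⟨T', hT'⟩ := exists_isConnecting hS ν T
  exact ⟨T', hi.extend hS D hν hT'⟩

/-- Directedness makes the union of the images a linear subspace, so every element of the span is
already the image of a single operator. -/
lemma IsCanonicalEmbedding.dense (hS : S.IsRegular) (hi : S.IsCanonicalEmbedding i)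
    (g : Elem (InfinitePath k V)) :
    Dense {e : S.Fibre g | ∃ (D : Decomp g) (T : S.Kpt D.α D.β), i g D T = e} := by
  have hspan : ∀ e ∈ Submodule.span ℂ {e : S.FamilyQuotient g |
      ∃ (D : Decomp g) (T : S.Kpt D.α D.β), S.IsLimitClass D T e},
      ∃ (D : Decomp g) (T : S.Kpt D.α D.β), Fibre.toQuotient S (i g D T) = e := by
    intro e he
    induction he using Submodule.span_induction with
    | mem e h =>
      obtain ⟨D, T, h⟩ := h
      exact ⟨D, T, (hi g D T).unique hS h⟩
    | zero =>
      obtain ⟨D⟩ : Nonempty (Decomp g) := inferInstance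
      exact ⟨D, 0, by rw [map_zero]; rfl⟩
    | add e e' _ _ h h' =>
      obtain ⟨D, T, rfl⟩ := h
      obtain ⟨D', T', rfl⟩ := h'
      obtain ⟨D'', h1, h2⟩ := exists_ge_ge D D'
      obtain ⟨R, hR⟩ := hi.exists_eq_of_le hS h1 T
      obtain ⟨R', hR'⟩ := hi.exists_eq_of_le hS h2 T'
      exact ⟨D'', R + R', by rw [map_add, hR, hR']; rfl⟩
    | smul t e _ h =>
      obtain ⟨D, T, rfl⟩ := h
      exact ⟨D, t • T, by rw [map_smul]; rfl⟩
  intro e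
  rw [Metric.mem_closure_iff]
  intro ε hε
  obtain ⟨e', he', hlt⟩ := Metric.mem_closure_iff.1
    (show Fibre.toQuotient S e ∈ closure _ from Subtype.property (p := (· ∈ S.fibreSubmodule g)) e)
    ε hε
  obtain ⟨D, T, rfl⟩ := hspan e' he'
  exact ⟨i g D T, ⟨D, T, rfl⟩, hlt⟩

end Canonical

end CorrSystem

/-! ## Extension of maps from directed unions -/

section Extension

variable {ι : Type*} [Preorder ι] [IsDirectedOrder ι] [Nonempty ι]

/-- The union of a directed family of subspaces. -/
def unionSubmodule {K : ι → Type*} [∀ j, NormedAddCommGroup (K j)] [∀ j, NormedSpace ℂ (K j)]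
    {E : Type*} [NormedAddCommGroup E] [NormedSpace ℂ E] (u : ∀ j, K j →ₗᵢ[ℂ] E)
    (hu : ∀ {j l}, j ≤ l → ∀ s, ∃ t, u l t = u j s) : Submodule ℂ E where
  carrier := {e | ∃ j s, u j s = e}
  zero_mem' := by
    obtain ⟨j⟩ : Nonempty ι := inferInstance
    exact ⟨j, 0, map_zero _⟩
  add_mem' := by
    rintro _ _ ⟨j, s, rfl⟩ ⟨l, t, rfl⟩
    obtain ⟨p, h1, h2⟩ := exists_ge_ge j l
    obtain ⟨s', hs⟩ := hu h1 s
    obtain ⟨t', ht⟩ := hu h2 t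
    exact ⟨p, s' + t', by rw [map_add, hs, ht]⟩
  smul_mem' := by
    rintro c _ ⟨j, s, rfl⟩
    exact ⟨j, c • s, map_smul _ _ _⟩

variable {K K' : ι → Type*} [∀ j, NormedAddCommGroup (K j)] [∀ j, NormedSpace ℂ (K j)]
    [∀ j, NormedAddCommGroup (K' j)] [∀ j, NormedSpace ℂ (K' j)]
    {E E' F : Type*} [NormedAddCommGroup E] [NormedSpace ℂ E] [NormedAddCommGroup E']
    [NormedSpace ℂ E'] [NormedAddCommGroup F] [NormedSpace ℂ F] [CompleteSpace F]

/-- A compatible family of semilinear isometries extends to the closure of the directed union. -/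
lemma exists_extension {σ : ℂ →+* ℂ} [RingHomIsometric σ] {u : ∀ j, K j →ₗᵢ[ℂ] E}
    (hu : ∀ {j l}, j ≤ l → ∀ s, ∃ t, u l t = u j s) (hd : Dense {e | ∃ j s, u j s = e})
    (φ : ∀ j, K j → F) (hadd : ∀ j s t, φ j (s + t) = φ j s + φ j t)
    (hsmul : ∀ j (c : ℂ) s, φ j (c • s) = σ c • φ j s) (hnorm : ∀ j s, ‖φ j s‖ = ‖s‖)
    (hφ : ∀ {j l}, j ≤ l → ∀ s t, u l t = u j s → φ l t = φ j s) :
    ∃ Φ : E →ₛₗᵢ[σ] F, ∀ j s, Φ (u j s) = φ j s := by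
  -- Passing to a common upper bound removes the order assumption from compatibility, so the value
  -- does not depend on the chosen representative.
  have hφ' : ∀ {j l} s t, u l t = u j s → φ l t = φ j s := by
    intro j l s t h
    obtain ⟨p, h1, h2⟩ := exists_ge_ge j l
    obtain ⟨s', hs⟩ := hu h1 s
    rw [← hφ h1 s s' hs, hφ h2 t s' (hs.trans h.symm)]
  choose J r hr using fun e : unionSubmodule u hu => e.2
  have key : ∀ (e : unionSubmodule u hu) j s, u j s = e → φ (J e) (r e) = φ j s :=
    fun e j s h => hφ' s (r e) ((hr e).trans h.symm)
  let f : unionSubmodule u hu →ₛₗ[σ] F :=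
    { toFun := fun e => φ (J e) (r e)
      map_add' := fun e e' => by
        obtain ⟨p, h1, h2⟩ := exists_ge_ge (J e) (J e')
        obtain ⟨s, hs⟩ := hu h1 (r e)
        obtain ⟨t, ht⟩ := hu h2 (r e')
        rw [key e p s (hs.trans (hr e)), key e' p t (ht.trans (hr e')),
          key (e + e') p (s + t) (by rw [map_add, hs, ht, hr, hr]; rfl), hadd]
      map_smul' := fun c e => by
        rw [key (c • e) (J e) (c • r e) (by rw [map_smul, hr]; rfl), hsmul] }
  have hdense : DenseRange (unionSubmodule u hu).subtype := by
    refine Dense.mono ?_ hd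
    rintro _ ⟨j, s, rfl⟩
    exact ⟨⟨_, j, s, rfl⟩, rfl⟩
  have hfn : ∀ e, ‖f e‖ = ‖e‖ := fun e => by
    change ‖φ (J e) (r e)‖ = ‖(e : E)‖
    rw [hnorm, ← hr e, (u (J e)).norm_map]
  have hb : ∀ e, ‖f e‖ ≤ 1 * ‖(unionSubmodule u hu).subtype e‖ := fun e => by
    rw [hfn, one_mul]
    rfl
  have heq := LinearMap.extendOfNorm_eq hdense ⟨1, hb⟩
  refine ⟨⟨(f.extendOfNorm (unionSubmodule u hu).subtype).toLinearMap, fun e => ?_⟩,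
    fun j s => ?_⟩
  · refine hdense.induction_on (p := fun e =>
      ‖f.extendOfNorm (unionSubmodule u hu).subtype e‖ = ‖e‖) e
      (isClosed_eq (ContinuousLinearMap.continuous _).norm continuous_norm) fun e => ?_
    rw [heq, hfn]
    rfl
  · exact (heq ⟨_, j, s, rfl⟩).trans (key _ j s rfl)

/-- A compatible family of contractive bilinear maps extends to the closures of the directed
unions. -/
lemma exists_bilinear_extension {u : ∀ j, K j →ₗᵢ[ℂ] E} {u' : ∀ j, K' j →ₗᵢ[ℂ] E'}
    (hu : ∀ {j l}, j ≤ l → ∀ s, ∃ t, u l t = u j s) (hd : Dense {e | ∃ j s, u j s = e})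
    (hu' : ∀ {j l}, j ≤ l → ∀ s, ∃ t, u' l t = u' j s) (hd' : Dense {e | ∃ j s, u' j s = e})
    (φ : ∀ j, K j → K' j → F) (hadd : ∀ j s s' t, φ j (s + s') t = φ j s t + φ j s' t)
    (hadd' : ∀ j s t t', φ j s (t + t') = φ j s t + φ j s t')
    (hsmul : ∀ j (c : ℂ) s t, φ j (c • s) t = c • φ j s t)
    (hsmul' : ∀ j (c : ℂ) s t, φ j s (c • t) = c • φ j s t)
    (hnorm : ∀ j s t, ‖φ j s t‖ ≤ ‖s‖ * ‖t‖)
    (hφ : ∀ {j l}, j ≤ l → ∀ s s' t t', u l s' = u j s → u' l t' = u' j t → φ l s' t' = φ j s t) :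
    ∃ Φ : E →L[ℂ] E' →L[ℂ] F, ∀ j s t, Φ (u j s) (u' j t) = φ j s t := by
  have hφ' : ∀ {j l} s s' t t', u l s' = u j s → u' l t' = u' j t → φ l s' t' = φ j s t := by
    intro j l s s' t t' h h'
    obtain ⟨p, h1, h2⟩ := exists_ge_ge j l
    obtain ⟨s'', hs⟩ := hu h1 s
    obtain ⟨t'', ht⟩ := hu' h1 t
    rw [← hφ h1 s s'' t t'' hs ht, hφ h2 s' s'' t' t'' (hs.trans h.symm) (ht.trans h'.symm)]
  -- The prescribed lower bound `j` lets the indices for two pairs be chosen in increasing order, as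
  -- additivity requires.
  have hcommon : ∀ (e : unionSubmodule u hu) (e' : unionSubmodule u' hu') (j : ι), ∃ p, j ≤ p ∧
      ∃ s t, u p s = e ∧ u' p t = e' := by
    rintro ⟨_, l, s, rfl⟩ ⟨_, m, t, rfl⟩ j
    obtain ⟨p, h1, h2⟩ := exists_ge_ge l m
    obtain ⟨q, h3, h4⟩ := exists_ge_ge p j
    obtain ⟨s', hs⟩ := hu (h1.trans h3) s
    obtain ⟨t', ht⟩ := hu' (h2.trans h3) t
    exact ⟨q, h4, s', t', hs, ht⟩
  choose J r r' hr hr' using fun (e : unionSubmodule u hu) (e' : unionSubmodule u' hu') =>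
    let ⟨p, _, s, t, h, h'⟩ := hcommon e e' (Classical.arbitrary ι)
    (⟨p, s, t, h, h'⟩ : ∃ p s t, u p s = e ∧ u' p t = e')
  have key : ∀ (e : unionSubmodule u hu) (e' : unionSubmodule u' hu') j s t, u j s = e →
      u' j t = e' → φ (J e e') (r e e') (r' e e') = φ j s t := fun e e' j s t h h' =>
    hφ' s _ t _ ((hr e e').trans h.symm) ((hr' e e').trans h'.symm)
  let B₀ : unionSubmodule u hu →ₗ[ℂ] unionSubmodule u' hu' →ₗ[ℂ] F :=
    LinearMap.mk₂ ℂ (fun e e' => φ (J e e') (r e e') (r' e e'))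
      (fun e₁ e₂ e' => by
        obtain ⟨p, -, s₁, t, h1, h2⟩ := hcommon e₁ e' (Classical.arbitrary ι)
        obtain ⟨q, hpq, s₂, t₂, h3, h4⟩ := hcommon e₂ e' p
        obtain ⟨s₁', h5⟩ := hu hpq s₁
        rw [key e₁ e' q s₁' t₂ (h5.trans h1) h4, key e₂ e' q s₂ t₂ h3 h4,
          key (e₁ + e₂) e' q (s₁' + s₂) t₂ (by rw [map_add, h5, h1, h3]; rfl) h4, hadd])
      (fun c e e' => by
        rw [key (c • e) e' (J e e') (c • r e e') (r' e e') (by rw [map_smul, hr]; rfl) (hr' e e'),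
          hsmul])
      (fun e e₁ e₂ => by
        obtain ⟨p, -, s, t₁, h1, h2⟩ := hcommon e e₁ (Classical.arbitrary ι)
        obtain ⟨q, hpq, s₂, t₂, h3, h4⟩ := hcommon e e₂ p
        obtain ⟨t₁', h5⟩ := hu' hpq t₁
        rw [key e e₁ q s₂ t₁' h3 (h5.trans h2), key e e₂ q s₂ t₂ h3 h4,
          key e (e₁ + e₂) q s₂ (t₁' + t₂) h3 (by rw [map_add, h5, h2, h4]; rfl), hadd'])
      (fun c e e' => by
        rw [key e (c • e') (J e e') (r e e') (c • r' e e') (hr e e') (by rw [map_smul, hr']; rfl),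
          hsmul'])
  have hB₀ : ∀ e e', ‖B₀ e e'‖ ≤ 1 * ‖e‖ * ‖e'‖ := by
    intro e e'
    rw [one_mul]
    refine (hnorm (J e e') (r e e') (r' e e')).trans_eq ?_
    rw [← (u _).norm_map, ← (u' _).norm_map, hr, hr']
    rfl
  let B : unionSubmodule u hu →L[ℂ] unionSubmodule u' hu' →L[ℂ] F := B₀.mkContinuous₂ 1 hB₀
  have hdense : DenseRange (unionSubmodule u hu).subtypeL := by
    refine Dense.mono ?_ hd
    rintro _ ⟨j, s, rfl⟩
    exact ⟨⟨_, j, s, rfl⟩, rfl⟩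
  have hdense' : DenseRange (unionSubmodule u' hu').subtypeL := by
    refine Dense.mono ?_ hd'
    rintro _ ⟨j, s, rfl⟩
    exact ⟨⟨_, j, s, rfl⟩, rfl⟩
  have hi : IsUniformInducing (unionSubmodule u hu).subtypeL :=
    isUniformEmbedding_subtype_val.isUniformInducing
  have hi' : IsUniformInducing (unionSubmodule u' hu').subtypeL :=
    isUniformEmbedding_subtype_val.isUniformInducing
  -- Extend in the first variable, flip, and extend in the second.
  let B₁ : E →L[ℂ] unionSubmodule u' hu' →L[ℂ] F := B.extend (unionSubmodule u hu).subtypeL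
  have hB₁ : ∀ e, B₁ ((unionSubmodule u hu).subtypeL e) = B e :=
    ContinuousLinearMap.extend_eq B hdense hi
  let B₂ : E' →L[ℂ] E →L[ℂ] F := B₁.flip.extend (unionSubmodule u' hu').subtypeL
  have hB₂ : ∀ e', B₂ ((unionSubmodule u' hu').subtypeL e') = B₁.flip e' :=
    ContinuousLinearMap.extend_eq B₁.flip hdense' hi'
  refine ⟨B₂.flip, fun j s t => ?_⟩
  have h1 := congrArg (fun L => L (u j s)) (hB₂ ⟨_, j, t, rfl⟩)
  have h2 := congrArg (fun L => L ⟨_, j, t, rfl⟩) (hB₁ ⟨_, j, s, rfl⟩)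
  exact h1.trans (h2.trans (key ⟨_, j, s, rfl⟩ ⟨_, j, t, rfl⟩ j s t rfl rfl))

end Extension

/-! ## Composable decompositions -/

section Composable

variable {k : ℕ} {V : Type u} [Category.{v} V] [KGraph k V]

/-- Decompositions `(α, β)` of `g` and `(β, γ)` of `h`. -/
structure ComposableDecomp {x y z : InfinitePath k V} (g : x ⟶ y) (h : y ⟶ z) where
  {a b c d : V}
  α : a ⟶ d
  β : b ⟶ d
  γ : c ⟶ d
  memg : Elem.mk g ∈ cylinder α β
  memh : Elem.mk h ∈ cylinder β γ

variable {x y z : InfinitePath k V} {g : x ⟶ y} {h : y ⟶ z}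

namespace ComposableDecomp

/-- The degree of `α` suffices, since `g` and `h` fix the differences to the other two degrees. -/
instance : Preorder (ComposableDecomp g h) :=
  Preorder.lift fun Q => KGraph.deg (k := k) Q.α

/-- The decomposition of `g`. -/
@[reducible] def fst (Q : ComposableDecomp g h) : Decomp (Elem.mk g) := ⟨Q.α, Q.β, Q.memg⟩

/-- The decomposition of `h`. -/
@[reducible] def snd (Q : ComposableDecomp g h) : Decomp (Elem.mk h) := ⟨Q.β, Q.γ, Q.memh⟩

/-- The decomposition of `gh`. -/
@[reducible] def prod (Q : ComposableDecomp g h) : Decomp (Elem.mk (g ≫ h)) :=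
  ⟨Q.α, Q.γ, mem_cylinder_comp Q.memg Q.memh⟩

instance : Nonempty (ComposableDecomp g h) := by
  obtain ⟨D⟩ : Nonempty (Decomp (Elem.mk g)) := inferInstance
  obtain ⟨D'⟩ : Nonempty (Decomp (Elem.mk h)) := inferInstance
  obtain ⟨a, b, c, d, α, β, γ, hg, hh, -⟩ := D.exists_composable D'
  exact ⟨⟨α, β, γ, hg, hh⟩⟩

instance : IsDirectedOrder (ComposableDecomp g h) :=
  ⟨fun Q Q' => by
    obtain ⟨D, h1, h2⟩ := exists_ge_ge Q.fst Q'.fst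
    obtain ⟨a, b, c, d, α, β, γ, hg, hh, h3, -⟩ := D.exists_composable Q.snd
    exact ⟨⟨α, β, γ, hg, hh⟩, h1.trans h3, h2.trans h3⟩⟩

/-- The decompositions of `g` and of `h` are extended by some `ν` and `ν'`. Both are what remains of
the middle path of `Q'` after that of `Q`, so they agree. -/
lemma exists_eq_extend {Q Q' : ComposableDecomp g h} (hle : Q ≤ Q') :
    ∃ (e : V) (ν : Q.d ⟶ e) (hg : Elem.mk g ∈ cylinder (Q.α ≫ ν) (Q.β ≫ ν))
      (hh : Elem.mk h ∈ cylinder (Q.β ≫ ν) (Q.γ ≫ ν)),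
      Q' = ⟨Q.α ≫ ν, Q.β ≫ ν, Q.γ ≫ ν, hg, hh⟩ := by
  obtain ⟨e, ν, hg, h1⟩ := Decomp.exists_eq_extend (D := Q.fst) (D' := Q'.fst) hle
  have e1 : Path.mk (Q.α ≫ ν) = Path.mk Q'.α :=
    (congrArg (fun D : Decomp (Elem.mk g) => Path.mk D.α) h1).symm
  have e2 : Path.mk (Q.β ≫ ν) = Path.mk Q'.β :=
    (congrArg (fun D : Decomp (Elem.mk g) => Path.mk D.β) h1).symm
  have hle' : Q.snd ≤ Q'.snd := by
    change KGraph.deg (k := k) Q.β ≤ KGraph.deg (k := k) Q'.β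
    rw [← deg_congr (k := k) e2, KGraph.deg_comp]
    exact le_add_of_nonneg_right zero_le
  obtain ⟨e', ν', hh, h2⟩ := Decomp.exists_eq_extend hle'
  have e3 : Path.mk (Q.β ≫ ν') = Path.mk Q'.β :=
    (congrArg (fun D : Decomp (Elem.mk h) => Path.mk D.α) h2).symm
  have e4 : Path.mk (Q.γ ≫ ν') = Path.mk Q'.γ :=
    (congrArg (fun D : Decomp (Elem.mk h) => Path.mk D.β) h2).symm
  have e5 := (Path.factor_unique k (e2.trans e3.symm) rfl).2
  injection e5 with _ e6 e7
  subst e6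
  have e7 := eq_of_heq e7
  subst e7
  refine ⟨e, ν, hg, hh, ?_⟩
  clear h1 h2 hle hle' e3
  obtain ⟨α', β', γ', hg', hh'⟩ := Q'
  injection e1 with e1 e1' e1''
  subst e1 e1'
  have e1'' := eq_of_heq e1''
  subst e1''
  injection e2 with e2 _ e2'
  subst e2
  have e2' := eq_of_heq e2'
  subst e2'
  injection e4 with e4 _ e4'
  subst e4
  have e4' := eq_of_heq e4'
  subst e4'
  rfl

lemma exists_ge_snd (Q : ComposableDecomp g h) (D : Decomp (Elem.mk h)) :
    ∃ Q' : ComposableDecomp g h, Q ≤ Q' ∧ D ≤ Q'.snd := by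
  obtain ⟨a, b, c, d, α, β, γ, hg, hh, h1, h2⟩ := Q.fst.exists_composable D
  exact ⟨⟨α, β, γ, hg, hh⟩, h1, h2⟩

lemma fst_mono {Q Q' : ComposableDecomp g h} (hle : Q ≤ Q') : Q.fst ≤ Q'.fst := hle

lemma snd_mono {Q Q' : ComposableDecomp g h} (hle : Q ≤ Q') : Q.snd ≤ Q'.snd := by
  obtain ⟨e, ν, hg, hh, rfl⟩ := exists_eq_extend hle
  exact Q.snd.le_extend ν hh

end ComposableDecomp

end Composable

namespace CorrSystem

variable {k : ℕ} {V : Type u} [Category.{v} V] [KGraph k V] {S : CorrSystem.{u, v, w₁, w₂} k V}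
  {i : S.EmbeddingFamily}

/-! ## The multiplication and the involution -/

lemma IsCanonicalEmbedding.dense_fst (hS : S.IsRegular) (hi : S.IsCanonicalEmbedding i)
    {x y z : InfinitePath k V} (g : x ⟶ y) (h : y ⟶ z) :
    Dense {e | ∃ (Q : ComposableDecomp g h) (T : S.Kpt Q.α Q.β), i ⟨g⟩ Q.fst T = e} := by
  refine Dense.mono ?_ (hi.dense hS ⟨g⟩)
  rintro _ ⟨D, T, rfl⟩
  obtain ⟨D'⟩ : Nonempty (Decomp (Elem.mk h)) := inferInstance
  obtain ⟨a, b, c, d, α, β, γ, hg, hh, h1, -⟩ := D.exists_composable D'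
  obtain ⟨T', hT'⟩ := hi.exists_eq_of_le hS h1 T
  exact ⟨⟨α, β, γ, hg, hh⟩, T', hT'⟩

lemma IsCanonicalEmbedding.dense_snd (hS : S.IsRegular) (hi : S.IsCanonicalEmbedding i)
    {x y z : InfinitePath k V} (g : x ⟶ y) (h : y ⟶ z) :
    Dense {e | ∃ (Q : ComposableDecomp g h) (T : S.Kpt Q.β Q.γ), i ⟨h⟩ Q.snd T = e} := by
  refine Dense.mono ?_ (hi.dense hS ⟨h⟩)
  rintro _ ⟨D, T, rfl⟩
  obtain ⟨Q⟩ : Nonempty (ComposableDecomp g h) := inferInstance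
  obtain ⟨Q', -, h1⟩ := Q.exists_ge_snd D
  obtain ⟨T', hT'⟩ := hi.exists_eq_of_le hS h1 T
  exact ⟨Q', T', hT'⟩

/-- Composition is contractive and `(T ⊗ 1)(T' ⊗ 1) = T T' ⊗ 1`, so the products are compatible
along composable decompositions. -/
lemma exists_mul (hS : S.IsRegular) (hi : S.IsCanonicalEmbedding i)
    {x y z : InfinitePath k V} (g : x ⟶ y) (h : y ⟶ z) :
    ∃ Φ : S.Fibre ⟨g⟩ →L[ℂ] S.Fibre ⟨h⟩ →L[ℂ] S.Fibre ⟨g ≫ h⟩,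
      ∀ (Q : ComposableDecomp g h) (T : S.Kpt Q.α Q.β) (T' : S.Kpt Q.β Q.γ),
        Φ (i ⟨g⟩ Q.fst T) (i ⟨h⟩ Q.snd T') = i ⟨g ≫ h⟩ Q.prod (Compacts.comp T T') := by
  refine exists_bilinear_extension (ι := ComposableDecomp g h)
    (K := fun Q => S.Kpt Q.α Q.β) (K' := fun Q => S.Kpt Q.β Q.γ)
    (u := fun Q => i ⟨g⟩ Q.fst) (u' := fun Q => i ⟨h⟩ Q.snd)
    (fun hle T => hi.exists_eq_of_le hS (ComposableDecomp.fst_mono hle) T) (hi.dense_fst hS g h)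
    (fun hle T => hi.exists_eq_of_le hS (ComposableDecomp.snd_mono hle) T) (hi.dense_snd hS g h)
    (fun Q T T' => i ⟨g ≫ h⟩ Q.prod (Compacts.comp T T')) ?_ ?_ ?_ ?_ ?_ ?_
  · intro Q T R T'
    rw [← map_add]
    exact congrArg _ (Subtype.ext (ContinuousLinearMap.add_comp _ _ _))
  · intro Q T T' R'
    rw [← map_add]
    exact congrArg _ (Subtype.ext (ContinuousLinearMap.comp_add _ _ _))
  · intro Q c T T'
    rw [← map_smul]
    exact congrArg _ (Subtype.ext (ContinuousLinearMap.smul_comp _ _ _))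
  · intro Q c T T'
    rw [← map_smul]
    exact congrArg _ (Subtype.ext (ContinuousLinearMap.comp_smul _ _ _))
  · intro Q T T'
    rw [(i _ _).norm_map]
    exact Compacts.norm_comp_le T T'
  · intro Q Q' hle T R T' R' h1 h2
    obtain ⟨e, ν, hg, hh, rfl⟩ := ComposableDecomp.exists_eq_extend hle
    obtain ⟨T₁, hT₁⟩ := exists_isConnecting hS ν T
    obtain ⟨T₂, hT₂⟩ := exists_isConnecting hS ν T'
    have e1 : R = T₁ := (i _ _).injective (h1.trans (hi.extend hS Q.fst hg hT₁).symm)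
    have e2 : R' = T₂ := (i _ _).injective (h2.trans (hi.extend hS Q.snd hh hT₂).symm)
    subst e1 e2
    exact hi.extend hS Q.prod (mem_cylinder_comp hg hh) (hT₁.comp hT₂)

lemma IsCanonicalEmbedding.induction_on (hS : S.IsRegular) (hi : S.IsCanonicalEmbedding i)
    {g : Elem (InfinitePath k V)} {p : S.Fibre g → Prop} (hcl : IsClosed {e | p e})
    (h : ∀ (D : Decomp g) (T : S.Kpt D.α D.β), p (i g D T)) (e : S.Fibre g) : p e := by
  refine closure_minimal ?_ hcl (hi.dense hS g e)
  rintro _ ⟨D, T, rfl⟩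
  exact h D T

/-- The principle behind the algebraic axioms: a closed condition may be tested on operators whose
decompositions share the middle path. -/
lemma IsCanonicalEmbedding.induction_on₂ (hS : S.IsRegular) (hi : S.IsCanonicalEmbedding i)
    {x y z : InfinitePath k V} {g : x ⟶ y} {h : y ⟶ z} {p : S.Fibre ⟨g⟩ → S.Fibre ⟨h⟩ → Prop}
    (hcl : IsClosed {q : S.Fibre ⟨g⟩ × S.Fibre ⟨h⟩ | p q.1 q.2})
    (H : ∀ {a b c d : V} (α : a ⟶ d) (β : b ⟶ d) (γ : c ⟶ d) (hg : Elem.mk g ∈ cylinder α β)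
      (hh : Elem.mk h ∈ cylinder β γ) (T : S.Kpt α β) (T' : S.Kpt β γ),
      p (i ⟨g⟩ ⟨α, β, hg⟩ T) (i ⟨h⟩ ⟨β, γ, hh⟩ T')) (e : S.Fibre ⟨g⟩) (e' : S.Fibre ⟨h⟩) :
    p e e' := by
  refine closure_minimal ?_ hcl ((hi.dense hS ⟨g⟩).prod (hi.dense hS ⟨h⟩) (e, e'))
  rintro ⟨_, _⟩ ⟨⟨D, T, rfl⟩, ⟨D', T', rfl⟩⟩
  obtain ⟨a, b, c, d, α, β, γ, hg, hh, h1, h2⟩ := D.exists_composable D'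
  obtain ⟨R, hR⟩ := hi.exists_eq_of_le hS h1 T
  obtain ⟨R₁, hR₁⟩ := hi.exists_eq_of_le hS h2 T'
  change p (i ⟨g⟩ D T) (i ⟨h⟩ D' T')
  rw [← hR, ← hR₁]
  exact H α β γ hg hh R R₁

/-- Existence and uniqueness of the multiplication. -/
lemma existsUnique_isMultiplication (hS : S.IsRegular) (hi : S.IsCanonicalEmbedding i) :
    ∃! mul : S.MulFamily, S.IsMultiplication i mul := by
  choose mul hmul using fun (x y z : InfinitePath k V) (g : x ⟶ y) (h : y ⟶ z) =>
    exists_mul hS hi g h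
  have hmul₀ : S.IsMultiplication i mul := fun {x y z} g h {a b c d} α β γ hg hh T T' =>
    hmul x y z g h ⟨α, β, γ, hg, hh⟩ T T'
  refine ⟨mul, hmul₀, fun mul' hmul' => ?_⟩
  funext x y z g h
  ext e e' : 2
  refine hi.induction_on₂ hS (p := fun e e' => mul' g h e e' = mul x y z g h e e')
    (isClosed_eq ?_ ?_) (fun α β γ hg hh T T' => ?_) e e'
  · exact (mul' g h).continuous₂
  · exact (mul x y z g h).continuous₂
  · rw [hmul', hmul₀]

/-- The adjoint of `T ⊗ 1` is `T⋆ ⊗ 1`, and adjoints preserve norms. -/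
lemma exists_adj (hS : S.IsRegular) (hi : S.IsCanonicalEmbedding i)
    {x y : InfinitePath k V} (g : x ⟶ y) :
    ∃ Φ : S.Fibre ⟨g⟩ →ₗᵢ⋆[ℂ] S.Fibre ⟨Groupoid.inv g⟩,
      ∀ (D : Decomp (Elem.mk g)) (T : S.Kpt D.α D.β),
        Φ (i ⟨g⟩ D T) = i ⟨Groupoid.inv g⟩ ⟨D.β, D.α, mem_cylinder_inv D.mem⟩ (Compacts.adj T) := by
  refine exists_extension (ι := Decomp (Elem.mk g)) (σ := starRingEnd ℂ)
    (K := fun D => S.Kpt D.α D.β) (u := fun D => i ⟨g⟩ D)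
    (fun hle T => hi.exists_eq_of_le hS hle T) (hi.dense hS ⟨g⟩)
    (fun D T => i ⟨Groupoid.inv g⟩ ⟨D.β, D.α, mem_cylinder_inv D.mem⟩ (Compacts.adj T))
    ?_ ?_ ?_ ?_
  · intro D T R
    rw [← map_add, Compacts.adj_add]
  · intro D c T
    rw [Compacts.adj_smul, map_smul]
    rfl
  · intro D T
    rw [(i _ _).norm_map]
    exact Compacts.norm_adj T
  · intro D D' hle T R h
    obtain ⟨e, ν, hg, rfl⟩ := Decomp.exists_eq_extend hle
    obtain ⟨T₁, hT₁⟩ := exists_isConnecting hS ν T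
    have e1 : R = T₁ := (i _ _).injective (h.trans (hi.extend hS D hg hT₁).symm)
    subst e1
    exact hi.extend hS ⟨D.β, D.α, mem_cylinder_inv D.mem⟩ (mem_cylinder_inv hg) (hT₁.adj hS)

/-- Existence and uniqueness of the involution. -/
lemma existsUnique_isInvolution (hS : S.IsRegular) (hi : S.IsCanonicalEmbedding i) :
    ∃! adj : S.AdjFamily, S.IsInvolution i adj := by
  choose adj hadj using fun (x y : InfinitePath k V) (g : x ⟶ y) => exists_adj hS hi g
  have hadj₀ : S.IsInvolution i adj := fun {x y} g {a b d} α β hg T T' h => by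
    rw [Compacts.eq_adj h]
    exact hadj x y g ⟨α, β, hg⟩ T
  refine ⟨adj, hadj₀, fun adj' hadj' => ?_⟩
  funext x y g
  ext e : 1
  refine hi.induction_on hS (p := fun e => adj' g e = adj x y g e)
    (isClosed_eq (adj' g).continuous (adj x y g).continuous) (fun D T => ?_) e
  rw [hadj' g D.α D.β D.mem T _ (Compacts.isAdjointPair_adj T),
    hadj₀ g D.α D.β D.mem T _ (Compacts.isAdjointPair_adj T)]

/-! ## The bundle topology -/

/-- The point is uniformity: the operator `T ⊗ 1` depends only on the paths, so one `T'` serves for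
all `g'` in the smaller cylinder. -/
lemma IsCanonicalEmbedding.exists_forall_eq_of_le (hS : S.IsRegular)
    (hi : S.IsCanonicalEmbedding i) {g : Elem (InfinitePath k V)} {D D' : Decomp g} (hle : D ≤ D')
    (T : S.Kpt D.α D.β) : ∃ T' : S.Kpt D'.α D'.β, ∀ (g' : Elem (InfinitePath k V))
      (h : g' ∈ cylinder D.α D.β) (h' : g' ∈ cylinder D'.α D'.β),
      i g' ⟨D'.α, D'.β, h'⟩ T' = i g' ⟨D.α, D.β, h⟩ T := by
  obtain ⟨d, ν, hν, rfl⟩ := Decomp.exists_eq_extend hle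
  obtain ⟨T', hT'⟩ := exists_isConnecting hS ν T
  exact ⟨T', fun g' h h' => hi.extend hS ⟨D.α, D.β, h⟩ h' hT'⟩

lemma basicSection_apply (i : S.EmbeddingFamily) {a b d : V} {α : a ⟶ d} {β : b ⟶ d}
    (T : S.Kpt α β) {g : Elem (InfinitePath k V)} (h : g ∈ cylinder α β) :
    S.basicSection i α β T g = i g ⟨α, β, h⟩ T := dif_pos h

lemma basicSection_mem (i : S.EmbeddingFamily) {a b d : V} (α : a ⟶ d) (β : b ⟶ d)
    (T : S.Kpt α β) : S.basicSection i α β T ∈ S.sections i :=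
  Submodule.subset_span ⟨a, b, d, α, β, T, rfl⟩

/-- Locally, every member of `sections` is a section `f_T^{α, β}`. -/
lemma IsCanonicalEmbedding.exists_eventually_eq (hS : S.IsRegular) (hi : S.IsCanonicalEmbedding i)
    {f : ∀ g, S.Fibre g} (hf : f ∈ S.sections i) (g : Elem (InfinitePath k V)) :
    ∃ (D : Decomp g) (T : S.Kpt D.α D.β), ∀ᶠ g' in 𝓝 g,
      ∀ h : g' ∈ cylinder D.α D.β, f g' = i g' ⟨D.α, D.β, h⟩ T := by
  induction hf using Submodule.span_induction with
  | mem f hf =>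
    obtain ⟨a, b, d, α, β, T, rfl⟩ := hf
    by_cases hg : g ∈ cylinder α β
    · exact ⟨⟨α, β, hg⟩, T, Eventually.of_forall fun g' h => basicSection_apply i T h⟩
    · obtain ⟨D⟩ : Nonempty (Decomp g) := inferInstance
      refine ⟨D, 0, ?_⟩
      -- Cylinders are closed, so off `Z(α, β)` the section vanishes in a whole neighbourhood.
      filter_upwards [(isClosed_cylinder hS.rowFinite α β).isOpen_compl.mem_nhds hg] with g' hg' h
      rw [map_zero]
      exact dif_neg hg'
  | zero =>
    obtain ⟨D⟩ : Nonempty (Decomp g) := inferInstance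
    exact ⟨D, 0, Eventually.of_forall fun g' h => (map_zero _).symm⟩
  | add f f' _ _ h h' =>
    obtain ⟨D, T, h⟩ := h
    obtain ⟨D', T', h'⟩ := h'
    obtain ⟨D'', h1, h2⟩ := exists_ge_ge D D'
    obtain ⟨R, hR⟩ := hi.exists_forall_eq_of_le hS h1 T
    obtain ⟨R', hR'⟩ := hi.exists_forall_eq_of_le hS h2 T'
    refine ⟨D'', R + R', ?_⟩
    filter_upwards [h, h'] with g' hg hg' hmem
    rw [map_add, hR g' (Decomp.cylinder_subset h1 hmem) hmem,
      hR' g' (Decomp.cylinder_subset h2 hmem) hmem, Pi.add_apply, hg, hg']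
  | smul t f _ h =>
    obtain ⟨D, T, h⟩ := h
    refine ⟨D, t • T, ?_⟩
    filter_upwards [h] with g' hg hmem
    rw [map_smul, Pi.smul_apply, hg hmem]

/-- Locally a section is the image of one fixed operator under isometries, so its norm is locally
constant. -/
lemma IsCanonicalEmbedding.isGeneratingSections (hS : S.IsRegular)
    (hi : S.IsCanonicalEmbedding i) : IsGeneratingSections (S.sections i) where
  continuous_norm f hf := by
    refine continuous_iff_continuousAt.2 fun g => ?_
    obtain ⟨D, T, h⟩ := hi.exists_eventually_eq hS hf g
    have : ∀ᶠ g' in 𝓝 g, ‖f g'‖ = ‖T‖ := by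
      filter_upwards [h, cylinder_mem_nhds D.mem] with g' h1 h2
      rw [h1 h2, (i _ _).norm_map]
    rw [ContinuousAt, this.self_of_nhds]
    exact tendsto_const_nhds.congr' (this.mono fun _ h => h.symm)
  dense g := by
    refine Dense.mono ?_ (hi.dense hS g)
    rintro _ ⟨D, T, rfl⟩
    exact ⟨_, basicSection_mem i D.α D.β T, basicSection_apply i T D.mem⟩

/-- Existence and uniqueness of the bundle topology. -/
lemma existsUnique_isBundleTopology (hS : S.IsRegular) (hi : S.IsCanonicalEmbedding i) :
    ∃! τ : TopologicalSpace (Total S.Fibre), S.IsBundleTopology i τ := by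
  have hΓ := hi.isGeneratingSections hS
  refine ⟨sectionTopology (S.sections i), ⟨hΓ.isBanachBundle, fun f hf => ?_⟩,
    fun τ hτ => hΓ.eq_sectionTopology τ hτ.1 hτ.2⟩
  exact @continuous_iff_continuousAt _ _ _ (sectionTopology (S.sections i)) _ |>.2
    fun g => hΓ.tendsto_section hf g

end CorrSystem

namespace CorrSystem

variable {k : ℕ} {V : Type u} [Category.{v} V] [KGraph k V] {S : CorrSystem.{u, v, w₁, w₂} k V}
  {i : S.EmbeddingFamily}

/-! ## The algebraic axioms of Fell bundles -/

variable (S) in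
/-- The identification of fibres over equal elements. -/
def castFibre {g g' : Elem (InfinitePath k V)} (h : g = g') : S.Fibre g ≃ₗᵢ[ℂ] S.Fibre g' :=
  h ▸ LinearIsometryEquiv.refl ℂ (S.Fibre g)

lemma total_mk_castFibre {g g' : Elem (InfinitePath k V)} (h : g = g') (a : S.Fibre g) :
    (⟨g', S.castFibre h a⟩ : Total S.Fibre) = ⟨g, a⟩ := by
  subst h
  rfl

/-- Identities between elements over equal but not identical groupoid elements become identities in
one fibre, where density arguments apply. -/
lemma total_mk_eq_iff {g g' : Elem (InfinitePath k V)} (h : g = g') {a : S.Fibre g}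
    {b : S.Fibre g'} : (⟨g, a⟩ : Total S.Fibre) = ⟨g', b⟩ ↔ S.castFibre h a = b := by
  subst h
  exact ⟨fun h => by cases h; rfl, fun h => by cases h; rfl⟩

lemma castFibre_apply {g g' : Elem (InfinitePath k V)} (h : g = g') {a b c : V} {α : a ⟶ c}
    {β : b ⟶ c} (hg : g ∈ cylinder α β) (hg' : g' ∈ cylinder α β) (T : S.Kpt α β) :
    S.castFibre h (i g ⟨α, β, hg⟩ T) = i g' ⟨α, β, hg'⟩ T := by
  subst h
  rfl

/-- Align `g` with `h`, and then `gh` with `l`. The second alignment extends `(α, γ)` by a segment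
`ν` of the common tail, by which the middle path `β` can be extended too. -/
lemma exists_composable₃ {w x y z : InfinitePath k V} {g : w ⟶ x} {h : x ⟶ y} {l : y ⟶ z}
    (D₁ : Decomp (Elem.mk g)) (D₂ : Decomp (Elem.mk h)) (D₃ : Decomp (Elem.mk l)) :
    ∃ (a b c d e : V) (α : a ⟶ e) (β : b ⟶ e) (γ : c ⟶ e) (δ : d ⟶ e)
      (hg : Elem.mk g ∈ cylinder α β) (hh : Elem.mk h ∈ cylinder β γ)
      (hl : Elem.mk l ∈ cylinder γ δ), D₁ ≤ ⟨α, β, hg⟩ ∧ D₂ ≤ ⟨β, γ, hh⟩ ∧ D₃ ≤ ⟨γ, δ, hl⟩ := by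
  obtain ⟨a, b, c, d, α, β, γ, hg, hh, h1, h2⟩ := D₁.exists_composable D₂
  obtain ⟨a', c', f, e, α', γ', δ, hgh, hl, h3, h4⟩ :=
    (⟨α, γ, mem_cylinder_comp hg hh⟩ : Decomp (Elem.mk (g ≫ h))).exists_composable D₃
  obtain ⟨e', ν, hν, h5⟩ := Decomp.exists_eq_extend h3
  have e1 : Path.mk α' = Path.mk (α ≫ ν) :=
    congrArg (fun D : Decomp (Elem.mk (g ≫ h)) => Path.mk D.α) h5
  have e2 : Path.mk γ' = Path.mk (γ ≫ ν) :=
    congrArg (fun D : Decomp (Elem.mk (g ≫ h)) => Path.mk D.β) h5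
  have hg' : Elem.mk g ∈ cylinder (α ≫ ν) (β ≫ ν) :=
    mem_cylinder_comp_iff.2 ⟨hg, (mem_cylinder_comp_iff.1 hν).2⟩
  -- Write `h = g⁻¹ (gh)` with `g⁻¹ ∈ Z(βν, αν)` and `gh ∈ Z(αν, γν)`.
  have hh' : Elem.mk h ∈ cylinder (β ≫ ν) (γ ≫ ν) := by
    have := mem_cylinder_comp (mem_cylinder_inv hg') hν
    rwa [show Groupoid.inv g ≫ g ≫ h = h by simp [← Category.assoc]] at this
  clear h3 h5
  injection e2 with e3 e4 e5
  subst e3 e4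
  have e5 := eq_of_heq e5
  subst e5
  exact ⟨_, _, _, _, _, α ≫ ν, β ≫ ν, γ ≫ ν, δ, hg', hh', hl,
    h1.trans (Decomp.le_extend ⟨α, β, hg⟩ ν hg'), h2.trans (Decomp.le_extend ⟨β, γ, hh⟩ ν hh'), h4⟩

lemma IsCanonicalEmbedding.induction_on₃ (hS : S.IsRegular) (hi : S.IsCanonicalEmbedding i)
    {w x y z : InfinitePath k V} {g : w ⟶ x} {h : x ⟶ y} {l : y ⟶ z}
    {p : S.Fibre ⟨g⟩ → S.Fibre ⟨h⟩ → S.Fibre ⟨l⟩ → Prop}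
    (hcl : IsClosed {q : S.Fibre ⟨g⟩ × S.Fibre ⟨h⟩ × S.Fibre ⟨l⟩ | p q.1 q.2.1 q.2.2})
    (H : ∀ {a b c d e : V} (α : a ⟶ e) (β : b ⟶ e) (γ : c ⟶ e) (δ : d ⟶ e)
      (hg : Elem.mk g ∈ cylinder α β) (hh : Elem.mk h ∈ cylinder β γ)
      (hl : Elem.mk l ∈ cylinder γ δ) (T₁ : S.Kpt α β) (T₂ : S.Kpt β γ) (T₃ : S.Kpt γ δ),
      p (i ⟨g⟩ ⟨α, β, hg⟩ T₁) (i ⟨h⟩ ⟨β, γ, hh⟩ T₂) (i ⟨l⟩ ⟨γ, δ, hl⟩ T₃))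
    (e₁ : S.Fibre ⟨g⟩) (e₂ : S.Fibre ⟨h⟩) (e₃ : S.Fibre ⟨l⟩) : p e₁ e₂ e₃ := by
  refine closure_minimal ?_ hcl
    ((hi.dense hS ⟨g⟩).prod ((hi.dense hS ⟨h⟩).prod (hi.dense hS ⟨l⟩)) (e₁, e₂, e₃))
  rintro ⟨_, _, _⟩ ⟨⟨D₁, T₁, rfl⟩, ⟨D₂, T₂, rfl⟩, ⟨D₃, T₃, rfl⟩⟩
  obtain ⟨a, b, c, d, e, α, β, γ, δ, hg, hh, hl, h1, h2, h3⟩ := exists_composable₃ D₁ D₂ D₃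
  obtain ⟨R₁, hR₁⟩ := hi.exists_eq_of_le hS h1 T₁
  obtain ⟨R₂, hR₂⟩ := hi.exists_eq_of_le hS h2 T₂
  obtain ⟨R₃, hR₃⟩ := hi.exists_eq_of_le hS h3 T₃
  change p (i ⟨g⟩ D₁ T₁) (i ⟨h⟩ D₂ T₂) (i ⟨l⟩ D₃ T₃)
  rw [← hR₁, ← hR₂, ← hR₃]
  exact H α β γ δ hg hh hl R₁ R₂ R₃

section Algebra

variable {mul : S.MulFamily} {adj : S.AdjFamily}

lemma IsInvolution.apply (hadj : S.IsInvolution i adj) {x y : InfinitePath k V} (g : x ⟶ y)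
    {a b d : V} {α : a ⟶ d} {β : b ⟶ d} (hg : Elem.mk g ∈ cylinder α β) (T : S.Kpt α β) :
    adj g (i ⟨g⟩ ⟨α, β, hg⟩ T) =
      i ⟨Groupoid.inv g⟩ ⟨β, α, mem_cylinder_inv hg⟩ (Compacts.adj T) :=
  hadj g α β hg T _ (Compacts.isAdjointPair_adj T)

lemma IsMultiplication.assoc (hS : S.IsRegular) (hi : S.IsCanonicalEmbedding i)
    (hmul : S.IsMultiplication i mul) {w x y z : InfinitePath k V} (g : w ⟶ x) (h : x ⟶ y)
    (l : y ⟶ z) (a : S.Fibre ⟨g⟩) (b : S.Fibre ⟨h⟩) (c : S.Fibre ⟨l⟩) :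
    (⟨_, mul (g ≫ h) l (mul g h a b) c⟩ : Total S.Fibre) = ⟨_, mul g (h ≫ l) a (mul h l b c)⟩ := by
  rw [total_mk_eq_iff (congrArg Elem.mk (Category.assoc g h l))]
  refine hi.induction_on₃ hS (p := fun a b c =>
    S.castFibre (congrArg Elem.mk (Category.assoc g h l)) (mul (g ≫ h) l (mul g h a b) c) =
      mul g (h ≫ l) a (mul h l b c)) (isClosed_eq ?_ ?_)
    (fun α β γ δ hg hh hl T₁ T₂ T₃ => ?_) a b c
  · refine (S.castFibre _).continuous.comp ?_
    fun_prop
  · fun_prop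
  · rw [hmul g h α β γ hg hh, hmul (g ≫ h) l α γ δ (mem_cylinder_comp hg hh) hl,
      hmul h l β γ δ hh hl, hmul g (h ≫ l) α β δ hg (mem_cylinder_comp hh hl)]
    exact castFibre_apply _ _ _ _

lemma IsMultiplication.norm_le (hS : S.IsRegular) (hi : S.IsCanonicalEmbedding i)
    (hmul : S.IsMultiplication i mul) {x y z : InfinitePath k V} (g : x ⟶ y) (h : y ⟶ z)
    (a : S.Fibre ⟨g⟩) (b : S.Fibre ⟨h⟩) : ‖mul g h a b‖ ≤ ‖a‖ * ‖b‖ := by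
  refine hi.induction_on₂ hS (p := fun a b => ‖mul g h a b‖ ≤ ‖a‖ * ‖b‖)
    (isClosed_le (by fun_prop) (by fun_prop)) (fun α β γ hg hh T T' => ?_) a b
  rw [hmul g h α β γ hg hh, (i _ _).norm_map, (i _ _).norm_map, (i _ _).norm_map]
  exact Compacts.norm_comp_le T T'

lemma IsInvolution.adj_adj (hS : S.IsRegular) (hi : S.IsCanonicalEmbedding i)
    (hadj : S.IsInvolution i adj) {x y : InfinitePath k V} (g : x ⟶ y) (a : S.Fibre ⟨g⟩) :
    (⟨_, adj _ (adj g a)⟩ : Total S.Fibre) = ⟨_, a⟩ := by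
  have e : Groupoid.inv (Groupoid.inv g) = g := Subtype.ext (neg_neg _)
  rw [total_mk_eq_iff (congrArg Elem.mk e)]
  refine hi.induction_on hS (p := fun a =>
    S.castFibre (congrArg Elem.mk e) (adj _ (adj g a)) = a) (isClosed_eq ?_ continuous_id)
    (fun D T => ?_) a
  · exact (S.castFibre _).continuous.comp ((adj _).continuous.comp (adj g).continuous)
  · rw [hadj.apply g D.mem, hadj.apply, Compacts.adj_adj]
    exact castFibre_apply _ _ _ _

lemma IsInvolution.adj_mul (hS : S.IsRegular) (hi : S.IsCanonicalEmbedding i)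
    (hmul : S.IsMultiplication i mul) (hadj : S.IsInvolution i adj)
    {x y z : InfinitePath k V} (g : x ⟶ y) (h : y ⟶ z) (a : S.Fibre ⟨g⟩) (b : S.Fibre ⟨h⟩) :
    (⟨_, adj _ (mul g h a b)⟩ : Total S.Fibre) = ⟨_, mul _ _ (adj h b) (adj g a)⟩ := by
  have e : Groupoid.inv (g ≫ h) = Groupoid.inv h ≫ Groupoid.inv g := Subtype.ext (neg_add_rev _ _)
  rw [total_mk_eq_iff (congrArg Elem.mk e)]
  refine hi.induction_on₂ hS (p := fun a b =>
    S.castFibre (congrArg Elem.mk e) (adj _ (mul g h a b)) = mul _ _ (adj h b) (adj g a))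
    (isClosed_eq ?_ ?_) (fun α β γ hg hh T T' => ?_) a b
  · refine (S.castFibre _).continuous.comp ((adj _).continuous.comp ?_)
    fun_prop
  · exact (mul _ _).continuous₂.comp (((adj h).continuous.comp continuous_snd).prodMk
      ((adj g).continuous.comp continuous_fst))
  · rw [hmul g h α β γ hg hh, hadj.apply, hadj.apply, hadj.apply,
      hmul _ _ γ β α (mem_cylinder_inv hh) (mem_cylinder_inv hg), Compacts.adj_comp]
    exact castFibre_apply _ _ _ _

lemma IsInvolution.norm_adj_mul_self (hS : S.IsRegular) (hi : S.IsCanonicalEmbedding i)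
    (hmul : S.IsMultiplication i mul) (hadj : S.IsInvolution i adj)
    {x y : InfinitePath k V} (g : x ⟶ y) (a : S.Fibre ⟨g⟩) :
    ‖mul _ _ (adj g a) a‖ = ‖a‖ ^ 2 := by
  refine hi.induction_on hS (p := fun a => ‖mul _ _ (adj g a) a‖ = ‖a‖ ^ 2)
    (isClosed_eq ?_ (by fun_prop)) (fun D T => ?_) a
  · exact ((mul _ _).continuous₂.comp ((adj g).continuous.prodMk continuous_id)).norm
  · rw [hadj.apply g D.mem, hmul _ _ D.β D.α D.β (mem_cylinder_inv D.mem) D.mem, (i _ _).norm_map,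
      (i _ _).norm_map]
    exact Compacts.norm_adj_comp_self T

/-! ### The C*-algebra over a unit -/

section Unit

variable (mul adj)

/-- The product of the C*-algebra `E_y`. -/
def unitMul (y : InfinitePath k V) (a b : S.Fibre ⟨𝟙 y⟩) : S.Fibre ⟨𝟙 y⟩ :=
  S.castFibre (congrArg Elem.mk (Category.id_comp (𝟙 y))) (mul (𝟙 y) (𝟙 y) a b)

lemma inv_id_eq (y : InfinitePath k V) : Groupoid.inv (𝟙 y) = 𝟙 y := Subtype.ext neg_zero

/-- The involution of the C*-algebra `E_y`. -/
def unitStar (y : InfinitePath k V) (a : S.Fibre ⟨𝟙 y⟩) : S.Fibre ⟨𝟙 y⟩ :=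
  S.castFibre (congrArg Elem.mk (inv_id_eq y)) (adj (𝟙 y) a)

lemma continuous_unitMul (y : InfinitePath k V) :
    Continuous fun p : S.Fibre ⟨𝟙 y⟩ × S.Fibre ⟨𝟙 y⟩ => unitMul mul y p.1 p.2 :=
  (S.castFibre _).continuous.comp (mul (𝟙 y) (𝟙 y)).continuous₂

lemma continuous_unitStar (y : InfinitePath k V) : Continuous (unitStar adj y) :=
  (S.castFibre _).continuous.comp (adj (𝟙 y)).continuous

variable {mul adj}

lemma mem_cylinder_id_comp {y : InfinitePath k V} {a b c d : V} {α : a ⟶ d} {β : b ⟶ d}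
    {γ : c ⟶ d} (hg : Elem.mk (𝟙 y) ∈ cylinder α β) (hh : Elem.mk (𝟙 y) ∈ cylinder β γ) :
    Elem.mk (𝟙 y) ∈ cylinder α γ := by
  have := mem_cylinder_comp hg hh
  rwa [Category.id_comp] at this

lemma mem_cylinder_id_inv {y : InfinitePath k V} {a b d : V} {α : a ⟶ d} {β : b ⟶ d}
    (hg : Elem.mk (𝟙 y) ∈ cylinder α β) : Elem.mk (𝟙 y) ∈ cylinder β α := by
  have := mem_cylinder_inv hg
  rwa [inv_id_eq] at this

lemma unitMul_apply (hmul : S.IsMultiplication i mul) {y : InfinitePath k V}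
    {a b c d : V} {α : a ⟶ d} {β : b ⟶ d} {γ : c ⟶ d} (hg : Elem.mk (𝟙 y) ∈ cylinder α β)
    (hh : Elem.mk (𝟙 y) ∈ cylinder β γ) (T : S.Kpt α β) (T' : S.Kpt β γ) :
    unitMul mul y (i _ ⟨α, β, hg⟩ T) (i _ ⟨β, γ, hh⟩ T') =
      i _ ⟨α, γ, mem_cylinder_id_comp hg hh⟩ (Compacts.comp T T') := by
  rw [unitMul, hmul _ _ α β γ hg hh]
  exact castFibre_apply _ _ _ _

lemma unitStar_apply (hadj : S.IsInvolution i adj) {y : InfinitePath k V}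
    {a b d : V} {α : a ⟶ d} {β : b ⟶ d} (hg : Elem.mk (𝟙 y) ∈ cylinder α β) (T : S.Kpt α β) :
    unitStar adj y (i _ ⟨α, β, hg⟩ T) = i _ ⟨β, α, mem_cylinder_id_inv hg⟩ (Compacts.adj T) := by
  rw [unitStar, hadj.apply _ hg]
  exact castFibre_apply _ _ _ _

/-- The fibre over a unit is a C*-algebra. -/
@[reducible] def unitCStarAlgebra (hS : S.IsRegular) (hi : S.IsCanonicalEmbedding i)
    (hmul : S.IsMultiplication i mul) (hadj : S.IsInvolution i adj) (y : InfinitePath k V) :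
    NonUnitalCStarAlgebra (S.Fibre ⟨𝟙 y⟩) :=
  { (inferInstance : NormedAddCommGroup (S.Fibre ⟨𝟙 y⟩)),
    (inferInstance : NormedSpace ℂ (S.Fibre ⟨𝟙 y⟩)) with
    mul := unitMul mul y
    left_distrib := fun a b c => by
      change unitMul mul y a (b + c) = unitMul mul y a b + unitMul mul y a c
      simp only [unitMul, map_add]
    right_distrib := fun a b c => by
      change unitMul mul y (a + b) c = unitMul mul y a c + unitMul mul y b c
      simp only [unitMul, map_add, add_apply]
    zero_mul := fun a => by
      change unitMul mul y 0 a = 0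
      simp only [unitMul, map_zero, zero_apply]
    mul_zero := fun a => by
      change unitMul mul y a 0 = 0
      simp only [unitMul, map_zero]
    mul_assoc := fun a b c => by
      refine hi.induction_on₃ hS (p := fun a b c => unitMul mul y (unitMul mul y a b) c =
        unitMul mul y a (unitMul mul y b c)) (isClosed_eq ?_ ?_)
        (fun α β γ δ hg hh hl T₁ T₂ T₃ => ?_) a b c
      · exact (continuous_unitMul mul y).comp (((continuous_unitMul mul y).comp
          (continuous_fst.prodMk continuous_snd.fst)).prodMk continuous_snd.snd)
      · exact (continuous_unitMul mul y).comp (continuous_fst.prodMk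
          ((continuous_unitMul mul y).comp continuous_snd))
      · rw [unitMul_apply hmul hg hh, unitMul_apply hmul _ hl, unitMul_apply hmul hh hl,
          unitMul_apply hmul hg]
        rfl
    norm_mul_le := fun a b => by
      change ‖unitMul mul y a b‖ ≤ _
      rw [unitMul, LinearIsometryEquiv.norm_map]
      exact hmul.norm_le hS hi _ _ a b
    star := unitStar adj y
    star_involutive := fun a => by
      refine hi.induction_on hS (p := fun a => unitStar adj y (unitStar adj y a) = a)
        (isClosed_eq ((continuous_unitStar adj y).comp (continuous_unitStar adj y)) continuous_id)
        (fun D T => ?_) a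
      rw [unitStar_apply hadj D.mem, unitStar_apply hadj, Compacts.adj_adj]
    star_mul := fun a b => by
      refine hi.induction_on₂ hS (p := fun a b => unitStar adj y (unitMul mul y a b) =
        unitMul mul y (unitStar adj y b) (unitStar adj y a)) (isClosed_eq ?_ ?_)
        (fun α β γ hg hh T T' => ?_) a b
      · exact (continuous_unitStar adj y).comp (continuous_unitMul mul y)
      · exact (continuous_unitMul mul y).comp (((continuous_unitStar adj y).comp
          continuous_snd).prodMk ((continuous_unitStar adj y).comp continuous_fst))
      · rw [unitMul_apply hmul hg hh, unitStar_apply hadj, unitStar_apply hadj hg,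
          unitStar_apply hadj hh, unitMul_apply hmul, Compacts.adj_comp]
    star_add := fun a b => by
      change unitStar adj y (a + b) = unitStar adj y a + unitStar adj y b
      simp only [unitStar, map_add]
    complete := (inferInstance : CompleteSpace (S.Fibre ⟨𝟙 y⟩)).complete
    norm_mul_self_le := fun a => by
      refine le_of_eq ?_
      refine hi.induction_on hS (p := fun a => ‖a‖ * ‖a‖ =
        ‖unitMul mul y (unitStar adj y a) a‖) (isClosed_eq (by fun_prop) ?_) (fun D T => ?_) a
      · exact ((continuous_unitMul mul y).comp
          ((continuous_unitStar adj y).prodMk continuous_id)).norm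
      · rw [unitStar_apply hadj D.mem, unitMul_apply hmul _ D.mem, (i _ _).norm_map,
          (i _ _).norm_map, ← sq]
        exact (Compacts.norm_adj_comp_self T).symm
    smul_assoc := fun t a b => by
      change unitMul mul y (t • a) b = t • unitMul mul y a b
      simp only [unitMul, map_smul, smul_apply]
    smul_comm := fun t a b => by
      change t • unitMul mul y a b = unitMul mul y a (t • b)
      simp only [unitMul, map_smul]
    star_smul := fun t a => by
      change unitStar adj y (t • a) = star t • unitStar adj y a
      simp only [unitStar, map_smulₛₗ]
      rfl }

lemma total_mk_mul_castFibre {x y z : InfinitePath k V} {g g' : x ⟶ y} (e : g = g') (h : y ⟶ z)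
    (a : S.Fibre ⟨g⟩) (b : S.Fibre ⟨h⟩) :
    (⟨_, mul g' h (S.castFibre (congrArg Elem.mk e) a) b⟩ : Total S.Fibre) =
      ⟨_, mul g h a b⟩ := by
  subst e
  rfl

/-- The positive cone of the C*-algebra `E_y` is closed, so `a` may be taken to be the image of an
operator. -/
lemma IsInvolution.adj_mul_self_pos (hS : S.IsRegular) (hi : S.IsCanonicalEmbedding i)
    (hmul : S.IsMultiplication i mul) (hadj : S.IsInvolution i adj)
    {x y : InfinitePath k V} (g : x ⟶ y) (a : S.Fibre ⟨g⟩) : ∃ b : S.Fibre ⟨𝟙 y⟩,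
    (⟨_, mul _ _ (adj g a) a⟩ : Total S.Fibre) = ⟨_, mul _ _ (adj (𝟙 y) b) b⟩ := by
  let _ := unitCStarAlgebra hS hi hmul hadj y
  let _ := CStarAlgebra.spectralOrder (S.Fibre ⟨𝟙 y⟩)
  have := CStarAlgebra.spectralOrderedRing (S.Fibre ⟨𝟙 y⟩)
  have e : Groupoid.inv g ≫ g = 𝟙 y := Groupoid.inv_comp g
  have hpos : 0 ≤ S.castFibre (congrArg Elem.mk e) (mul _ _ (adj g a) a) := by
    refine hi.induction_on hS (p := fun a =>
      0 ≤ S.castFibre (congrArg Elem.mk e) (mul _ _ (adj g a) a)) ?_ (fun D T => ?_) a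
    · have hcl : IsClosed {c : S.Fibre ⟨𝟙 y⟩ | 0 ≤ c} :=
        CStarAlgebra.isClosed_nonneg (A := S.Fibre ⟨𝟙 y⟩)
      have hc : Continuous fun a : S.Fibre ⟨g⟩ =>
          S.castFibre (congrArg Elem.mk e) (mul _ _ (adj g a) a) :=
        (S.castFibre _).continuous.comp
          ((mul _ _).continuous₂.comp ((adj g).continuous.prodMk continuous_id))
      exact hcl.preimage hc
    -- `T` itself lives over `g`, not over the unit; replacing `T⋆ T` by `R⋆ R` with `R ∈ K(X_β)`
    -- gives a square inside `E_y`.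
    · obtain ⟨R, hR⟩ := Compacts.exists_adj_comp_self_eq T
      have hmem : Elem.mk (𝟙 y) ∈ cylinder D.β D.β := by
        have := mem_cylinder_comp (mem_cylinder_inv D.mem) D.mem
        rwa [e] at this
      rw [hadj.apply g D.mem, hmul _ _ D.β D.α D.β (mem_cylinder_inv D.mem) D.mem, hR,
        castFibre_apply _ _ hmem]
      have h1 : i ⟨𝟙 y⟩ ⟨D.β, D.β, hmem⟩ (Compacts.comp (Compacts.adj R) R) =
          star (i ⟨𝟙 y⟩ ⟨D.β, D.β, hmem⟩ R) * i ⟨𝟙 y⟩ ⟨D.β, D.β, hmem⟩ R := by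
        change _ = unitMul mul y (unitStar adj y _) _
        rw [unitStar_apply hadj, unitMul_apply hmul]
      rw [h1]
      exact star_mul_self_nonneg _
  obtain ⟨b, hb⟩ := CStarAlgebra.nonneg_iff_eq_star_mul_self.1 hpos
  refine ⟨b, ?_⟩
  -- The operations of `E_y` are `mul` and `adj` up to casts along `1 · 1 = 1` and `1⁻¹ = 1`; the
  -- casts disappear in the total space.
  rw [← total_mk_castFibre (congrArg Elem.mk e), hb,
    ← total_mk_mul_castFibre (mul := mul) (inv_id_eq y) (𝟙 y)]
  exact total_mk_castFibre (congrArg Elem.mk (Category.id_comp (𝟙 y))) _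

end Unit

end Algebra

end CorrSystem

/-! ## Saturation -/

section Modules

variable {B : Type*} [NonUnitalCStarAlgebra B] {X Y Z : Type*}
  [NormedAddCommGroup X] [NormedSpace ℂ X] [CompleteSpace X] [RightHilbertModule B X]
  [NormedAddCommGroup Y] [NormedSpace ℂ Y] [CompleteSpace Y] [RightHilbertModule B Y]
  [NormedAddCommGroup Z] [NormedSpace ℂ Z] [CompleteSpace Z] [RightHilbertModule B Z]

variable (B Z) in
/-- The operators `θ_{z, x}` depend continuously and linearly on `z`. -/
def rankOneL (x : X) : Z →L[ℂ] (X →L[ℂ] Z) :=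
  LinearMap.mkContinuous
    { toFun := fun z => rankOne B z x
      map_add' := fun z z' => by
        ext w
        simp [add_rmul]
      map_smul' := fun t z => by
        ext w
        simp [smul_rmul] } ‖x‖ fun z => (norm_rankOne_le z x).trans_eq (mul_comm _ _)

/-- If `Y` is full, then the operators that factor through `Y` are total in `K(X, Z)`. -/
lemma Compacts.mem_of_forall_comp_mem (hY : IsFull B Y) {N : Submodule ℂ (Compacts B X Z)}
    (hN : IsClosed (N : Set (Compacts B X Z)))
    (h : ∀ (P : Compacts B Y Z) (Q : Compacts B X Y), Compacts.comp P Q ∈ N)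
    (T : Compacts B X Z) : T ∈ N := by
  have hcl : IsClosed (N.map (Compacts B X Z).subtype : Set (X →L[ℂ] Z)) :=
    (Submodule.isClosed_topologicalClosure
      (Submodule.span ℂ {T : X →L[ℂ] Z | IsRankOne B T})).isClosedEmbedding_subtypeVal.isClosedMap
      _ hN
  -- For `b = ⟨y, y'⟩` the operator is the product `θ_{z, y} θ_{y', x}`, and such `b` span a dense
  -- subspace. In `h2` every `z` is then approximated by elements `z b`.
  have h1 : ∀ (z : Z) (x : X) (b : B),
      rankOneL B Z x (rmulL B Z z b) ∈ N.map (Compacts B X Z).subtype := by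
    intro z x b
    have hcont : Continuous fun b => rankOneL B Z x (rmulL B Z z b) :=
      (rankOneL B Z x).continuous.comp (rmulL B Z z).continuous
    refine closure_minimal ?_ (hcl.preimage hcont) (hY b)
    change Submodule.span ℂ _ ≤ (N.map (Compacts B X Z).subtype).comap
      ((rankOneL B Z x).comp (rmulL B Z z)).toLinearMap
    refine Submodule.span_le.2 ?_
    rintro _ ⟨y, y', rfl⟩
    refine ⟨_, h ⟨_, rankOne_mem_compacts z y⟩ ⟨_, rankOne_mem_compacts y' x⟩, ?_⟩
    ext w
    change rmul z (hinner y (rmul y' (hinner x w))) = rmul (rmul z (hinner y y')) (hinner x w)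
    rw [hinner_rmul, rmul_rmul]
  have h2 : ∀ (z : Z) (x : X), rankOne B z x ∈ N.map (Compacts B X Z).subtype := by
    intro z x
    refine (hcl.preimage (rankOneL B Z x).continuous).closure_subset
      (Metric.mem_closure_iff.2 fun ε hε => ?_)
    obtain ⟨b, hb⟩ := exists_norm_rmul_sub_lt B z hε
    exact ⟨rmul z b, h1 z x b, by rwa [dist_comm, dist_eq_norm]⟩
  have h3 : Compacts B X Z ≤ N.map (Compacts B X Z).subtype := by
    refine Submodule.topologicalClosure_minimal _ (Submodule.span_le.2 fun R hR => ?_) hcl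
    obtain ⟨z, x, rfl⟩ := hR.exists_eq
    exact h2 z x
  obtain ⟨R, hR, hRT⟩ := h3 T.2
  rwa [← Subtype.ext hRT]

end Modules

namespace CorrSystem

variable {k : ℕ} {V : Type u} [Category.{v} V] [KGraph k V] {S : CorrSystem.{u, v, w₁, w₂} k V}
  {i : S.EmbeddingFamily} {mul : S.MulFamily} {adj : S.AdjFamily}

/-- For composable decompositions, fullness of `X_β` makes `K(X_β, X_α) K(X_γ, X_β)` total in
`K(X_γ, X_α)`. -/
lemma IsMultiplication.isSaturated (hS : S.IsRegular) (hi : S.IsCanonicalEmbedding i)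
    (hmul : S.IsMultiplication i mul) :
    IsSaturated S.Fibre (fun g h e e' => mul g h e e') := by
  intro x y z g h
  set M := (Submodule.span ℂ {e : S.Fibre ⟨g ≫ h⟩ | ∃ a b, e = mul g h a b}).topologicalClosure
    with hM
  have hcl : IsClosed (M : Set (S.Fibre ⟨g ≫ h⟩)) := Submodule.isClosed_topologicalClosure _
  have key : ∀ (Q : ComposableDecomp g h) (T : S.Kpt Q.α Q.γ), i ⟨g ≫ h⟩ Q.prod T ∈ M := by
    intro Q T
    refine Compacts.mem_of_forall_comp_mem (hS.full Q.β)
      (N := M.comap (i ⟨g ≫ h⟩ Q.prod).toLinearMap)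
      (hcl.preimage (i ⟨g ≫ h⟩ Q.prod).continuous) (fun P R => ?_) T
    refine Submodule.le_topologicalClosure _ (Submodule.subset_span ?_)
    exact ⟨_, _, (hmul g h Q.α Q.β Q.γ Q.memg Q.memh P R).symm⟩
  refine fun e => hi.induction_on hS (p := fun e => e ∈ M) hcl (fun D T => ?_) e
  obtain ⟨Q⟩ : Nonempty (ComposableDecomp g h) := inferInstance
  obtain ⟨D', h1, h2⟩ := exists_ge_ge D Q.prod
  -- A general decomposition of `gh` has no middle path. Far enough out it extends `(α, γ)` by some
  -- `ν`, and `βν` is the missing path.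
  obtain ⟨d, ν, hν, rfl⟩ := Decomp.exists_eq_extend h2
  have hg : Elem.mk g ∈ cylinder (Q.α ≫ ν) (Q.β ≫ ν) :=
    mem_cylinder_comp_iff.2 ⟨Q.memg, (mem_cylinder_comp_iff.1 hν).2⟩
  have hh : Elem.mk h ∈ cylinder (Q.β ≫ ν) (Q.γ ≫ ν) := by
    have := mem_cylinder_comp (mem_cylinder_inv hg) hν
    rwa [show Groupoid.inv g ≫ g ≫ h = h by simp [← Category.assoc]] at this
  obtain ⟨R, hR⟩ := hi.exists_eq_of_le hS h1 T
  rw [← hR]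
  exact key ⟨_, _, _, hg, hh⟩ R

/-! ## Continuity of the operations -/

/-- Over `Z(α, β)` the involution preserves distances and carries the section of `T` to that of
`T⋆`, so closeness to the former becomes closeness to the latter. -/
lemma IsInvolution.continuous_adj (hS : S.IsRegular) (hi : S.IsCanonicalEmbedding i)
    (hadj : S.IsInvolution i adj) :
    Continuous[sectionTopology (S.sections i), sectionTopology (S.sections i)]
      fun e : Total S.Fibre => (⟨_, adj e.base.hom e.val⟩ : Total S.Fibre) := by
  let _ := sectionTopology (S.sections i)
  have hΓ := hi.isGeneratingSections hS
  refine continuous_iff_continuousAt.2 fun e => ?_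
  have hid : Tendsto (fun e' : Total S.Fibre => e') (𝓝 e) (𝓝 e) := tendsto_id
  have hbase := (tendsto_sectionTopology_iff.1 hid).1
  refine hΓ.tendsto_of_forall_lt ((continuous_inv_pathGroupoid.tendsto e.base).comp hbase)
    fun ε hε => ?_
  obtain ⟨_, ⟨D, T, rfl⟩, hT⟩ := Metric.mem_closure_iff.1 (hi.dense hS e.base e.val) ε hε
  rw [dist_eq_norm, ← basicSection_apply i T D.mem] at hT
  have hnorm : ∀ e' : Total S.Fibre, e'.base ∈ cylinder D.α D.β →
      ‖adj e'.base.hom e'.val -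
        S.basicSection i D.β D.α (Compacts.adj T) ⟨Groupoid.inv e'.base.hom⟩‖ =
      ‖e'.val - S.basicSection i D.α D.β T e'.base‖ := by
    intro e' he'
    rw [basicSection_apply i T he', basicSection_apply i _ (mem_cylinder_inv he'),
      ← hadj.apply e'.base.hom he', ← map_sub, (adj _).norm_map]
  refine ⟨_, basicSection_mem i D.β D.α (Compacts.adj T), (hnorm e D.mem).trans_lt hT, ?_⟩
  filter_upwards [hbase (cylinder_mem_nhds D.mem),
    eventually_norm_sub_lt_of_tendsto hid (basicSection_mem i D.α D.β T) hT] with e' h1 h2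
  exact (hnorm e' h1).trans_lt h2

/-- Apart from the two errors, the bound involves only the norms of `a'` and `b'`; for values of
basic sections on their cylinders these are constant. -/
lemma IsMultiplication.norm_mul_sub_le (hS : S.IsRegular) (hi : S.IsCanonicalEmbedding i)
    (hmul : S.IsMultiplication i mul) {x y z : InfinitePath k V} (g : x ⟶ y) (h : y ⟶ z)
    (a a' : S.Fibre ⟨g⟩) (b b' : S.Fibre ⟨h⟩) :
    ‖mul g h a b - mul g h a' b'‖ ≤ ‖a - a'‖ * (‖b - b'‖ + ‖b'‖) + ‖a'‖ * ‖b - b'‖ := by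
  have e : mul g h a b - mul g h a' b' = mul g h (a - a') b + mul g h a' (b - b') := by
    simp
  rw [e]
  refine (norm_add_le _ _).trans (add_le_add ((hmul.norm_le hS hi _ _ _ _).trans ?_)
    (hmul.norm_le hS hi _ _ _ _))
  gcongr
  simpa using norm_add_le (b - b') b'

lemma IsMultiplication.continuous_mul (hS : S.IsRegular) (hi : S.IsCanonicalEmbedding i)
    (hmul : S.IsMultiplication i mul) [τ : TopologicalSpace (Total S.Fibre)]
    (hτ : τ = sectionTopology (S.sections i)) :
    Continuous[TopologicalSpace.induced (fun p : BundlePair S.Fibre =>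
      ((⟨_, p.e₁⟩, ⟨_, p.e₂⟩) : Total S.Fibre × Total S.Fibre)) inferInstance, inferInstance]
      fun p : BundlePair S.Fibre => (⟨_, mul p.fst p.snd p.e₁ p.e₂⟩ : Total S.Fibre) := by
  subst hτ
  let _ := sectionTopology (S.sections i)
  have hΓ := hi.isGeneratingSections hS
  let _ : TopologicalSpace (BundlePair S.Fibre) := TopologicalSpace.induced
    (fun p : BundlePair S.Fibre =>
      ((⟨_, p.e₁⟩, ⟨_, p.e₂⟩) : Total S.Fibre × Total S.Fibre)) inferInstance
  have hc : Continuous fun p : BundlePair S.Fibre =>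
    ((⟨_, p.e₁⟩, ⟨_, p.e₂⟩) : Total S.Fibre × Total S.Fibre) := continuous_induced_dom
  refine continuous_iff_continuousAt.2 fun p => ?_
  have h1 := hc.fst.continuousAt (x := p)
  have h2 := hc.snd.continuousAt (x := p)
  have hb1 := (tendsto_sectionTopology_iff.1 h1).1
  have hb2 := (tendsto_sectionTopology_iff.1 h2).1
  refine hΓ.tendsto_of_forall_lt (tendsto_mul_pathGroupoid
    (fun q : BundlePair S.Fibre => ⟨q.fst, q.snd⟩) p.fst p.snd hb1 hb2) fun ε hε => ?_
  -- With errors below `δ ≤ 1` and approximants of norm at most `‖e₁‖ + 1` and `‖e₂‖ + 1`, the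
  -- product changes by at most `δ (‖e₁‖ + ‖e₂‖ + 3)`. The constant `4` makes the inequality strict.
  set K := ‖p.e₁‖ + ‖p.e₂‖ + 4 with hK
  have hKpos : 0 < K := by positivity
  set δ := min 1 (ε / K) with hδ
  have hδpos : 0 < δ := by positivity
  have hδ1 : δ ≤ 1 := min_le_left _ _
  have hδK : δ * K ≤ ε := (le_div_iff₀ hKpos).1 (min_le_right _ _)
  obtain ⟨_, ⟨D₁, T₁, rfl⟩, hT₁⟩ := Metric.mem_closure_iff.1 (hi.dense hS ⟨p.fst⟩ p.e₁) δ hδpos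
  obtain ⟨_, ⟨D₂, T₂, rfl⟩, hT₂⟩ := Metric.mem_closure_iff.1 (hi.dense hS ⟨p.snd⟩ p.e₂) δ hδpos
  obtain ⟨a, b, c, d, α, β, γ, hg, hh, hle1, hle2⟩ := D₁.exists_composable D₂
  obtain ⟨R₁, hR₁⟩ := hi.exists_eq_of_le hS hle1 T₁
  obtain ⟨R₂, hR₂⟩ := hi.exists_eq_of_le hS hle2 T₂
  rw [← hR₁, dist_eq_norm] at hT₁
  rw [← hR₂, dist_eq_norm] at hT₂
  have hn1 : ‖R₁‖ ≤ ‖p.e₁‖ + 1 := by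
    rw [← (i ⟨p.fst⟩ ⟨α, β, hg⟩).norm_map R₁]
    have := norm_sub_norm_le (i ⟨p.fst⟩ ⟨α, β, hg⟩ R₁) p.e₁
    rw [norm_sub_rev] at this
    linarith
  have hn2 : ‖R₂‖ ≤ ‖p.e₂‖ + 1 := by
    rw [← (i ⟨p.snd⟩ ⟨β, γ, hh⟩).norm_map R₂]
    have := norm_sub_norm_le (i ⟨p.snd⟩ ⟨β, γ, hh⟩ R₂) p.e₂
    rw [norm_sub_rev] at this
    linarith
  have key : ∀ q : BundlePair S.Fibre, Elem.mk q.fst ∈ cylinder α β →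
      Elem.mk q.snd ∈ cylinder β γ → ‖q.e₁ - S.basicSection i α β R₁ ⟨q.fst⟩‖ < δ →
      ‖q.e₂ - S.basicSection i β γ R₂ ⟨q.snd⟩‖ < δ →
      ‖mul q.fst q.snd q.e₁ q.e₂ -
        S.basicSection i α γ (Compacts.comp R₁ R₂) ⟨q.fst ≫ q.snd⟩‖ < ε := by
    intro q hq1 hq2 hd1 hd2
    rw [basicSection_apply i R₁ hq1] at hd1
    rw [basicSection_apply i R₂ hq2] at hd2
    rw [basicSection_apply i _ (mem_cylinder_comp hq1 hq2), ← hmul q.fst q.snd α β γ hq1 hq2]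
    refine (hmul.norm_mul_sub_le hS hi _ _ _ _ _ _).trans_lt ?_
    rw [(i _ _).norm_map, (i _ _).norm_map]
    calc _ ≤ δ * (1 + (‖p.e₂‖ + 1)) + (‖p.e₁‖ + 1) * δ := by
          gcongr
          exact hd2.le.trans hδ1
      _ < δ * K := by rw [hK]; nlinarith
      _ ≤ ε := hδK
  rw [← basicSection_apply i R₁ hg] at hT₁
  rw [← basicSection_apply i R₂ hh] at hT₂
  refine ⟨_, basicSection_mem i α γ (Compacts.comp R₁ R₂), key p hg hh hT₁ hT₂, ?_⟩
  filter_upwards [hb1 (cylinder_mem_nhds hg), hb2 (cylinder_mem_nhds hh),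
    eventually_norm_sub_lt_of_tendsto h1 (basicSection_mem i α β R₁) hT₁,
    eventually_norm_sub_lt_of_tendsto h2 (basicSection_mem i β γ R₂) hT₂] with q q1 q2 q3 q4
  exact key q q1 q2 q3 q4

/-! ### The Fell bundle. -/

lemma isFellBundle (hS : S.IsRegular) (hi : S.IsCanonicalEmbedding i)
    (hmul : S.IsMultiplication i mul) (hadj : S.IsInvolution i adj)
    [τ : TopologicalSpace (Total S.Fibre)] (hτ : S.IsBundleTopology i τ) :
    IsFellBundle S.Fibre (fun g h e e' => mul g h e e') (fun g e => adj g e) where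
  base_groupoid := isLocallyCompactHausdorffGroupoid hS.rowFinite
  banach_bundle := hτ.1
  -- Uniqueness identifies an arbitrary bundle topology with `sectionTopology`, for which continuity
  -- is known.
  continuous_mul := hmul.continuous_mul hS hi
    ((hi.isGeneratingSections hS).eq_sectionTopology τ hτ.1 hτ.2)
  add_mul g h a a' b := by rw [map_add, add_apply]
  mul_add g h a b b' := map_add _ _ _
  smul_mul g h t a b := by rw [map_smul, smul_apply]
  mul_smul g h t a b := map_smul _ _ _
  mul_assoc g h l a b c := hmul.assoc hS hi g h l a b c
  norm_mul_le g h a b := hmul.norm_le hS hi g h a b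
  continuous_adj := by
    obtain rfl := (hi.isGeneratingSections hS).eq_sectionTopology τ hτ.1 hτ.2
    exact hadj.continuous_adj hS hi
  adj_add g a b := map_add _ _ _
  adj_smul g t a := map_smulₛₗ _ _ _
  adj_adj g a := hadj.adj_adj hS hi g a
  adj_mul g h a b := hadj.adj_mul hS hi hmul g h a b
  norm_adj_mul_self g a := hadj.norm_adj_mul_self hS hi hmul g a
  adj_mul_self_pos g a := hadj.adj_mul_self_pos hS hi hmul g a

end CorrSystem

end GraphCorr

end

theorem theorem4p3p1 {k : ℕ} {V : Type u} [Category.{v} V] [GraphCorr.KGraph k V]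
    (S : GraphCorr.CorrSystem.{u, v, w₁, w₂} k V) (hS : S.IsRegular) :
    -- the canonical maps of `K(X_β, X_α)` into the inductive limit `E_g` are isometries
    (∃! i : S.EmbeddingFamily, S.IsCanonicalEmbedding i) ∧
    ∀ i : S.EmbeddingFamily, S.IsCanonicalEmbedding i →
      -- the multiplication, the involution and the topology are well defined
      (∃! mul : S.MulFamily, S.IsMultiplication i mul) ∧
      (∃! adj : S.AdjFamily, S.IsInvolution i adj) ∧
      (∃! τ : TopologicalSpace (GraphCorr.Total S.Fibre), S.IsBundleTopology i τ) ∧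
      -- with these, the disjoint union of the `E_g` is a saturated Fell bundle
      ∀ (mul : S.MulFamily) (adj : S.AdjFamily)
        (τ : TopologicalSpace (GraphCorr.Total S.Fibre)),
        S.IsMultiplication i mul → S.IsInvolution i adj → S.IsBundleTopology i τ →
          GraphCorr.IsFellBundle S.Fibre (fun g h e e' => mul g h e e') (fun g e => adj g e) ∧
          GraphCorr.IsSaturated S.Fibre (fun g h e e' => mul g h e e') :=
  ⟨GraphCorr.CorrSystem.existsUnique_isCanonicalEmbedding hS, fun _ hi =>
    ⟨GraphCorr.CorrSystem.existsUnique_isMultiplication hS hi,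
      GraphCorr.CorrSystem.existsUnique_isInvolution hS hi,
      GraphCorr.CorrSystem.existsUnique_isBundleTopology hS hi,
      fun _ _ _ hmul hadj hτ => ⟨GraphCorr.CorrSystem.isFellBundle hS hi hmul hadj hτ,
        hmul.isSaturated hS hi⟩⟩⟩
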